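/- Let $\Bbbk$ be an algebraically closed field of characteristic $0$. For a finite abelian group $G$ and $g,h\in G$ let $Q(G,g+h)$ be the Hopf quiver with vertex set $G$ and, for every $x\in G$, two arrows $x\to gx$ and $x\to hx$ (two different arrows even if $g=h$); let $X:1\to g$ and $Y:1\to h$ be the two arrows starting at the unit. A *graded Majid algebra structure* on the path coalgebra $\Bbbk Q(G,g+h)$ *with associator* $\Phi$, where $\Phi$ is a normalized $3$-cocycle on $G$, is a Majid algebra (coquasi-Hopf algebra) structure on this coalgebra whose vertices multiply as in $G$ with unit $1\in G$, whose multiplication and antipode map $S$ preserve the grading by path length, whose associator is $\Phi$ on vertices and is $0$ on triples of paths not all of length $0$, and whose antipode functionals $\alpha,\beta$ vanish on paths of positive length. In such a structure write $f\triangleright v=(f\cdot v)\cdot f^{-1}$ for $f\in G$. Let $M$ be the Majid subalgebra generated by $G$, $X$ and $Y$. We say that $M$ satisfies (R1–R2) if it is finite dimensional, (R1) it is generated by the abelian group $G$ of group-like elements and the two skew-primitive elements $X,Y$, and (R2) $XY=qYX$ for some $q\in\Bbbk^*$. 1. Let $m,n>1$, let $\zeta_m,\zeta_n\in\Bbbk$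 be primitive $m$-th and $n$-th roots of unity, let $G=\mathbb Z_m\times\mathbb Z_n=\langle g\rangle\times\langle h\rangle$, let $0\le a<m$, $0\le b<\gcd(m,n)$, $0\le c<n$, and for $0\le i,s,k<m$, $0\le j,t,l<n$ put $$\Phi_{a,b,c}(g^ih^j,g^sh^t,g^kh^l)=\zeta_m^{a\lfloor (k+s)/m\rfloor i}\,\zeta_n^{b\lfloor (k+s)/m\rfloor j}\,\zeta_n^{c\lfloor (t+l)/n\rfloor j}.$$ Let $\lambda_1,\eta_2\in\Bbbk$. Then $\Bbbk Q(\mathbb Z_m\times\mathbb Z_n,g+h)$ admits a graded Majid algebra structure with associator $\Phi_{a,b,c}$ such that $g\triangleright X=\lambda_1X$, $h\triangleright Y=\eta_2Y$ and $M$ satisfies (R1–R2), if and only if $\lambda_1^m=\zeta_m^a$, $\eta_2^n=\zeta_n^c$, the congruence $$mx+ny+(m+1)b\equiv 0 \pmod{mn}$$ has a solution $(x,y)\in\mathbb Z\times\mathbb Z$, and $\lambda_1\ne 1$, $\eta_2\neq 1$. 2. Let $m>1$, let $\zeta_m\in\Bbbk$ be a primitive $m$-th root of unity and $\zeta_{m^2}\in\Bbbk$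 an $m$-th root of $\zeta_m$, let $G=\mathbb Z_m=\langle e\rangle$, $g=e^\alpha$, $h=e^\beta$ with $0<\alpha,\beta<m$ and $\gcd(\alpha,\beta)=1$, let $0\le a<m$, and for $0\le i,j,k<m$ put $\Phi_a(e^i,e^j,e^k)=\zeta_m^{a\lfloor (j+k)/m\rfloor i}$. Let $\mu_1,\mu_2\in\Bbbk$. Then $\Bbbk Q(\mathbb Z_m,e^\alpha+e^\beta)$ admits a graded Majid algebra structure with associator $\Phi_a$ such that $e\triangleright X=\mu_1X$, $e\triangleright Y=\mu_2Y$ and $M$ satisfies (R1–R2), if and only if the congruence $$m(\beta x+\alpha y+2a\alpha\beta)+2a\alpha\beta\equiv 0 \pmod{m^2}$$ has a solution $(x,y)\in\mathbb Z\times\mathbb Z$ with $\mu_1=\zeta_{m^2}^{a\alpha}\zeta_m^x$ and $\mu_2=\zeta_{m^2}^{a\beta}\zeta_m^y$, and $\mu_1^\alpha\neq1$, $\mu_2^\beta\neq 1$. -/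

import Mathlib

open scoped TensorProduct

noncomputable section

/-! ## Hopf quivers of finite abelian groups and their path coalgebras

Abelian groups are written additively.  For a family `r : ι → G`, the Hopf quiver
`Q(G, ∑ i, r i)` has vertex set `G` and, for every vertex `x` and every `i : ι`, one arrow
`x → r i + x`.  A path `aₗ ⋯ a₁` is therefore the same thing as its source together with the list
of the labels in `ι` of `aₗ, …, a₁` (in this order: the last arrow comes first). -/

/-- Paths of the Hopf quiver attached to a family `r : ι → G`: a source, and the word of labels
of the arrows, the last arrow first. -/
abbrev HopfPath (G ι : Type*) : Type _ := G × List ι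

namespace HopfPath

variable {G ι : Type*} [AddCommGroup G]

/-- The trivial path at a vertex. -/
def vertex (x : G) : HopfPath G ι := (x, [])

/-- The arrow `x → r i + x`. -/
def arrow (x : G) (i : ι) : HopfPath G ι := (x, [i])

/-- The length of a path. -/
def length (p : HopfPath G ι) : ℕ := p.2.length

/-- The end vertex of a path. -/
def target (r : ι → G) (p : HopfPath G ι) : G := (p.2.map r).sum + p.1

/-- The initial part of a path `p`, obtained by deleting its last `j` arrows. -/
def initial (j : ℕ) (p : HopfPath G ι) : HopfPath G ι := (p.1, p.2.drop j)

/-- The final part of a path `p`, consisting of its last `j` arrows. -/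
def final (r : ι → G) (j : ℕ) (p : HopfPath G ι) : HopfPath G ι :=
  (target r (initial j p), p.2.take j)

end HopfPath

/-- The underlying vector space `𝕜Q` of the path coalgebra: the free vector space on the set of
paths. -/
def PathCoalgebra (k : Type*) [Field k] {G ι : Type*} (_r : ι → G) : Type _ :=
  HopfPath G ι →₀ k

namespace PathCoalgebra

variable {k : Type*} [Field k] {G ι : Type*}

instance (r : ι → G) : AddCommGroup (PathCoalgebra k r) :=
  inferInstanceAs (AddCommGroup (HopfPath G ι →₀ k))

instance (r : ι → G) : Module k (PathCoalgebra k r) :=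
  inferInstanceAs (Module k (HopfPath G ι →₀ k))

/-- The basis of paths. -/
def basis (k : Type*) [Field k] {G ι : Type*} (r : ι → G) :
    Module.Basis (HopfPath G ι) k (PathCoalgebra k r) :=
  Module.Basis.ofRepr (LinearEquiv.refl k (HopfPath G ι →₀ k))

/-- A path as an element of the path coalgebra. -/
def ofPath (k : Type*) [Field k] {G ι : Type*} (r : ι → G) (p : HopfPath G ι) :
    PathCoalgebra k r :=
  basis k r p

variable [AddCommGroup G]

/-- `Δ(aₗ ⋯ a₁) = ∑ⱼ (aₗ ⋯ aⱼ₊₁) ⊗ (aⱼ ⋯ a₁)`, where the empty products at the two ends are the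
trivial paths at the target and at the source; `ε` is `1` on vertices and `0` on longer paths. -/
instance (r : ι → G) : CoalgebraStruct k (PathCoalgebra k r) where
  comul := (basis k r).constr k fun p =>
    ∑ j ∈ Finset.range (p.length + 1),
      ofPath k r (p.final r j) ⊗ₜ[k] ofPath k r (p.initial j)
  counit := (basis k r).constr k fun p => if p.length = 0 then 1 else 0

theorem comul_ofPath (r : ι → G) (p : HopfPath G ι) :
    CoalgebraStruct.comul (R := k) (ofPath k r p) =
      ∑ j ∈ Finset.range (p.length + 1),
        ofPath k r (p.final r j) ⊗ₜ[k] ofPath k r (p.initial j) :=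
  (basis k r).constr_basis k _ p

theorem counit_ofPath (r : ι → G) (p : HopfPath G ι) :
    CoalgebraStruct.counit (R := k) (ofPath k r p) = if p.length = 0 then 1 else 0 :=
  (basis k r).constr_basis k _ p

instance (r : ι → G) : Coalgebra k (PathCoalgebra k r) where
  coassoc := by
    refine (basis k r).ext fun p => ?_
    change _ = (CoalgebraStruct.comul.lTensor _) (CoalgebraStruct.comul (R := k) (ofPath k r p))
    change TensorProduct.assoc k _ _ _ ((CoalgebraStruct.comul.rTensor _)
      (CoalgebraStruct.comul (R := k) (ofPath k r p))) = _
    simp only [comul_ofPath, map_sum, LinearMap.rTensor_tmul, LinearMap.lTensor_tmul,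
      TensorProduct.sum_tmul, TensorProduct.tmul_sum, TensorProduct.assoc_tmul]
    rw [Finset.sum_sigma', Finset.sum_sigma']
    refine Finset.sum_bij' (fun a _ => ⟨a.2, a.1 - a.2⟩) (fun a _ => ⟨a.1 + a.2, a.1⟩)
      ?_ ?_ ?_ ?_ ?_
    · rintro ⟨i, j⟩ h
      simp [HopfPath.length, HopfPath.initial, HopfPath.final] at h ⊢
      omega
    · rintro ⟨i, j⟩ h
      simp [HopfPath.length, HopfPath.initial, HopfPath.final] at h ⊢
      omega
    · rintro ⟨i, j⟩ h
      simp [HopfPath.length, HopfPath.initial, HopfPath.final] at h ⊢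
      omega
    · rintro ⟨i, j⟩ h
      simp
    · rintro ⟨i, j⟩ h
      simp only [HopfPath.length, HopfPath.final, List.length_take, Finset.mem_sigma,
        Finset.mem_range] at h
      have hj : j ≤ i := by omega
      obtain ⟨d, rfl⟩ := Nat.exists_eq_add_of_le hj
      obtain ⟨x, w⟩ := p
      have h1 : (List.drop j (List.take (j + d) w)) ++ List.drop (j + d) w = List.drop j w := by
        have : List.drop (j + d) w = List.drop d (List.drop j w) := by
          rw [List.drop_drop]
        rw [List.drop_take, this]
        simp
      have h2 : HopfPath.final r j (HopfPath.final r (j + d) (x, w)) =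
          HopfPath.final r j (x, w) := by
        simp only [HopfPath.final, HopfPath.initial, HopfPath.target, ← h1]
        simp [List.take_take, add_assoc]
      have h3 : HopfPath.initial j (HopfPath.final r (j + d) (x, w)) =
          HopfPath.final r d (HopfPath.initial j (x, w)) := by
        simp [HopfPath.final, HopfPath.initial, HopfPath.target, List.drop_take,
          List.drop_drop]
      have h4 : HopfPath.initial (j + d) (x, w) =
          HopfPath.initial d (HopfPath.initial j (x, w)) := by
        simp [HopfPath.initial, List.drop_drop]
      simp only [Nat.add_sub_cancel_left]
      rw [h2, h3, h4]
  rTensor_counit_comp_comul := by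
    refine (basis k r).ext fun p => ?_
    change (CoalgebraStruct.counit.rTensor _) (CoalgebraStruct.comul (R := k) (ofPath k r p)) =
      (1 : k) ⊗ₜ[k] ofPath k r p
    simp only [comul_ofPath, map_sum, LinearMap.rTensor_tmul, counit_ofPath]
    rw [Finset.sum_eq_single 0]
    · simp [HopfPath.length, HopfPath.final, HopfPath.initial]
    · intro j hj h0
      have : (HopfPath.final r j p).length ≠ 0 := by
        simp [HopfPath.length, HopfPath.final] at hj ⊢
        refine ⟨h0, fun h => h0 ?_⟩
        simpa [h] using hj
      simp [this]
    · simp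
  lTensor_counit_comp_comul := by
    refine (basis k r).ext fun p => ?_
    change (CoalgebraStruct.counit.lTensor _) (CoalgebraStruct.comul (R := k) (ofPath k r p)) =
      ofPath k r p ⊗ₜ[k] (1 : k)
    simp only [comul_ofPath, map_sum, LinearMap.lTensor_tmul, counit_ofPath]
    rw [Finset.sum_eq_single p.length]
    · simp [HopfPath.length, HopfPath.final, HopfPath.initial, HopfPath.target]
    · intro j hj h0
      have : (HopfPath.initial j p).length ≠ 0 := by
        simp [HopfPath.length, HopfPath.initial] at hj h0 ⊢
        omega
      simp [this]
    · simp

/-- The homogeneous component of degree `l`: the span of the paths of length `l`. -/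
def homogeneous (k : Type*) [Field k] {G ι : Type*} (r : ι → G) (l : ℕ) :
    Submodule k (PathCoalgebra k r) :=
  Submodule.span k (ofPath k r '' {p | p.length = l})

end PathCoalgebra

/-! ## Majid algebras (coquasi-Hopf algebras) -/

/-- Convolution of linear maps out of a coalgebra along a bilinear pairing `β`:
`c ↦ ∑ β (f c₍₁₎ ⊗ g c₍₂₎)`. -/
def convAlong {k C U V W : Type*} [CommSemiring k] [AddCommMonoid C] [Module k C]
    [CoalgebraStruct k C] [AddCommMonoid U] [Module k U] [AddCommMonoid V] [Module k V]
    [AddCommMonoid W] [Module k W] (β : U ⊗[k] V →ₗ[k] W) (f : C →ₗ[k] U) (g : C →ₗ[k] V) :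
    C →ₗ[k] W :=
  β ∘ₗ TensorProduct.map f g ∘ₗ CoalgebraStruct.comul

/-- `c ↦ ∑ φ c₍₁₎ • F c₍₂₎` for a functional `φ` and a linear map `F`. -/
def convLeft {k C V : Type*} [CommSemiring k] [AddCommMonoid C] [Module k C]
    [CoalgebraStruct k C] [AddCommMonoid V] [Module k V] (φ : C →ₗ[k] k) (F : C →ₗ[k] V) :
    C →ₗ[k] V :=
  convAlong (TensorProduct.lid k V).toLinearMap φ F

/-- `c ↦ ∑ φ c₍₂₎ • F c₍₁₎` for a linear map `F` and a functional `φ`. -/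
def convRight {k C V : Type*} [CommSemiring k] [AddCommMonoid C] [Module k C]
    [CoalgebraStruct k C] [AddCommMonoid V] [Module k V] (F : C →ₗ[k] V) (φ : C →ₗ[k] k) :
    C →ₗ[k] V :=
  convAlong (TensorProduct.rid k V).toLinearMap F φ

/-- A Majid algebra (coquasi-Hopf algebra, dual quasi-Hopf algebra) structure on a coalgebra `H`.
In Sweedler notation the axioms are written above the fields. -/
structure MajidAlgebra (k H : Type*) [Field k] [AddCommGroup H] [Module k H] [Coalgebra k H] where
  /-- The multiplication, a morphism of coalgebras. -/
  mul : H ⊗[k] H →ₗc[k] H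
  /-- The unit. -/
  one : H
  /-- The associator `Φ`. -/
  assoc : H ⊗[k] (H ⊗[k] H) →ₗ[k] k
  /-- The convolution inverse `Φ⁻¹` of the associator. -/
  assocInv : H ⊗[k] (H ⊗[k] H) →ₗ[k] k
  /-- The map `S` of the antipode `(S, α, β)`. -/
  antipode : H →ₗ[k] H
  /-- The functional `α` of the antipode `(S, α, β)`. -/
  α : H →ₗ[k] k
  /-- The functional `β` of the antipode `(S, α, β)`. -/
  β : H →ₗ[k] k
  /-- The unit map `𝕜 → H` is a morphism of coalgebras. -/
  one_isGroupLike : IsGroupLikeElem k one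
  one_mul : ∀ a, mul (one ⊗ₜ a) = a
  mul_one : ∀ a, mul (a ⊗ₜ one) = a
  assoc_conv_assocInv : convLeft assoc assocInv = CoalgebraStruct.counit
  assocInv_conv_assoc : convLeft assocInv assoc = CoalgebraStruct.counit
  /-- `a₁(b₁c₁) Φ(a₂,b₂,c₂) = Φ(a₁,b₁,c₁) (a₂b₂)c₂` -/
  quasi_assoc :
    convRight (mul.toLinearMap ∘ₗ mul.toLinearMap.lTensor H) assoc =
      convLeft assoc (mul.toLinearMap ∘ₗ mul.toLinearMap.rTensor H ∘ₗ
        (TensorProduct.assoc k H H H).symm.toLinearMap)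
  /-- `Φ(a₁,b₁,c₁d₁) Φ(a₂b₂,c₂,d₂) = Φ(b₁,c₁,d₁) Φ(a₁,b₂c₂,d₂) Φ(a₂,b₃,c₃)` -/
  pentagon :
    convLeft
      (assoc ∘ₗ (mul.toLinearMap.lTensor H).lTensor H)
      (assoc ∘ₗ mul.toLinearMap.rTensor (H ⊗[k] H) ∘ₗ
        (TensorProduct.assoc k H H (H ⊗[k] H)).symm.toLinearMap) =
    convLeft
      ((TensorProduct.lid k k).toLinearMap ∘ₗ
        TensorProduct.map (CoalgebraStruct.counit (R := k) (A := H)) assoc)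
      (convLeft
        (assoc ∘ₗ (mul.toLinearMap.rTensor H ∘ₗ
          (TensorProduct.assoc k H H H).symm.toLinearMap).lTensor H)
        ((TensorProduct.rid k k).toLinearMap ∘ₗ
          TensorProduct.map assoc (CoalgebraStruct.counit (R := k) (A := H)) ∘ₗ
          (TensorProduct.assoc k H (H ⊗[k] H) H).symm.toLinearMap ∘ₗ
          (TensorProduct.assoc k H H H).symm.toLinearMap.lTensor H))
  /-- `Φ(a,1,b) = ε(a)ε(b)` -/
  assoc_one : ∀ a b, assoc (a ⊗ₜ (one ⊗ₜ b)) =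
    CoalgebraStruct.counit (R := k) a * CoalgebraStruct.counit (R := k) b
  /-- `S` is an antimorphism of coalgebras: `Δ(S a) = S a₂ ⊗ S a₁` -/
  comul_antipode : CoalgebraStruct.comul ∘ₗ antipode =
    (TensorProduct.comm k H H).toLinearMap ∘ₗ TensorProduct.map antipode antipode ∘ₗ
      CoalgebraStruct.comul
  counit_antipode : CoalgebraStruct.counit ∘ₗ antipode = CoalgebraStruct.counit (R := k) (A := H)
  /-- `S(a₁) α(a₂) a₃ = α(a) 1` -/
  antipode_left : convAlong mul.toLinearMap (convRight antipode α) LinearMap.id =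
    α.smulRight one
  /-- `a₁ β(a₂) S(a₃) = β(a) 1` -/
  antipode_right : convAlong mul.toLinearMap (convRight LinearMap.id β) antipode =
    β.smulRight one
  /-- `Φ(a₁,S(a₃),a₅) β(a₂) α(a₄) = ε(a)` -/
  assoc_antipode :
    convAlong assoc (convRight LinearMap.id β)
      (convAlong LinearMap.id (convRight antipode α) LinearMap.id) = CoalgebraStruct.counit
  /-- `Φ⁻¹(S(a₁),a₃,S(a₅)) α(a₂) β(a₄) = ε(a)` -/
  assocInv_antipode :
    convAlong assocInv (convRight antipode α)
      (convAlong LinearMap.id (convRight LinearMap.id β) antipode) = CoalgebraStruct.counit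

namespace MajidAlgebra

section

variable {k H : Type*} [Field k] [AddCommGroup H] [Module k H] [Coalgebra k H]

/-- The product of two elements of a Majid algebra. -/
def prod (M : MajidAlgebra k H) (a b : H) : H := M.mul (a ⊗ₜ b)

/-- A Majid subalgebra: a subspace that contains `1`, is closed under the multiplication and under
the antipode, and is a subcoalgebra, i.e. `Δ(N) ⊆ N ⊗ N`. -/
structure IsMajidSubalgebra (M : MajidAlgebra k H) (N : Submodule k H) : Prop where
  one_mem : M.one ∈ N
  prod_mem : ∀ a ∈ N, ∀ b ∈ N, M.prod a b ∈ N
  antipode_mem : ∀ a ∈ N, M.antipode a ∈ N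
  comul_mem : ∀ a ∈ N, CoalgebraStruct.comul (R := k) a ∈
    LinearMap.range (TensorProduct.map N.subtype N.subtype)

/-- The Majid subalgebra generated by a set: the intersection of all Majid subalgebras
containing it. -/
def generated (M : MajidAlgebra k H) (s : Set H) : Submodule k H :=
  sInf {N | M.IsMajidSubalgebra N ∧ s ⊆ N}

/-- `a` is skew-primitive with respect to a subset `Γ` of group-like elements:
`Δ(a) = a ⊗ s + t ⊗ a` for some `s, t ∈ Γ`. -/
def IsSkewPrimitive (k : Type*) {H : Type*} [Field k] [AddCommGroup H] [Module k H]
    [Coalgebra k H] (Γ : Set H) (a : H) : Prop :=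
  ∃ s ∈ Γ, ∃ t ∈ Γ, CoalgebraStruct.comul (R := k) a = a ⊗ₜ[k] s + t ⊗ₜ[k] a

/-- The subspace `N` of `M` is a finite dimensional Majid subalgebra
* (R1) generated by an abelian group of group-like elements (the image of `γ : G → H`) and two
  skew-primitive elements `X`, `Y`,
* (R2) which are skew-commutative: `X Y = q Y X` for some `q ∈ 𝕜ˣ`. -/
structure SatisfiesR1R2 (M : MajidAlgebra k H) (N : Submodule k H) {G : Type*} [AddCommGroup G]
    (γ : G → H) (X Y : H) : Prop where
  finiteDimensional : FiniteDimensional k N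
  isGroupLike : ∀ x, IsGroupLikeElem k (γ x)
  map_add : ∀ x y, γ (x + y) = M.prod (γ x) (γ y)
  isSkewPrimitive_left : IsSkewPrimitive k (Set.range γ) X
  isSkewPrimitive_right : IsSkewPrimitive k (Set.range γ) Y
  generates : N = M.generated (Set.range γ ∪ {X, Y})
  skewCommute : ∃ q : k, q ≠ 0 ∧ M.prod X Y = q • M.prod Y X

end

section

open PathCoalgebra

variable {k : Type*} [Field k] {G ι : Type*} [AddCommGroup G] {r : ι → G}

/-- The structure `M` makes `𝕜Q`, graded by the length of paths, a graded Majid algebra with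
associator `φ`: the degree zero part is the Majid algebra `(𝕜G, φ)` spanned by the vertices, the
multiplication and `S` preserve degrees, and `Φ`, `α`, `β` are concentrated in degree zero. -/
structure IsGraded (M : MajidAlgebra k (PathCoalgebra k r)) (φ : G → G → G → k) : Prop where
  one_eq : M.one = ofPath k r (.vertex 0)
  vertex_mul : ∀ x y : G, M.prod (ofPath k r (.vertex x)) (ofPath k r (.vertex y)) =
    ofPath k r (.vertex (x + y))
  assoc_vertex : ∀ x y z : G, M.assoc (ofPath k r (.vertex x) ⊗ₜ
    (ofPath k r (.vertex y) ⊗ₜ ofPath k r (.vertex z))) = φ x y z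
  assoc_eq_zero : ∀ p q s : HopfPath G ι, 0 < p.length + q.length + s.length →
    M.assoc (ofPath k r p ⊗ₜ (ofPath k r q ⊗ₜ ofPath k r s)) = 0
  prod_mem : ∀ p q : HopfPath G ι,
    M.prod (ofPath k r p) (ofPath k r q) ∈ homogeneous k r (p.length + q.length)
  antipode_mem : ∀ p : HopfPath G ι, M.antipode (ofPath k r p) ∈ homogeneous k r p.length
  α_eq_zero : ∀ p : HopfPath G ι, 0 < p.length → M.α (ofPath k r p) = 0
  β_eq_zero : ∀ p : HopfPath G ι, 0 < p.length → M.β (ofPath k r p) = 0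

/-- The action `f ▷ v = (f · v) · f⁻¹` of a vertex `f`. -/
def act (M : MajidAlgebra k (PathCoalgebra k r)) (f : G) (v : PathCoalgebra k r) :
    PathCoalgebra k r :=
  M.prod (M.prod (ofPath k r (.vertex f)) v) (ofPath k r (.vertex (-f)))

/-- The Majid subalgebra of `𝕜Q` generated by all vertices and the arrows `X : 0 → r 0` and
`Y : 0 → r 1`, in case `Q = Q(G, r 0 + r 1)`. -/
def planeSubalgebra {r : Fin 2 → G} (M : MajidAlgebra k (PathCoalgebra k r)) :
    Submodule k (PathCoalgebra k r) :=
  M.generated (Set.range (fun x : G => ofPath k r (.vertex x)) ∪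
    {ofPath k r (.arrow 0 0), ofPath k r (.arrow 0 1)})

/-- The Majid subalgebra generated by the vertices and the arrows `X : 0 → r 0`, `Y : 0 → r 1`
is finite dimensional and satisfies (R1) and (R2). -/
def PlaneSatisfiesR1R2 {r : Fin 2 → G} (M : MajidAlgebra k (PathCoalgebra k r)) : Prop :=
  M.SatisfiesR1R2 M.planeSubalgebra (fun x : G => ofPath k r (.vertex x))
    (ofPath k r (.arrow 0 0)) (ofPath k r (.arrow 0 1))

end

end MajidAlgebra

/-! ## The 3-cocycles -/

/-- The normalized 3-cocycle `Φ_{a,b,c}` on `ℤ_m × ℤ_n`, where `ζm`, `ζn` are primitive roots of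
unity of order `m`, `n`:
`Φ(gⁱhʲ, gˢhᵗ, gᵏhˡ) = ζm^(a[(k+s)/m]i) ζn^(b[(k+s)/m]j) ζn^(c[(t+l)/n]j)`, the exponents
`i, s, k` and `j, t, l` being taken in `[0, m)` and `[0, n)`. -/
def cocycleProd {k : Type*} [Field k] (m n : ℕ) (ζm ζn : k) (a b c : ℕ)
    (x y z : ZMod m × ZMod n) : k :=
  ζm ^ (a * ((z.1.val + y.1.val) / m) * x.1.val) *
    ζn ^ (b * ((z.1.val + y.1.val) / m) * x.2.val) *
    ζn ^ (c * ((y.2.val + z.2.val) / n) * x.2.val)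

/-- The normalized 3-cocycle `Φ_a(eⁱ, eʲ, eᵏ) = ζ^(a[(j+k)/m]i)` on `ℤ_m`, the exponents being
taken in `[0, m)`. -/
def cocycleCyclic {k : Type*} [Field k] (m : ℕ) (ζ : k) (a : ℕ) (x y z : ZMod m) : k :=
  ζ ^ (a * ((y.val + z.val) / m) * x.val)

end

/-! Everything is governed by the scalars `t` in `f X = t X f`, where `f` is a vertex and `X` an
arrow starting at the unit. Since the multiplication is a coalgebra map, products respect sources
and targets, and quasi-associativity becomes `φ(sources) • u(vw) = φ(targets) • (uv)w`. Hence the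
scalars of `f`, `f'` and `f + f'` are related by a quotient of values of `φ`. Going once around a
cyclic factor of order `m` then forces `t ^ m` to be a prescribed root of unity (`commutes_add`,
`commutes_nsmul`). The action scalar `μ` of `f ▷ X = μ X` differs from `t` by another quotient of
values of `φ` (`commutes_of_act`).

Necessity. Deleting the first arrow is a derivation on products of paths starting at the unit.
Applied to `XY = qYX`, it gives `gY = q Yg` and `hX = q⁻¹ Xh` (`commutes_of_skewCommute`). Applied
to powers of `X`, it produces the quantum integers `1 + t + ⋯ + t ^ n`, where `t` is the scalar of
`X` with its own target vertex (`dropFirst_arrowPow`). In characteristic zero, `t = 1` makes all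
powers of `X` nonzero; they have different degrees, so the subalgebra is infinite dimensional.

For `ℤ_m × ℤ_n` one finds `q ^ m = ζn ^ b` and `q ^ n = 1`, so `gcd(m, n)` divides `b`, and `b = 0`
because `b < gcd(m, n)`. The congruence also forces `gcd(m, n) ∣ b`, so it too says exactly that `b
= 0`. The self-braiding of `X` is `λ₁ ζm ^ a` with `λ₁ ^ m = ζm ^ a`, and it is `1` iff `λ₁ = 1`;
similarly for `Y`.

For `ℤ_m` put `t₁ = μ₁ ζ ^ (aα)` and `t₂ = μ₂ ζ ^ (aβ)`. The constraint on `m`-th powers gives `μ₁ =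
ξ ^ (aα) ζ ^ x` and `μ₂ = ξ ^ (aβ) ζ ^ y`. Inverse mutual braidings mean `t₁ ^ β t₂ ^ α = 1`; as `ξ`
has order `m²`, this is the stated congruence on the exponent of `ξ`.

Sufficiency. A diagonal quasi-bimodule structure on the arrows yields a twisted shuffle product on
paths. An element of the path coalgebra is determined by its vertex part and by its images under
deletion of last (or first) arrows, and these deletions are twisted derivations. Associativity,
compatibility with `Δ` and the antipode axioms thus reduce to identities for single arrows. Explicit
bimodules for `ℤ_m`, and products of two pull-backs for `ℤ_m × ℤ_n`, realize all admissible scalars.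
If the self-braidings are nontrivial roots of unity, high powers of `X` and `Y` vanish. Rebracketing
and reordering monomials costs only nonzero scalars, so every monomial is a multiple of some `(Xᵃ
Yᵇ) f`, and finite dimension follows. -/

set_option linter.unusedSectionVars false

noncomputable section

/-! ### Targets and lengths of paths -/

namespace HopfPath

variable {G ι : Type*} [AddCommGroup G] (r : ι → G)

@[simp]
theorem target_nil (x : G) : target r (x, []) = x := by simp [target]

@[simp]
theorem target_cons (x : G) (i : ι) (w : List ι) :
    target r (x, i :: w) = r i + target r (x, w) := by simp [target, add_assoc]

@[simp]
theorem target_concat (x : G) (w : List ι) (i : ι) :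
    target r (x, w ++ [i]) = target r (r i + x, w) := by simp [target, add_assoc]

theorem target_append (x : G) (w v : List ι) :
    target r (x, w ++ v) = target r (target r (x, v), w) := by simp [target, add_assoc]

theorem target_final (j : ℕ) (p : HopfPath G ι) : target r (final r j p) = target r p := by
  obtain ⟨x, w⟩ := p
  simp only [final, initial]
  rw [← target_append, List.take_append_drop]

theorem length_final {j : ℕ} {p : HopfPath G ι} (h : j ≤ p.length) :
    (final r j p).length = j := by
  simpa [final, length] using h

theorem length_initial (j : ℕ) (p : HopfPath G ι) : (initial j p).length = p.length - j := by
  simp [initial, length]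

theorem length_eq_zero {p : HopfPath G ι} (h : p.length = 0) : p = vertex p.1 := by
  obtain ⟨x, w⟩ := p
  simp_all [length, vertex]

end HopfPath

/-! ### Deleting and adding arrows in the path coalgebra -/

namespace PathCoalgebra

open HopfPath

variable {k : Type*} [Field k] {G ι : Type*}

theorem basis_apply (r : ι → G) (p : HopfPath G ι) : basis k r p = ofPath k r p := rfl

theorem hom_ext {r : ι → G} {V : Type*} [AddCommMonoid V] [Module k V]
    {f g : PathCoalgebra k r →ₗ[k] V} (h : ∀ p, f (ofPath k r p) = g (ofPath k r p)) : f = g :=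
  (basis k r).ext h

/-- The linear map with prescribed values on paths. -/
def lift {r : ι → G} {V : Type*} [AddCommGroup V] [Module k V] (f : HopfPath G ι → V) :
    PathCoalgebra k r →ₗ[k] V :=
  (basis k r).constr k f

@[simp]
theorem lift_ofPath {r : ι → G} {V : Type*} [AddCommGroup V] [Module k V]
    (f : HopfPath G ι → V) (p : HopfPath G ι) : lift f (ofPath k r p) = f p :=
  (basis k r).constr_basis k f p

theorem coord_ofPath (r : ι → G) [DecidableEq (HopfPath G ι)] (p q : HopfPath G ι) :
    (basis k r).coord p (ofPath k r q) = if q = p then 1 else 0 := by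
  rw [Module.Basis.coord_apply, ← basis_apply, Module.Basis.repr_self, Finsupp.single_apply]

theorem ofPath_ne_zero (r : ι → G) (p : HopfPath G ι) : ofPath k r p ≠ 0 :=
  (basis k r).ne_zero p

/-- The projection onto the span of the vertices. -/
def vertexPart (k : Type*) [Field k] (r : ι → G) : PathCoalgebra k r →ₗ[k] PathCoalgebra k r :=
  lift fun p => if p.length = 0 then ofPath k r p else 0

theorem vertexPart_ofPath (r : ι → G) (p : HopfPath G ι) :
    vertexPart k r (ofPath k r p) = if p.length = 0 then ofPath k r p else 0 :=
  lift_ofPath _ _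

open scoped Classical in
/-- The linear map deleting the last arrow of a path if it has label `i`, and annihilating all
other paths. -/
def dropLast (k : Type*) [Field k] (r : ι → G) (i : ι) :
    PathCoalgebra k r →ₗ[k] PathCoalgebra k r :=
  lift fun p => match p.2 with
    | [] => 0
    | j :: w => if j = i then ofPath k r (p.1, w) else 0

@[simp]
theorem dropLast_nil (r : ι → G) (i : ι) (x : G) : dropLast k r i (ofPath k r (x, [])) = 0 :=
  lift_ofPath _ _

open scoped Classical in
theorem dropLast_cons (r : ι → G) (i : ι) (x : G) (j : ι) (w : List ι) :
    dropLast k r i (ofPath k r (x, j :: w)) = if j = i then ofPath k r (x, w) else 0 :=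
  lift_ofPath _ _

/-- The linear map adding a last arrow with label `i` to every path. -/
def pathCons (k : Type*) [Field k] (r : ι → G) (i : ι) :
    PathCoalgebra k r →ₗ[k] PathCoalgebra k r :=
  lift fun p => ofPath k r (p.1, i :: p.2)

@[simp]
theorem pathCons_ofPath (r : ι → G) (i : ι) (p : HopfPath G ι) :
    pathCons k r i (ofPath k r p) = ofPath k r (p.1, i :: p.2) :=
  lift_ofPath _ _

open scoped Classical in
theorem dropLast_pathCons (r : ι → G) (i j : ι) (u : PathCoalgebra k r) :
    dropLast k r i (pathCons k r j u) = if j = i then u else 0 := by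
  have : dropLast k r i ∘ₗ pathCons k r j = if j = i then LinearMap.id else 0 := by
    refine hom_ext fun p => ?_
    by_cases h : j = i <;> simp [dropLast_cons, h]
  have := LinearMap.congr_fun this u
  by_cases h : j = i <;> simpa [h] using this

theorem vertexPart_pathCons (r : ι → G) (j : ι) (u : PathCoalgebra k r) :
    vertexPart k r (pathCons k r j u) = 0 := by
  have : vertexPart k r ∘ₗ pathCons k r j = 0 := by
    refine hom_ext fun p => ?_
    simp [vertexPart_ofPath, length]
  exact LinearMap.congr_fun this u

theorem coord_cons (r : ι → G) (x : G) (i : ι) (w : List ι) :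
    (basis k r).coord (x, i :: w) = (basis k r).coord (x, w) ∘ₗ dropLast k r i := by
  classical
  refine hom_ext fun ⟨y, v⟩ => ?_
  cases v with
  | nil => simp [-Module.Basis.coord_apply, coord_ofPath]
  | cons j v =>
    by_cases h : j = i <;>
      simp [-Module.Basis.coord_apply, coord_ofPath, dropLast_cons, h]

theorem coord_nil (r : ι → G) (x : G) :
    (basis k r).coord (x, []) = (basis k r).coord (x, []) ∘ₗ vertexPart k r := by
  classical
  refine hom_ext fun ⟨y, v⟩ => ?_
  cases v <;> simp [-Module.Basis.coord_apply, coord_ofPath, vertexPart_ofPath, length]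

/-- Every coordinate at a nonempty word factors through the deletion of its last arrow, by
`coord_cons`. This is the extensionality principle for inductions on path length: deletion lowers
the degree by one. -/
theorem ext_dropLast {r : ι → G} {u v : PathCoalgebra k r}
    (h0 : vertexPart k r u = vertexPart k r v) (h : ∀ i, dropLast k r i u = dropLast k r i v) :
    u = v := by
  refine (basis k r).ext_elem fun p => ?_
  change (basis k r).coord p u = (basis k r).coord p v
  obtain ⟨x, _ | ⟨i, w⟩⟩ := p
  · rw [coord_nil, LinearMap.comp_apply, h0, LinearMap.comp_apply]
  · rw [coord_cons, LinearMap.comp_apply, h, LinearMap.comp_apply]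

/-- Testing the left factor is enough, since a coordinate on the tensor square is a product of two
coordinates and the left one factors as in `ext_dropLast`. -/
theorem tensor_ext_dropLast {r : ι → G} {u v : PathCoalgebra k r ⊗[k] PathCoalgebra k r}
    (h0 : (vertexPart k r).rTensor _ u = (vertexPart k r).rTensor _ v)
    (h : ∀ i, (dropLast k r i).rTensor _ u = (dropLast k r i).rTensor _ v) : u = v := by
  have key : ∀ p q, TensorProduct.map ((basis k r).coord p) ((basis k r).coord q) u =
      TensorProduct.map ((basis k r).coord p) ((basis k r).coord q) v := by
    intro p q
    obtain ⟨x, _ | ⟨i, w⟩⟩ := p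
    · rw [coord_nil, ← LinearMap.map_comp_rTensor, LinearMap.comp_apply, h0,
        LinearMap.comp_apply]
    · rw [coord_cons, ← LinearMap.map_comp_rTensor, LinearMap.comp_apply, h,
        LinearMap.comp_apply]
  refine ((basis k r).tensorProduct (basis k r)).ext_elem fun ⟨p, q⟩ => ?_
  have hc : ((basis k r).tensorProduct (basis k r)).coord (p, q) =
      (TensorProduct.lid k k).toLinearMap ∘ₗ
        TensorProduct.map ((basis k r).coord p) ((basis k r).coord q) := by
    ext a b
    simp [mul_comm]
  have := congrArg (TensorProduct.lid k k) (key p q)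
  have h1 := LinearMap.congr_fun hc u
  have h2 := LinearMap.congr_fun hc v
  simp only [LinearMap.comp_apply, LinearEquiv.coe_coe] at h1 h2
  rw [this, ← h2] at h1
  exact h1

variable [AddCommGroup G] (r : ι → G)

/-- The span of the paths of length `n` from `s` to `t`. -/
def between (k : Type*) [Field k] (r : ι → G) (s t : G) (n : ℕ) :
    Submodule k (PathCoalgebra k r) :=
  Submodule.span k (ofPath k r '' {p | p.1 = s ∧ p.target r = t ∧ p.length = n})

theorem ofPath_mem_between (p : HopfPath G ι) :
    ofPath k r p ∈ between k r p.1 (p.target r) p.length :=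
  Submodule.subset_span ⟨p, ⟨rfl, rfl, rfl⟩, rfl⟩

variable {r}

theorem between_induction {s t : G} {n : ℕ} {P : PathCoalgebra k r → Prop}
    (h0 : P 0) (hadd : ∀ u v, P u → P v → P (u + v)) (hsmul : ∀ (c : k) u, P u → P (c • u))
    (hp : ∀ p : HopfPath G ι, p.1 = s → p.target r = t → p.length = n → P (ofPath k r p))
    {u : PathCoalgebra k r} (hu : u ∈ between k r s t n) : P u := by
  induction hu using Submodule.span_induction with
  | mem x hx =>
    obtain ⟨p, ⟨h1, h2, h3⟩, rfl⟩ := hx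
    exact hp p h1 h2 h3
  | zero => exact h0
  | add x y _ _ hx hy => exact hadd x y hx hy
  | smul c x _ hx => exact hsmul c x hx

/-- Linear maps that agree on the paths of length `n` from `s` to `t` agree on their span. -/
theorem eqOn_between {V : Type*} [AddCommGroup V] [Module k V] {s t : G} {n : ℕ}
    {f g : PathCoalgebra k r →ₗ[k] V}
    (hp : ∀ p : HopfPath G ι, p.1 = s → p.target r = t → p.length = n →
      f (ofPath k r p) = g (ofPath k r p))
    {u : PathCoalgebra k r} (hu : u ∈ between k r s t n) : f u = g u :=
  between_induction (P := fun u => f u = g u) (by simp) (fun u v hu hv => by simp [hu, hv])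
    (fun c u hu => by simp [hu]) hp hu

theorem between_le_homogeneous (s t : G) (n : ℕ) : between k r s t n ≤ homogeneous k r n :=
  Submodule.span_mono (Set.image_mono fun _ hp => hp.2.2)

theorem pathCons_mem_between (i : ι) {s t : G} {n : ℕ} {u : PathCoalgebra k r}
    (hu : u ∈ between k r s t n) : pathCons k r i u ∈ between k r s (r i + t) (n + 1) := by
  refine between_induction (P := fun u => pathCons k r i u ∈ _) (by simp)
    (fun u v hu hv => by rw [map_add]; exact add_mem hu hv)
    (fun c u hu => by rw [map_smul]; exact Submodule.smul_mem _ _ hu) (fun p h1 h2 h3 => ?_) hu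
  rw [pathCons_ofPath]
  refine Submodule.subset_span ⟨(p.1, i :: p.2), ⟨h1, ?_, ?_⟩, rfl⟩
  · simp [← h2]
  · simp [← h3, HopfPath.length]

/-- `Δ` applied to the vertex `x` is `x ⊗ x`. -/
theorem comul_vertex (x : G) : CoalgebraStruct.comul (R := k) (ofPath k r (vertex x)) =
    ofPath k r (vertex x) ⊗ₜ[k] ofPath k r (vertex x) := by
  simp [comul_ofPath, vertex, length, final, initial]

theorem comul_arrow (x : G) (i : ι) : CoalgebraStruct.comul (R := k) (ofPath k r (arrow x i)) =
    ofPath k r (arrow x i) ⊗ₜ[k] ofPath k r (vertex x) +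
      ofPath k r (vertex (r i + x)) ⊗ₜ[k] ofPath k r (arrow x i) := by
  simp [comul_ofPath, arrow, length, final, initial, Finset.sum_range_succ, vertex, add_comm]

theorem isGroupLikeElem_vertex (x : G) : IsGroupLikeElem k (ofPath k r (vertex x)) where
  counit_eq_one := by simp [counit_ofPath, vertex, length]
  comul_eq_tmul_self := comul_vertex x

theorem rTensor_vertexPart_comul (p : HopfPath G ι) :
    (vertexPart k r).rTensor _ (CoalgebraStruct.comul (R := k) (ofPath k r p)) =
      ofPath k r (vertex (p.target r)) ⊗ₜ[k] ofPath k r p := by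
  rw [comul_ofPath, map_sum, Finset.sum_eq_single 0]
  · simp [vertexPart_ofPath, final, initial, length, vertex]
  · intro j hj h0
    have : (final r j p).length ≠ 0 := by
      rw [length_final r (by simpa [Nat.lt_succ_iff] using hj)]; exact h0
    simp [vertexPart_ofPath, this]
  · simp

theorem lTensor_vertexPart_comul (p : HopfPath G ι) :
    (vertexPart k r).lTensor _ (CoalgebraStruct.comul (R := k) (ofPath k r p)) =
      ofPath k r p ⊗ₜ[k] ofPath k r (vertex p.1) := by
  rw [comul_ofPath, map_sum, Finset.sum_eq_single p.length]
  · simp [vertexPart_ofPath, final, initial, length, vertex]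
  · intro j hj h0
    have : (initial j p).length ≠ 0 := by
      rw [length_initial]; simp at hj; omega
    simp [vertexPart_ofPath, this]
  · simp

/-- The left tensor factor of `Δ` carries the final part of a path, so deleting a last arrow
commutes with `Δ`: it is a map of right comodules. -/
theorem rTensor_dropLast_comul (i : ι) (p : HopfPath G ι) :
    (dropLast k r i).rTensor _ (CoalgebraStruct.comul (R := k) (ofPath k r p)) =
      CoalgebraStruct.comul (R := k) (dropLast k r i (ofPath k r p)) := by
  obtain ⟨x, w⟩ := p
  cases w with
  | nil => simp [comul_ofPath, length, final, initial]
  | cons j w =>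
    -- The summand whose left factor is a vertex is killed; the remaining ones are the summands for
    -- `w`, shifted by one.
    have h0 : (dropLast k r i) (ofPath k r (final r 0 (x, j :: w))) = 0 := by simp [final]
    have hs : ∀ n, final r (n + 1) (x, j :: w) =
      ((final r n (x, w)).1, j :: (final r n (x, w)).2) := fun n => rfl
    have hi : ∀ n, initial (n + 1) (x, j :: w) = initial n (x, w) := fun n => rfl
    rw [comul_ofPath, map_sum, show HopfPath.length (x, j :: w) = w.length + 1 from rfl,
      Finset.sum_range_succ', LinearMap.rTensor_tmul, h0, TensorProduct.zero_tmul, add_zero,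
      dropLast_cons]
    simp only [hs, hi, LinearMap.rTensor_tmul, dropLast_cons]
    by_cases h : j = i
    · simp only [h, if_true, comul_ofPath]
      rfl
    · simp [h]

open scoped Classical in
/-- The functional that is `1` on the arrows with label `i` and `0` on all other paths. -/
def arrowCoeff (k : Type*) [Field k] (r : ι → G) (i : ι) : PathCoalgebra k r →ₗ[k] k :=
  lift fun p => if p.2 = [i] then 1 else 0

open scoped Classical in
theorem arrowCoeff_ofPath (i : ι) (p : HopfPath G ι) :
    arrowCoeff k r i (ofPath k r p) = if p.2 = [i] then 1 else 0 :=
  lift_ofPath _ _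

theorem arrowCoeff_eq_zero (i : ι) {n : ℕ} (hn : n ≠ 1) {u : PathCoalgebra k r}
    (hu : u ∈ homogeneous k r n) : arrowCoeff k r i u = 0 := by
  classical
  induction hu using Submodule.span_induction with
  | mem x hx =>
    obtain ⟨p, hp, rfl⟩ := hx
    rw [arrowCoeff_ofPath, if_neg]
    intro h
    simp only [Set.mem_ofPred_eq, HopfPath.length, h, List.length_singleton] at hp
    exact hn hp.symm
  | zero => simp
  | add x y _ _ hx hy => simp [hx, hy]
  | smul c x _ hx => simp [hx]

theorem convRight_ofPath {V : Type*} [AddCommGroup V] [Module k V]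
    (F : PathCoalgebra k r →ₗ[k] V) (φ : PathCoalgebra k r →ₗ[k] k) (p : HopfPath G ι) :
    convRight F φ (ofPath k r p) = ∑ j ∈ Finset.range (p.length + 1),
      φ (ofPath k r (p.initial j)) • F (ofPath k r (p.final r j)) := by
  simp [convRight, convAlong, comul_ofPath]

/-- The linear map deleting the first arrow of a path if it has label `i`, and annihilating all
other paths. -/
def dropFirst (k : Type*) [Field k] (r : ι → G) (i : ι) :
    PathCoalgebra k r →ₗ[k] PathCoalgebra k r :=
  convRight LinearMap.id (arrowCoeff k r i)

@[simp]
theorem dropFirst_nil (i : ι) (x : G) : dropFirst k r i (ofPath k r (x, [])) = 0 := by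
  simp [dropFirst, convRight_ofPath, arrowCoeff_ofPath, length, initial]

open scoped Classical in
theorem dropFirst_concat (i : ι) (x : G) (w : List ι) (j : ι) :
    dropFirst k r i (ofPath k r (x, w ++ [j])) =
      if j = i then ofPath k r (r j + x, w) else 0 := by
  rw [dropFirst, convRight_ofPath, Finset.sum_eq_single w.length]
  · simp [arrowCoeff_ofPath, initial, final]
  · intro l _ hl
    rw [arrowCoeff_ofPath, if_neg, zero_smul]
    intro h
    have := congrArg List.length h
    simp [initial] at this
    omega
  · simp [length]

end PathCoalgebra

/-! ### Normalized cocycles and quasi-bimodules of arrows -/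

/-- Normalized 3-cocycles with values in the nonzero elements of a field. -/
structure IsNormalizedCocycle {k G : Type*} [Field k] [AddCommGroup G] (φ : G → G → G → k) :
    Prop where
  ne_zero : ∀ x y z, φ x y z ≠ 0
  apply_zero : ∀ x z, φ x 0 z = 1
  cocycle : ∀ x y z w,
    φ x y (z + w) * φ (x + y) z w = φ y z w * (φ x (y + z) w * φ x y z)

namespace IsNormalizedCocycle

variable {k G : Type*} [Field k] [AddCommGroup G] {φ : G → G → G → k}

theorem zero_left (h : IsNormalizedCocycle φ) (y z : G) : φ 0 y z = 1 := by
  have := h.cocycle 0 0 y z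
  simp only [zero_add, h.apply_zero, mul_one] at this
  exact mul_right_cancel₀ (h.ne_zero 0 y z) this.symm

theorem zero_right (h : IsNormalizedCocycle φ) (x y : G) : φ x y 0 = 1 := by
  have := h.cocycle x y 0 0
  simp only [add_zero, h.apply_zero, mul_one, one_mul] at this
  exact mul_right_cancel₀ (h.ne_zero x y 0) (by rw [one_mul]; exact this.symm)

/-- The cocycle identity at `(x, -x, x, -x)`, where all other factors are normalized away. It makes
the two antipode axioms involving `Φ` and `Φ⁻¹` compatible. -/
theorem neg_mul_neg (h : IsNormalizedCocycle φ) (x : G) : φ x (-x) x * φ (-x) x (-x) = 1 := by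
  have := h.cocycle x (-x) x (-x)
  simp only [add_neg_cancel, neg_add_cancel, h.zero_left, h.zero_right, h.apply_zero,
    mul_one, one_mul] at this
  rw [mul_comm, ← this]

end IsNormalizedCocycle

/-- Scalars describing a quasi-bimodule structure on the span of the arrows of a Hopf quiver over
the group algebra with associator `φ`: the vertex `f` times the arrow `x → r i + x` is `L f x i`
times the arrow at `f + x`, and the arrow times the vertex `y` is `R x i y` times the arrow at
`x + y`. -/
structure ArrowBimodule {k G ι : Type*} [Field k] [AddCommGroup G] (φ : G → G → G → k)
    (r : ι → G) where
  L : G → G → ι → k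
  R : G → ι → G → k
  L_zero : ∀ x i, L 0 x i = 1
  R_zero : ∀ x i, R x i 0 = 1
  R_ne_zero : ∀ x i y, R x i y ≠ 0
  left_assoc : ∀ f f' x i,
    φ f f' x * (L f' x i * L f (f' + x) i) = φ f f' (r i + x) * L (f + f') x i
  middle_assoc : ∀ f x i f',
    φ f x f' * (R x i f' * L f (x + f') i) = φ f (r i + x) f' * (L f x i * R (f + x) i f')
  right_assoc : ∀ x i f f',
    φ x f f' * R x i (f + f') = φ (r i + x) f f' * (R x i f * R (x + f) i f')

namespace PathCoalgebra

open HopfPath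

variable {k : Type*} [Field k] {G ι : Type*} [AddCommGroup G] {r : ι → G}

theorem mem_between_of_eq {s s' t t' : G} {n n' : ℕ} {u : PathCoalgebra k r}
    (hu : u ∈ between k r s t n) (hs : s = s') (ht : t = t') (hn : n = n') :
    u ∈ between k r s' t' n' := by
  subst hs ht hn
  exact hu

theorem dropLast_ofPath_cases (i : ι) (p : HopfPath G ι) :
    dropLast k r i (ofPath k r p) = 0 ∨ ∃ p' : HopfPath G ι,
      dropLast k r i (ofPath k r p) = ofPath k r p' ∧ p'.1 = p.1 ∧
        p'.target r = p.target r - r i ∧ p'.length + 1 = p.length := by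
  classical
  obtain ⟨x, _ | ⟨j, w⟩⟩ := p
  · simp
  · by_cases h : j = i
    · exact .inr ⟨(x, w), by simp [dropLast_cons, h], rfl, by simp [h], rfl⟩
    · exact .inl (by simp [dropLast_cons, h])

theorem comul_dropLast (i : ι) (u : PathCoalgebra k r) :
    CoalgebraStruct.comul (R := k) (dropLast k r i u) =
      (dropLast k r i).rTensor _ (CoalgebraStruct.comul (R := k) u) := by
  have : CoalgebraStruct.comul ∘ₗ dropLast k r i =
      (dropLast k r i).rTensor _ ∘ₗ CoalgebraStruct.comul (R := k) :=
    hom_ext fun p => (rTensor_dropLast_comul i p).symm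
  exact LinearMap.congr_fun this u

end PathCoalgebra

/-! ### The twisted shuffle product -/

namespace ArrowBimodule

open HopfPath PathCoalgebra

variable {k : Type*} [Field k] {G ι : Type*} [AddCommGroup G] {φ : G → G → G → k} {r : ι → G}

/-- The product of the paths `(x, w)` and `(y, v)`, a twisted shuffle product. -/
def shuffle (D : ArrowBimodule φ r) (x y : G) : List ι → List ι → PathCoalgebra k r
  | [], [] => ofPath k r (x + y, [])
  | i :: w, [] => D.R (target r (x, w)) i y • pathCons k r i (shuffle D x y w [])
  | [], j :: v => D.L x (target r (y, v)) j • pathCons k r j (shuffle D x y [] v)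
  | i :: w, j :: v =>
    D.R (target r (x, w)) i (target r (y, j :: v)) •
        pathCons k r i (shuffle D x y w (j :: v)) +
      D.L (target r (x, i :: w)) (target r (y, v)) j •
        pathCons k r j (shuffle D x y (i :: w) v)
  termination_by w v => w.length + v.length

/-- The multiplication of the path coalgebra determined by a quasi-bimodule structure on the
arrows. -/
def mulMap (D : ArrowBimodule φ r) :
    PathCoalgebra k r ⊗[k] PathCoalgebra k r →ₗ[k] PathCoalgebra k r :=
  TensorProduct.lift (lift fun p => lift fun q => D.shuffle p.1 q.1 p.2 q.2)

variable (D : ArrowBimodule φ r)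

theorem mulMap_ofPath (p q : HopfPath G ι) :
    D.mulMap (ofPath k r p ⊗ₜ ofPath k r q) = D.shuffle p.1 q.1 p.2 q.2 := by
  simp [mulMap]

theorem shuffle_mem_between (x y : G) (w v : List ι) : D.shuffle x y w v ∈
    between k r (x + y) (target r (x, w) + target r (y, v)) (w.length + v.length) := by
  induction w, v using shuffle.induct with
  | case1 =>
    rw [shuffle]
    simpa [HopfPath.length] using ofPath_mem_between (k := k) r (x + y, ([] : List ι))
  | case2 i w ih =>
    rw [shuffle]
    exact Submodule.smul_mem _ _ (mem_between_of_eq (pathCons_mem_between i ih) rfl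
      (by simp [add_assoc]) (by simp))
  | case3 j v ih =>
    rw [shuffle]
    exact Submodule.smul_mem _ _ (mem_between_of_eq (pathCons_mem_between j ih) rfl
      (by simp [add_left_comm]) (by simp))
  | case4 i w j v ih1 ih2 =>
    rw [shuffle]
    refine add_mem (Submodule.smul_mem _ _ ?_) (Submodule.smul_mem _ _ ?_)
    · exact mem_between_of_eq (pathCons_mem_between i ih1) rfl (by simp [add_assoc])
        (by simp only [List.length_cons]; omega)
    · exact mem_between_of_eq (pathCons_mem_between j ih2) rfl (by simp [add_left_comm])
        (by simp only [List.length_cons]; omega)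

theorem mulMap_mem_between_ofPath (p q : HopfPath G ι) :
    D.mulMap (ofPath k r p ⊗ₜ ofPath k r q) ∈
      between k r (p.1 + q.1) (target r p + target r q) (p.length + q.length) := by
  rw [mulMap_ofPath]
  exact D.shuffle_mem_between p.1 q.1 p.2 q.2

theorem mulMap_vertex (x y : G) :
    D.mulMap (ofPath k r (vertex x) ⊗ₜ ofPath k r (vertex y)) = ofPath k r (vertex (x + y)) := by
  rw [mulMap_ofPath, vertex, vertex, shuffle]; rfl

/-- A twisted Leibniz rule: the last arrow of a shuffle comes from one of the two factors. The
coefficients depend on the targets only, so the rule extends linearly to combinations of paths with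
a common target. -/
theorem dropLast_mulMap_ofPath (i : ι) (p q : HopfPath G ι) :
    dropLast k r i (D.mulMap (ofPath k r p ⊗ₜ ofPath k r q)) =
      D.R (target r p - r i) i (target r q) •
          D.mulMap (dropLast k r i (ofPath k r p) ⊗ₜ ofPath k r q) +
        D.L (target r p) (target r q - r i) i •
          D.mulMap (ofPath k r p ⊗ₜ dropLast k r i (ofPath k r q)) := by
  classical
  obtain ⟨x, w⟩ := p
  obtain ⟨y, v⟩ := q
  rw [mulMap_ofPath]
  cases w with
  | nil =>
    cases v with
    | nil => simp [shuffle]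
    | cons j v =>
      by_cases h : j = i
      · subst h
        simp [shuffle, dropLast_pathCons, dropLast_cons, mulMap_ofPath]
      · simp [shuffle, dropLast_pathCons, dropLast_cons, h]
  | cons l w =>
    cases v with
    | nil =>
      by_cases h : l = i
      · subst h
        simp [shuffle, dropLast_pathCons, dropLast_cons, mulMap_ofPath]
      · simp [shuffle, dropLast_pathCons, dropLast_cons, h]
    | cons j v =>
      by_cases h : l = i <;> by_cases h' : j = i
      · subst h
        subst h'
        simp [shuffle, dropLast_pathCons, dropLast_cons, mulMap_ofPath]
      · subst h
        simp [shuffle, dropLast_pathCons, dropLast_cons, mulMap_ofPath, h']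
      · subst h'
        simp [shuffle, dropLast_pathCons, dropLast_cons, mulMap_ofPath, h]
      · simp [shuffle, dropLast_pathCons, dropLast_cons, h, h']

theorem dropLast_mulMap (i : ι) {s t s' t' : G} {n n' : ℕ} {u v : PathCoalgebra k r}
    (hu : u ∈ between k r s t n) (hv : v ∈ between k r s' t' n') :
    dropLast k r i (D.mulMap (u ⊗ₜ v)) =
      D.R (t - r i) i t' • D.mulMap (dropLast k r i u ⊗ₜ v) +
        D.L t (t' - r i) i • D.mulMap (u ⊗ₜ dropLast k r i v) := by
  refine between_induction (P := fun u => dropLast k r i (D.mulMap (u ⊗ₜ v)) =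
      D.R (t - r i) i t' • D.mulMap (dropLast k r i u ⊗ₜ v) +
        D.L t (t' - r i) i • D.mulMap (u ⊗ₜ dropLast k r i v)) (by simp)
    (fun a b ha hb => ?_) (fun c a ha => ?_) (fun p _ hp _ => ?_) hu
  · simp only [TensorProduct.add_tmul, map_add, ha, hb, smul_add]; abel
  · simp only [← TensorProduct.smul_tmul', map_smul, ha, smul_add, smul_comm c]
  refine between_induction (P := fun v => dropLast k r i (D.mulMap (ofPath k r p ⊗ₜ v)) =
      D.R (t - r i) i t' • D.mulMap (dropLast k r i (ofPath k r p) ⊗ₜ v) +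
        D.L t (t' - r i) i • D.mulMap (ofPath k r p ⊗ₜ dropLast k r i v)) (by simp)
    (fun a b ha hb => ?_) (fun c a ha => ?_) (fun q _ hq _ => ?_) hv
  · simp only [TensorProduct.tmul_add, map_add, ha, hb, smul_add]; abel
  · simp only [TensorProduct.tmul_smul, map_smul, ha, smul_add, smul_comm c]
  · subst hp
    subst hq
    exact D.dropLast_mulMap_ofPath i p q

theorem vertexPart_mulMap_ofPath (p q : HopfPath G ι) :
    vertexPart k r (D.mulMap (ofPath k r p ⊗ₜ ofPath k r q)) =
      D.mulMap (vertexPart k r (ofPath k r p) ⊗ₜ vertexPart k r (ofPath k r q)) := by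
  obtain ⟨x, w⟩ := p
  obtain ⟨y, v⟩ := q
  rw [mulMap_ofPath, vertexPart_ofPath, vertexPart_ofPath]
  cases w <;> cases v <;>
    simp [shuffle, vertexPart_pathCons, vertexPart_ofPath, mulMap_ofPath, HopfPath.length]

theorem vertexPart_mulMap (u v : PathCoalgebra k r) :
    vertexPart k r (D.mulMap (u ⊗ₜ v)) = D.mulMap (vertexPart k r u ⊗ₜ vertexPart k r v) := by
  have : vertexPart k r ∘ₗ D.mulMap =
      D.mulMap ∘ₗ TensorProduct.map (vertexPart k r) (vertexPart k r) :=
    TensorProduct.ext (hom_ext fun p => hom_ext fun q => by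
      simpa using D.vertexPart_mulMap_ofPath p q)
  exact LinearMap.congr_fun this (u ⊗ₜ v)

/-- Induction on the total length. Deleting a last arrow gives three terms on each side, according
to the factor that contains the arrow; the change of `φ` at the targets is absorbed by the three
bimodule axioms. -/
theorem mulMap_assoc_ofPath (p q s : HopfPath G ι) :
    φ p.1 q.1 s.1 • D.mulMap (ofPath k r p ⊗ₜ D.mulMap (ofPath k r q ⊗ₜ ofPath k r s)) =
      φ (target r p) (target r q) (target r s) •
        D.mulMap (D.mulMap (ofPath k r p ⊗ₜ ofPath k r q) ⊗ₜ ofPath k r s) := by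
  induction h : p.length + q.length + s.length using Nat.strong_induction_on generalizing p q s with
  | _ n ih =>
  refine ext_dropLast ?_ fun i => ?_
  · simp only [map_smul, vertexPart_mulMap, vertexPart_ofPath]
    by_cases hp : p.length = 0
    · by_cases hq : q.length = 0
      · by_cases hs : s.length = 0
        · rw [HopfPath.length_eq_zero hp, HopfPath.length_eq_zero hq,
            HopfPath.length_eq_zero hs]
          have h0 (x : G) : (vertex x : HopfPath G ι).length = 0 := rfl
          have h1 (x : G) : (vertex x : HopfPath G ι).1 = x := rfl
          have h2 (x : G) : target r (vertex x) = x := target_nil r x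
          simp only [h0, h1, h2, if_true, mulMap_vertex, add_assoc]
        · simp [hs]
      · simp [hq]
    · simp [hp]
  · have e1 := D.dropLast_mulMap i (ofPath_mem_between (k := k) r p)
      (D.mulMap_mem_between_ofPath q s)
    have e2 := D.dropLast_mulMap i (D.mulMap_mem_between_ofPath p q)
      (ofPath_mem_between (k := k) r s)
    rw [map_smul, map_smul, e1, e2, D.dropLast_mulMap_ofPath, D.dropLast_mulMap_ofPath]
    simp only [TensorProduct.tmul_add, TensorProduct.add_tmul, TensorProduct.tmul_smul,
      ← TensorProduct.smul_tmul', map_add, map_smul, smul_add, smul_smul]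
    rw [add_assoc]
    -- The axioms are applied to the arrow with label `i` that ends at the target of `p`, of `q` or
    -- of `s`, hence starts at that target minus `r i`.
    have c1 := D.right_assoc (target r p - r i) i (target r q) (target r s)
    have c2 := D.middle_assoc (target r p) (target r q - r i) i (target r s)
    have c3 := D.left_assoc (target r p) (target r q) (target r s - r i) i
    rw [add_sub_cancel] at c1 c2 c3
    rw [show target r p - r i + target r q = target r p + target r q - r i by abel] at c1
    rw [show target r q - r i + target r s = target r q + target r s - r i by abel,
      show target r p + (target r q - r i) = target r p + target r q - r i by abel] at c2
    rw [show target r q + (target r s - r i) = target r q + target r s - r i by abel] at c3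
    congr 1
    · rcases dropLast_ofPath_cases (k := k) i p with h0 | ⟨p', h0, h1, h2, h3⟩
      · rw [h0]; simp
      · have := ih _ (by omega) p' q s rfl
        rw [h1, h2] at this
        rw [h0, mul_comm, mul_smul, this, smul_smul, mul_comm, c1]
        congr 1
        ring
    congr 1
    · rcases dropLast_ofPath_cases (k := k) i q with h0 | ⟨p', h0, h1, h2, h3⟩
      · rw [h0]; simp
      · have := ih _ (by omega) p p' s rfl
        rw [h1, h2] at this
        rw [h0, mul_comm, mul_smul, this, smul_smul]
        congr 1
        linear_combination c2
    · rcases dropLast_ofPath_cases (k := k) i s with h0 | ⟨p', h0, h1, h2, h3⟩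
      · rw [h0]; simp
      · have := ih _ (by omega) p q p' rfl
        rw [h1, h2] at this
        rw [h0, mul_comm, mul_smul, this, smul_smul]
        congr 1
        linear_combination c3

theorem mulMap_vertex_zero_left (u : PathCoalgebra k r) :
    D.mulMap (ofPath k r (vertex 0) ⊗ₜ u) = u := by
  have : D.mulMap ∘ₗ TensorProduct.mk k _ _ (ofPath k r (vertex 0)) = LinearMap.id := by
    refine hom_ext fun ⟨y, v⟩ => ?_
    simp only [LinearMap.comp_apply, TensorProduct.mk_apply,
      LinearMap.id_apply, mulMap_ofPath, vertex]
    induction v with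
    | nil => simp [shuffle]
    | cons i v ih => simp [shuffle, D.L_zero, ih]
  exact LinearMap.congr_fun this u

theorem mulMap_vertex_zero_right (u : PathCoalgebra k r) :
    D.mulMap (u ⊗ₜ ofPath k r (vertex 0)) = u := by
  have : D.mulMap ∘ₗ (TensorProduct.mk k _ _).flip (ofPath k r (vertex 0)) =
      LinearMap.id := by
    refine hom_ext fun ⟨y, v⟩ => ?_
    simp only [LinearMap.comp_apply, LinearMap.flip_apply, TensorProduct.mk_apply,
      LinearMap.id_apply, mulMap_ofPath, vertex]
    induction v with
    | nil => simp [shuffle]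
    | cons i v ih => simp [shuffle, D.R_zero, ih]
  exact LinearMap.congr_fun this u

/-- The componentwise product on `𝕜Q ⊗ 𝕜Q`. -/
def mulMap₂ : (PathCoalgebra k r ⊗[k] PathCoalgebra k r) ⊗[k]
    (PathCoalgebra k r ⊗[k] PathCoalgebra k r) →ₗ[k]
      PathCoalgebra k r ⊗[k] PathCoalgebra k r :=
  TensorProduct.map D.mulMap D.mulMap ∘ₗ
    (TensorProduct.AlgebraTensorModule.tensorTensorTensorComm k k k k _ _ _ _).toLinearMap

theorem mulMap₂_tmul (a b c d : PathCoalgebra k r) : D.mulMap₂ ((a ⊗ₜ b) ⊗ₜ (c ⊗ₜ d)) =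
    D.mulMap (a ⊗ₜ c) ⊗ₜ D.mulMap (b ⊗ₜ d) := by
  simp [mulMap₂]

theorem rTensor_dropLast_mulMap₂ (i : ι) (p q : HopfPath G ι) :
    (dropLast k r i).rTensor _ (D.mulMap₂ (CoalgebraStruct.comul (R := k) (ofPath k r p) ⊗ₜ
        CoalgebraStruct.comul (R := k) (ofPath k r q))) =
      D.R (target r p - r i) i (target r q) • D.mulMap₂ (
          (dropLast k r i).rTensor _ (CoalgebraStruct.comul (R := k) (ofPath k r p)) ⊗ₜ
            CoalgebraStruct.comul (R := k) (ofPath k r q)) +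
        D.L (target r p) (target r q - r i) i • D.mulMap₂ (
          CoalgebraStruct.comul (R := k) (ofPath k r p) ⊗ₜ
            (dropLast k r i).rTensor _ (CoalgebraStruct.comul (R := k) (ofPath k r q))) := by
  simp only [comul_ofPath, TensorProduct.sum_tmul, TensorProduct.tmul_sum, map_sum,
    mulMap₂_tmul, LinearMap.rTensor_tmul, Finset.smul_sum, ← Finset.sum_add_distrib]
  refine Finset.sum_congr rfl fun l _ => Finset.sum_congr rfl fun j _ => ?_
  rw [D.dropLast_mulMap_ofPath, target_final, target_final, TensorProduct.add_tmul,
    TensorProduct.smul_tmul', TensorProduct.smul_tmul']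

theorem rTensor_vertexPart_mulMap₂ (z z' : PathCoalgebra k r ⊗[k] PathCoalgebra k r) :
    (vertexPart k r).rTensor _ (D.mulMap₂ (z ⊗ₜ z')) =
      D.mulMap₂ ((vertexPart k r).rTensor _ z ⊗ₜ (vertexPart k r).rTensor _ z') := by
  induction z with
  | zero => simp
  | add a b ha hb => simp only [TensorProduct.add_tmul, map_add, ha, hb]
  | tmul a b =>
    induction z' with
    | zero => simp
    | add c d hc hd => simp only [TensorProduct.tmul_add, map_add, hc, hd]
    | tmul c d => simp [mulMap₂_tmul, vertexPart_mulMap]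

theorem rTensor_vertexPart_comul_of_mem {s t : G} {n : ℕ} {u : PathCoalgebra k r}
    (hu : u ∈ between k r s t n) :
    (vertexPart k r).rTensor _ (CoalgebraStruct.comul (R := k) u) =
      ofPath k r (vertex t) ⊗ₜ[k] u :=
  eqOn_between (f := (vertexPart k r).rTensor _ ∘ₗ CoalgebraStruct.comul (R := k))
    (g := TensorProduct.mk k _ _ (ofPath k r (vertex t)))
    (fun p _ hp _ => by
      subst hp
      exact rTensor_vertexPart_comul p) hu

/-- Both sides satisfy the same Leibniz rule for deletion in the left factor, because the final
parts of a path share its target. The vertex parts are computed by multiplying targets. -/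
theorem comul_mulMap_ofPath (p q : HopfPath G ι) :
    CoalgebraStruct.comul (R := k) (D.mulMap (ofPath k r p ⊗ₜ ofPath k r q)) =
      D.mulMap₂ (CoalgebraStruct.comul (R := k) (ofPath k r p) ⊗ₜ
        CoalgebraStruct.comul (R := k) (ofPath k r q)) := by
  induction h : p.length + q.length using Nat.strong_induction_on generalizing p q with
  | _ n ih =>
  refine tensor_ext_dropLast ?_ fun i => ?_
  · rw [rTensor_vertexPart_comul_of_mem (D.mulMap_mem_between_ofPath p q),
      rTensor_vertexPart_mulMap₂, rTensor_vertexPart_comul, rTensor_vertexPart_comul,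
      mulMap₂_tmul, mulMap_vertex]
  · rw [← comul_dropLast, D.dropLast_mulMap_ofPath, rTensor_dropLast_mulMap₂,
      ← comul_dropLast, ← comul_dropLast, map_add, map_smul, map_smul]
    congr 2
    · rcases dropLast_ofPath_cases (k := k) i p with h0 | ⟨p', h0, h1, h2, h3⟩
      · rw [h0]; simp
      · rw [h0, ih _ (by omega) p' q rfl]
    · rcases dropLast_ofPath_cases (k := k) i q with h0 | ⟨p', h0, h1, h2, h3⟩
      · rw [h0]; simp
      · rw [h0, ih _ (by omega) p p' rfl]

theorem counit_eq_zero_of_mem {s t : G} {n : ℕ} (hn : n ≠ 0) {u : PathCoalgebra k r}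
    (hu : u ∈ between k r s t n) : CoalgebraStruct.counit (R := k) u = 0 :=
  eqOn_between (f := CoalgebraStruct.counit (R := k)) (g := 0)
    (fun p _ _ hp => by simp [counit_ofPath, hp, hn]) hu

theorem counit_mulMap_ofPath (p q : HopfPath G ι) :
    CoalgebraStruct.counit (R := k) (D.mulMap (ofPath k r p ⊗ₜ ofPath k r q)) =
      CoalgebraStruct.counit (R := k) (ofPath k r p) *
        CoalgebraStruct.counit (R := k) (ofPath k r q) := by
  by_cases h : p.length + q.length = 0
  · have hp : p.length = 0 := by omega
    have hq : q.length = 0 := by omega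
    rw [HopfPath.length_eq_zero hp, HopfPath.length_eq_zero hq, mulMap_vertex]
    simp [counit_ofPath, vertex, HopfPath.length]
  · rw [counit_eq_zero_of_mem h (D.mulMap_mem_between_ofPath p q), counit_ofPath, counit_ofPath]
    by_cases hp : p.length = 0
    · have hq : q.length ≠ 0 := by omega
      simp [hq]
    · simp [hp]

/-- The multiplication as a morphism of coalgebras. -/
def mulHom : PathCoalgebra k r ⊗[k] PathCoalgebra k r →ₗc[k] PathCoalgebra k r where
  toLinearMap := D.mulMap
  counit_comp := by
    refine TensorProduct.ext (hom_ext fun p => hom_ext fun q => ?_)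
    simp [counit_mulMap_ofPath, mul_comm]
  map_comp_comul := by
    refine TensorProduct.ext (hom_ext fun p => hom_ext fun q => ?_)
    exact (D.comul_mulMap_ofPath p q).symm

end ArrowBimodule

/-! ### Convolution with functionals concentrated in degree zero -/

section Convolution

variable {k C D V : Type*} [Field k] [AddCommGroup C] [Module k C] [Coalgebra k C]
  [AddCommGroup D] [Module k D] [Coalgebra k D] [AddCommGroup V] [Module k V]

/-- With `π` the projection onto vertices and `c` a path, `t` is the target. A convolution with a
degree-zero functional thereby becomes multiplication by its value at the target (from the left) or
at the source (from the right). -/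
theorem convLeft_apply_of_rTensor {π : C →ₗ[k] C} {φ : C →ₗ[k] k} (hφ : φ ∘ₗ π = φ)
    (F : C →ₗ[k] V) {c t : C}
    (h : π.rTensor C (CoalgebraStruct.comul (R := k) c) = t ⊗ₜ[k] c) :
    convLeft φ F c = φ t • F c := by
  have e : TensorProduct.map φ F = TensorProduct.map φ F ∘ₗ π.rTensor C := by
    rw [LinearMap.map_comp_rTensor, hφ]
  simp only [convLeft, convAlong, LinearMap.comp_apply]
  rw [e, LinearMap.comp_apply, h]
  simp

theorem convRight_apply_of_lTensor {π : C →ₗ[k] C} {φ : C →ₗ[k] k} (hφ : φ ∘ₗ π = φ)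
    (F : C →ₗ[k] V) {c s : C}
    (h : π.lTensor C (CoalgebraStruct.comul (R := k) c) = c ⊗ₜ[k] s) :
    convRight F φ c = φ s • F c := by
  have e : TensorProduct.map F φ = TensorProduct.map F φ ∘ₗ π.lTensor C := by
    rw [LinearMap.map_comp_lTensor, hφ]
  simp only [convRight, convAlong, LinearMap.comp_apply]
  rw [e, LinearMap.comp_apply, h]
  simp

theorem rTensor_map_comul_tmul {π : C →ₗ[k] C} {ρ : D →ₗ[k] D} {c t : C} {d t' : D}
    (h : π.rTensor C (CoalgebraStruct.comul (R := k) c) = t ⊗ₜ[k] c)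
    (h' : ρ.rTensor D (CoalgebraStruct.comul (R := k) d) = t' ⊗ₜ[k] d) :
    (TensorProduct.map π ρ).rTensor (C ⊗[k] D) (CoalgebraStruct.comul (R := k) (c ⊗ₜ[k] d)) =
      (t ⊗ₜ[k] t') ⊗ₜ[k] (c ⊗ₜ[k] d) := by
  have e : (TensorProduct.map π ρ).rTensor (C ⊗[k] D) ∘ₗ
      (TensorProduct.AlgebraTensorModule.tensorTensorTensorComm k k k k C C D D).toLinearMap =
      (TensorProduct.AlgebraTensorModule.tensorTensorTensorComm k k k k C C D D).toLinearMap ∘ₗ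
        TensorProduct.map (π.rTensor C) (ρ.rTensor D) := by
    ext; simp
  have := LinearMap.congr_fun e (CoalgebraStruct.comul (R := k) c ⊗ₜ[k]
    CoalgebraStruct.comul (R := k) d)
  simp only [LinearMap.comp_apply, TensorProduct.map_tmul, h, h'] at this
  simpa using this

theorem lTensor_map_comul_tmul {π : C →ₗ[k] C} {ρ : D →ₗ[k] D} {c s : C} {d s' : D}
    (h : π.lTensor C (CoalgebraStruct.comul (R := k) c) = c ⊗ₜ[k] s)
    (h' : ρ.lTensor D (CoalgebraStruct.comul (R := k) d) = d ⊗ₜ[k] s') :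
    (TensorProduct.map π ρ).lTensor (C ⊗[k] D) (CoalgebraStruct.comul (R := k) (c ⊗ₜ[k] d)) =
      (c ⊗ₜ[k] d) ⊗ₜ[k] (s ⊗ₜ[k] s') := by
  have e : (TensorProduct.map π ρ).lTensor (C ⊗[k] D) ∘ₗ
      (TensorProduct.AlgebraTensorModule.tensorTensorTensorComm k k k k C C D D).toLinearMap =
      (TensorProduct.AlgebraTensorModule.tensorTensorTensorComm k k k k C C D D).toLinearMap ∘ₗ
        TensorProduct.map (π.lTensor C) (ρ.lTensor D) := by
    ext; simp
  have := LinearMap.congr_fun e (CoalgebraStruct.comul (R := k) c ⊗ₜ[k]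
    CoalgebraStruct.comul (R := k) d)
  simp only [LinearMap.comp_apply, TensorProduct.map_tmul, h, h'] at this
  simpa using this

theorem convRight_counit (F : C →ₗ[k] V) :
    convRight F (CoalgebraStruct.counit (R := k) (A := C)) = F := by
  ext u
  have h := congrArg (TensorProduct.map F LinearMap.id) (Coalgebra.lTensor_counit_comul (R := k) u)
  simpa [convRight, convAlong, LinearMap.lTensor, TensorProduct.map_map] using
    congrArg (TensorProduct.rid k V) h

theorem convRight_comp_coalgHom (F : D →ₗ[k] V) (θ : D →ₗ[k] k) (μ : C →ₗc[k] D) (z : C) :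
    convRight F θ (μ z) = convRight (F ∘ₗ μ.toLinearMap) (θ ∘ₗ μ.toLinearMap) z := by
  have hc : CoalgebraStruct.comul (R := k) (μ z) =
      TensorProduct.map μ.toLinearMap μ.toLinearMap (CoalgebraStruct.comul (R := k) z) :=
    (LinearMap.congr_fun μ.map_comp_comul z).symm
  simp only [convRight, convAlong, LinearMap.comp_apply, hc, TensorProduct.map_map]

theorem convLeft_comp_coalgHom (F : D →ₗ[k] V) (θ : D →ₗ[k] k) (μ : C →ₗc[k] D) (z : C) :
    convLeft θ F (μ z) = convLeft (θ ∘ₗ μ.toLinearMap) (F ∘ₗ μ.toLinearMap) z := by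
  have hc : CoalgebraStruct.comul (R := k) (μ z) =
      TensorProduct.map μ.toLinearMap μ.toLinearMap (CoalgebraStruct.comul (R := k) z) :=
    (LinearMap.congr_fun μ.map_comp_comul z).symm
  simp only [convLeft, convAlong, LinearMap.comp_apply, hc, TensorProduct.map_map]

theorem convRight_add (F : C →ₗ[k] V) (θ θ' : C →ₗ[k] k) :
    convRight F (θ + θ') = convRight F θ + convRight F θ' := by
  simp only [convRight, convAlong, TensorProduct.map_add_right, LinearMap.add_comp,
    LinearMap.comp_add]

theorem convRight_smul (F : C →ₗ[k] V) (a : k) (θ : C →ₗ[k] k) :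
    convRight F (a • θ) = a • convRight F θ := by
  simp only [convRight, convAlong, TensorProduct.map_smul_right, LinearMap.smul_comp,
    LinearMap.comp_smul]

theorem convRight_map_tmul (F : C ⊗[k] D →ₗ[k] V) (θ : C →ₗ[k] k) (θ' : D →ₗ[k] k) (c : C)
    (d : D) : convRight F ((TensorProduct.lid k k).toLinearMap ∘ₗ TensorProduct.map θ θ')
      (c ⊗ₜ d) = F (convRight LinearMap.id θ c ⊗ₜ convRight LinearMap.id θ' d) := by
  simp only [convRight, convAlong, LinearMap.comp_apply, TensorProduct.comul_tmul]
  induction CoalgebraStruct.comul (R := k) c with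
  | zero => simp
  | add x y hx hy => simp only [TensorProduct.add_tmul, map_add, hx, hy]
  | tmul x y =>
    induction CoalgebraStruct.comul (R := k) d with
    | zero => simp
    | add x y hx hy => simp only [TensorProduct.tmul_add, map_add, hx, hy]
    | tmul x' y' => simp [← TensorProduct.smul_tmul', smul_smul, mul_comm (θ y)]

end Convolution

namespace PathCoalgebra

open HopfPath

variable {k : Type*} [Field k] {G ι : Type*} [AddCommGroup G] {r : ι → G}

/-- The functional on triples of paths that is given by `φ` on vertices and vanishes on all other
triples of paths. -/
def vertexFunctional (r : ι → G) (φ : G → G → G → k) :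
    PathCoalgebra k r ⊗[k] (PathCoalgebra k r ⊗[k] PathCoalgebra k r) →ₗ[k] k :=
  TensorProduct.lift (lift fun p => TensorProduct.lift (lift fun q => lift fun s =>
    if p.length + q.length + s.length = 0 then φ p.1 q.1 s.1 else 0))

theorem vertexFunctional_ofPath (φ : G → G → G → k) (p q s : HopfPath G ι) :
    vertexFunctional r φ (ofPath k r p ⊗ₜ (ofPath k r q ⊗ₜ ofPath k r s)) =
      if p.length + q.length + s.length = 0 then φ p.1 q.1 s.1 else 0 := by
  simp [vertexFunctional]

theorem vertexFunctional_vertex (φ : G → G → G → k) (x y z : G) :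
    vertexFunctional r φ (ofPath k r (vertex x) ⊗ₜ (ofPath k r (vertex y) ⊗ₜ
      ofPath k r (vertex z))) = φ x y z := by
  simp [vertexFunctional_ofPath, vertex, HopfPath.length]

theorem eq_vertexFunctional {φ : G → G → G → k}
    {Φ : PathCoalgebra k r ⊗[k] (PathCoalgebra k r ⊗[k] PathCoalgebra k r) →ₗ[k] k}
    (h0 : ∀ x y z, Φ (ofPath k r (vertex x) ⊗ₜ (ofPath k r (vertex y) ⊗ₜ
      ofPath k r (vertex z))) = φ x y z)
    (h : ∀ p q s : HopfPath G ι, 0 < p.length + q.length + s.length →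
      Φ (ofPath k r p ⊗ₜ (ofPath k r q ⊗ₜ ofPath k r s)) = 0) :
    Φ = vertexFunctional r φ := by
  refine TensorProduct.ext (hom_ext fun p => TensorProduct.ext (hom_ext fun q =>
    hom_ext fun s => ?_))
  change Φ (ofPath k r p ⊗ₜ (ofPath k r q ⊗ₜ ofPath k r s)) =
    vertexFunctional r φ (ofPath k r p ⊗ₜ (ofPath k r q ⊗ₜ ofPath k r s))
  rw [vertexFunctional_ofPath]
  split_ifs with hl
  · rw [HopfPath.length_eq_zero (p := p) (by omega), HopfPath.length_eq_zero (p := q) (by omega),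
      HopfPath.length_eq_zero (p := s) (by omega)]
    exact h0 _ _ _
  · exact h p q s (by omega)

theorem vertexFunctional_vertexPart (φ : G → G → G → k) (u v w : PathCoalgebra k r) :
    vertexFunctional r φ (vertexPart k r u ⊗ₜ (vertexPart k r v ⊗ₜ vertexPart k r w)) =
      vertexFunctional r φ (u ⊗ₜ (v ⊗ₜ w)) := by
  have : vertexFunctional r φ ∘ₗ TensorProduct.map (vertexPart k r)
      (TensorProduct.map (vertexPart k r) (vertexPart k r)) = vertexFunctional r φ := by
    refine eq_vertexFunctional (fun x y z => ?_) (fun p q s h => ?_)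
    · simp [vertexPart_ofPath, vertexFunctional_ofPath, vertex, HopfPath.length]
    · simp only [LinearMap.comp_apply, TensorProduct.map_tmul, vertexPart_ofPath]
      by_cases hp : p.length = 0
      · by_cases hq : q.length = 0
        · have hs : s.length ≠ 0 := by omega
          simp [hs]
        · simp [hq]
      · simp [hp]
  exact LinearMap.congr_fun this (u ⊗ₜ (v ⊗ₜ w))

theorem vertexFunctional_comp_map (φ : G → G → G → k) :
    vertexFunctional r φ ∘ₗ TensorProduct.map (vertexPart k r)
      (TensorProduct.map (vertexPart k r) (vertexPart k r)) = vertexFunctional r φ :=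
  TensorProduct.ext (LinearMap.ext fun u => TensorProduct.ext (LinearMap.ext fun v =>
    LinearMap.ext fun w => vertexFunctional_vertexPart φ u v w))

theorem convLeft_vertexFunctional {V : Type*} [AddCommGroup V] [Module k V]
    (φ : G → G → G → k)
    (F : PathCoalgebra k r ⊗[k] (PathCoalgebra k r ⊗[k] PathCoalgebra k r) →ₗ[k] V)
    (p q s : HopfPath G ι) :
    convLeft (vertexFunctional r φ) F (ofPath k r p ⊗ₜ (ofPath k r q ⊗ₜ ofPath k r s)) =
      φ (p.target r) (q.target r) (s.target r) •
        F (ofPath k r p ⊗ₜ (ofPath k r q ⊗ₜ ofPath k r s)) := by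
  rw [convLeft_apply_of_rTensor (vertexFunctional_comp_map φ) F
    (rTensor_map_comul_tmul (rTensor_vertexPart_comul p)
      (rTensor_map_comul_tmul (rTensor_vertexPart_comul q) (rTensor_vertexPart_comul s))),
    vertexFunctional_vertex]

theorem convRight_vertexFunctional {V : Type*} [AddCommGroup V] [Module k V]
    (φ : G → G → G → k)
    (F : PathCoalgebra k r ⊗[k] (PathCoalgebra k r ⊗[k] PathCoalgebra k r) →ₗ[k] V)
    (p q s : HopfPath G ι) :
    convRight F (vertexFunctional r φ) (ofPath k r p ⊗ₜ (ofPath k r q ⊗ₜ ofPath k r s)) =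
      φ p.1 q.1 s.1 • F (ofPath k r p ⊗ₜ (ofPath k r q ⊗ₜ ofPath k r s)) := by
  rw [convRight_apply_of_lTensor (vertexFunctional_comp_map φ) F
    (lTensor_map_comul_tmul (lTensor_vertexPart_comul p)
      (lTensor_map_comul_tmul (lTensor_vertexPart_comul q) (lTensor_vertexPart_comul s))),
    vertexFunctional_vertex]

theorem counit_vertexPart (u : PathCoalgebra k r) :
    CoalgebraStruct.counit (R := k) (vertexPart k r u) = CoalgebraStruct.counit (R := k) u := by
  have : CoalgebraStruct.counit ∘ₗ vertexPart k r = CoalgebraStruct.counit (R := k) := by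
    refine hom_ext fun p => ?_
    by_cases h : p.length = 0 <;> simp [vertexPart_ofPath, counit_ofPath, h]
  exact LinearMap.congr_fun this u

theorem coord_concat (x : G) (w : List ι) (i : ι) :
    (basis k r).coord (x, w ++ [i]) = (basis k r).coord (r i + x, w) ∘ₗ dropFirst k r i := by
  classical
  refine hom_ext fun ⟨y, v⟩ => ?_
  rcases List.eq_nil_or_concat' v with rfl | ⟨v, j, rfl⟩
  · simp [-Module.Basis.coord_apply, coord_ofPath]
  · by_cases h : j = i
    · subst h
      simp [-Module.Basis.coord_apply, coord_ofPath, dropFirst_concat]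
    · simp [-Module.Basis.coord_apply, coord_ofPath, dropFirst_concat, h]

theorem ext_dropFirst {u v : PathCoalgebra k r}
    (h0 : vertexPart k r u = vertexPart k r v)
    (h : ∀ i, dropFirst k r i u = dropFirst k r i v) : u = v := by
  refine (basis k r).ext_elem fun p => ?_
  change (basis k r).coord p u = (basis k r).coord p v
  obtain ⟨x, w⟩ := p
  rcases List.eq_nil_or_concat' w with rfl | ⟨w, i, rfl⟩
  · rw [coord_nil, LinearMap.comp_apply, h0, LinearMap.comp_apply]
  · rw [coord_concat, LinearMap.comp_apply, h, LinearMap.comp_apply]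

theorem convRight_tmul_ofPath {V : Type*} [AddCommGroup V] [Module k V]
    (F : PathCoalgebra k r ⊗[k] PathCoalgebra k r →ₗ[k] V)
    (θ : PathCoalgebra k r ⊗[k] PathCoalgebra k r →ₗ[k] k) (p q : HopfPath G ι) :
    convRight F θ (ofPath k r p ⊗ₜ ofPath k r q) =
      ∑ j ∈ Finset.range (p.length + 1), ∑ l ∈ Finset.range (q.length + 1),
        θ (ofPath k r (p.initial j) ⊗ₜ ofPath k r (q.initial l)) •
          F (ofPath k r (p.final r j) ⊗ₜ ofPath k r (q.final r l)) := by
  simp only [convRight, convAlong, LinearMap.comp_apply, TensorProduct.comul_tmul, comul_ofPath,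
    TensorProduct.sum_tmul, TensorProduct.tmul_sum, map_sum,
    TensorProduct.AlgebraTensorModule.tensorTensorTensorComm_tmul, TensorProduct.map_tmul,
    LinearEquiv.coe_coe, TensorProduct.rid_tmul]
  exact Finset.sum_comm

/-- If the coefficients of arrows satisfy a twisted Leibniz rule, so does the deletion of first
arrows. -/
theorem dropFirst_mul (μ : PathCoalgebra k r ⊗[k] PathCoalgebra k r →ₗc[k] PathCoalgebra k r)
    (i : ι) (p q : HopfPath G ι) (a b : k)
    (h : ∀ j l, arrowCoeff k r i (μ (ofPath k r (p.initial j) ⊗ₜ ofPath k r (q.initial l))) =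
      a * (arrowCoeff k r i (ofPath k r (p.initial j)) *
        CoalgebraStruct.counit (R := k) (ofPath k r (q.initial l))) +
      b * (CoalgebraStruct.counit (R := k) (ofPath k r (p.initial j)) *
        arrowCoeff k r i (ofPath k r (q.initial l)))) :
    dropFirst k r i (μ (ofPath k r p ⊗ₜ ofPath k r q)) =
      a • μ (dropFirst k r i (ofPath k r p) ⊗ₜ ofPath k r q) +
        b • μ (ofPath k r p ⊗ₜ dropFirst k r i (ofPath k r q)) := by
  set ω := arrowCoeff k r i
  set ε := CoalgebraStruct.counit (R := k) (A := PathCoalgebra k r)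
  -- By hypothesis `ω ∘ μ` agrees with `θ` on all pairs of initial parts of `p` and `q`, and these
  -- are the only arguments that occur in the convolution.
  set θ : PathCoalgebra k r ⊗[k] PathCoalgebra k r →ₗ[k] k :=
    a • ((TensorProduct.lid k k).toLinearMap ∘ₗ TensorProduct.map ω ε) +
      b • ((TensorProduct.lid k k).toLinearMap ∘ₗ TensorProduct.map ε ω) with hθ
  have h1 : dropFirst k r i (μ (ofPath k r p ⊗ₜ ofPath k r q)) =
      convRight μ.toLinearMap θ (ofPath k r p ⊗ₜ ofPath k r q) := by
    rw [dropFirst, convRight_comp_coalgHom, convRight_tmul_ofPath, convRight_tmul_ofPath]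
    refine Finset.sum_congr rfl fun j _ => Finset.sum_congr rfl fun l _ => ?_
    congr 1
    exact (h j l).trans (by simp [hθ])
  rw [h1, hθ, convRight_add, convRight_smul, convRight_smul, LinearMap.add_apply,
    LinearMap.smul_apply, LinearMap.smul_apply, convRight_map_tmul, convRight_map_tmul,
    convRight_counit]
  rfl

end PathCoalgebra

/-- A telescoping device for the antipode: by the Leibniz rule each summand has two parts, and
neighbouring summands cancel. -/
theorem sum_range_succ_add_eq_zero {M : Type*} [AddCommGroup M] {n : ℕ} {a b : ℕ → M}
    (h0 : a 0 = 0) (hn : b n = 0) (h : ∀ j < n, a (j + 1) + b j = 0) :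
    ∑ j ∈ Finset.range (n + 1), (a j + b j) = 0 := by
  rw [Finset.sum_add_distrib, Finset.sum_range_succ', Finset.sum_range_succ, h0, hn, add_zero,
    add_zero, ← Finset.sum_add_distrib]
  exact Finset.sum_eq_zero fun j hj => h j (Finset.mem_range.1 hj)

/-! ### The antipode as reversal of paths -/

namespace ArrowBimodule

open HopfPath PathCoalgebra

variable {k : Type*} [Field k] {G ι : Type*} [AddCommGroup G] {φ : G → G → G → k} {r : ι → G}
  (D : ArrowBimodule φ r)

theorem arrowCoeff_mulMap (i : ι) (p q : HopfPath G ι) :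
    arrowCoeff k r i (D.mulMap (ofPath k r p ⊗ₜ ofPath k r q)) =
      D.R p.1 i q.1 * (arrowCoeff k r i (ofPath k r p) *
        CoalgebraStruct.counit (R := k) (ofPath k r q)) +
      D.L p.1 q.1 i * (CoalgebraStruct.counit (R := k) (ofPath k r p) *
        arrowCoeff k r i (ofPath k r q)) := by
  classical
  obtain ⟨x, w⟩ := p
  obtain ⟨y, v⟩ := q
  by_cases h : w.length + v.length = 1
  · rw [mulMap_ofPath]
    rcases w with _ | ⟨l, _ | ⟨l', w⟩⟩
    · rcases v with _ | ⟨l, _ | ⟨l', v⟩⟩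
      · simp at h
      · by_cases hl : l = i <;>
          simp [shuffle, arrowCoeff_ofPath, counit_ofPath, HopfPath.length, hl]
      · simp at h
    · rcases v with _ | ⟨l', v⟩
      · by_cases hl : l = i <;>
          simp [shuffle, arrowCoeff_ofPath, counit_ofPath, HopfPath.length, hl]
      · simp at h
    · simp only [List.length_cons] at h
      omega
  · have hm : D.mulMap (ofPath k r (x, w) ⊗ₜ ofPath k r (y, v)) ∈
        homogeneous k r (w.length + v.length) :=
      between_le_homogeneous _ _ _ (D.mulMap_mem_between_ofPath (x, w) (y, v))
    rw [arrowCoeff_eq_zero i h hm]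
    rcases w with _ | ⟨l, w⟩
    · rcases v with _ | ⟨l', _ | ⟨l'', v⟩⟩
      · simp [arrowCoeff_ofPath]
      · simp at h
      · simp [arrowCoeff_ofPath]
    · rcases v with _ | ⟨l', v⟩
      · rcases w with _ | ⟨l', w⟩
        · simp at h
        · simp [arrowCoeff_ofPath, counit_ofPath, HopfPath.length]
      · simp [counit_ofPath, HopfPath.length]

theorem dropFirst_mulMap_ofPath (i : ι) (p q : HopfPath G ι) :
    dropFirst k r i (D.mulMap (ofPath k r p ⊗ₜ ofPath k r q)) =
      D.R p.1 i q.1 • D.mulMap (dropFirst k r i (ofPath k r p) ⊗ₜ ofPath k r q) +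
        D.L p.1 q.1 i • D.mulMap (ofPath k r p ⊗ₜ dropFirst k r i (ofPath k r q)) :=
  dropFirst_mul D.mulHom i p q _ _ fun _ _ => D.arrowCoeff_mulMap i _ _

/-- The coefficient of the antipode on the arrow `x → r i + x`. -/
def arrowAntipode (x : G) (i : ι) : k :=
  -(D.L (-(r i + x)) x i / D.R (-(r i + x)) i x)

theorem arrowAntipode_left (x : G) (i : ι) :
    D.R (-(r i + x)) i x * D.arrowAntipode x i + D.L (-(r i + x)) x i = 0 := by
  rw [arrowAntipode, mul_neg, mul_div_cancel₀ _ (D.R_ne_zero _ _ _), neg_add_cancel]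

/-- The coefficient `arrowAntipode` is chosen to satisfy the left antipode identity on arrows. The
right one, with the weight `φ(x, -x, x)⁻¹` of `β`, then follows from the three bimodule axioms for
the arrow `x → y` and the vertices `y`, `-y`, `-x`, `x`, where `y = r i + x`. -/
theorem arrowAntipode_right (hφ : IsNormalizedCocycle φ) (x : G) (i : ι) :
    (φ x (-x) x)⁻¹ * D.R x i (-x) +
      (φ (r i + x) (-(r i + x)) (r i + x))⁻¹ * D.L (r i + x) (-(r i + x)) i *
        D.arrowAntipode x i = 0 := by
  set y := r i + x with hy
  have e1 := D.left_assoc y (-y) x i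
  have e2 := D.middle_assoc y (-y) i x
  have e3 := D.right_assoc x i (-x) x
  have e0 : r i + -y = -x := by rw [hy]; abel
  rw [← hy, add_neg_cancel, D.L_zero, mul_one] at e1
  rw [e0, add_neg_cancel] at e2
  rw [← hy, neg_add_cancel, D.R_zero, mul_one, add_neg_cancel] at e3
  have h1 := hφ.ne_zero x (-x) x
  have h2 := hφ.ne_zero y (-y) y
  have h3 := D.R_ne_zero (-y) i x
  have h4 := hφ.ne_zero y (-x) x
  have h5 := D.R_ne_zero 0 i x
  have h6 := hφ.ne_zero y (-y) x
  rw [arrowAntipode, ← hy]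
  field_simp
  -- The prefactor is nonzero; it is what remains after eliminating the auxiliary scalars common to
  -- `e1`, `e2` and `e3`.
  have key : φ y (-x) x * D.R 0 i x * (φ y (-y) y * D.R x i (-x) * D.R (-y) i x -
      φ x (-x) x * D.L y (-y) i * D.L (-y) x i) = 0 := by
    linear_combination (-φ y (-y) y * D.R (-y) i x) * e3 - φ x (-x) x * D.R (-y) i x * e1 +
      φ x (-x) x * D.L (-y) x i * e2
  have := (mul_eq_zero.1 key).resolve_left (mul_ne_zero h4 h5)
  linear_combination this

/-- The coefficient of the antipode on the path with source `x` and a given word of labels. -/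
def antipodeCoeff (x : G) : List ι → k
  | [] => 1
  | i :: w => D.arrowAntipode (target r (x, w)) i * antipodeCoeff x w

theorem antipodeCoeff_append (x : G) (w v : List ι) : D.antipodeCoeff x (w ++ v) =
    D.antipodeCoeff (target r (x, v)) w * D.antipodeCoeff x v := by
  induction w with
  | nil => simp [antipodeCoeff]
  | cons i w ih => simp only [List.cons_append, antipodeCoeff, ih, target_append, mul_assoc]

theorem antipodeCoeff_concat (x : G) (w : List ι) (i : ι) : D.antipodeCoeff x (w ++ [i]) =
    D.arrowAntipode x i * D.antipodeCoeff (r i + x) w := by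
  rw [antipodeCoeff_append, target_cons, target_nil, antipodeCoeff, antipodeCoeff, target_nil,
    mul_one, mul_comm]

/-- The antipode: paths are reversed. -/
def antipodeMap : PathCoalgebra k r →ₗ[k] PathCoalgebra k r :=
  lift fun p => D.antipodeCoeff p.1 p.2 • ofPath k r (-target r p, p.2.reverse)

theorem antipodeMap_ofPath (p : HopfPath G ι) : D.antipodeMap (ofPath k r p) =
    D.antipodeCoeff p.1 p.2 • ofPath k r (-target r p, p.2.reverse) :=
  lift_ofPath _ _

theorem antipodeMap_vertex (x : G) :
    D.antipodeMap (ofPath k r (vertex x)) = ofPath k r (vertex (-x)) := by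
  simp [antipodeMap_ofPath, vertex, antipodeCoeff]

theorem target_reverse (x : G) (w : List ι) :
    target r (-target r (x, w), w.reverse) = -x := by
  simp [target, List.map_reverse, List.sum_reverse]

theorem antipodeMap_mem_between (p : HopfPath G ι) :
    D.antipodeMap (ofPath k r p) ∈ between k r (-target r p) (-p.1) p.length := by
  rw [antipodeMap_ofPath]
  refine Submodule.smul_mem _ _ (mem_between_of_eq (ofPath_mem_between r _) rfl ?_ ?_)
  · exact target_reverse p.1 p.2
  · simp [HopfPath.length]

theorem comul_antipodeMap_ofPath (p : HopfPath G ι) :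
    CoalgebraStruct.comul (R := k) (D.antipodeMap (ofPath k r p)) =
      ∑ j ∈ Finset.range (p.length + 1),
        D.antipodeMap (ofPath k r (p.initial j)) ⊗ₜ[k]
          D.antipodeMap (ofPath k r (p.final r j)) := by
  obtain ⟨x, w⟩ := p
  rw [antipodeMap_ofPath, map_smul, comul_ofPath, ← Finset.sum_flip]
  simp only [HopfPath.length, List.length_reverse, Finset.smul_sum]
  refine Finset.sum_congr rfl fun j hj => ?_
  have hj' : j ≤ w.length := by simpa [Nat.lt_succ_iff] using hj
  have h1 : (final r (w.length - j) (-target r (x, w), w.reverse)) =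
      (-target r (initial j (x, w)), (w.drop j).reverse) := by
    refine Prod.ext ?_ ?_
    · change target r (-target r (x, w), w.reverse.drop (w.length - j)) =
        -target r (x, w.drop j)
      conv_lhs => rw [← List.take_append_drop j w, target_append]
      rw [List.take_append_drop, List.drop_reverse, Nat.sub_sub_self hj', target_reverse]
    · change w.reverse.take (w.length - j) = (w.drop j).reverse
      rw [List.take_reverse, Nat.sub_sub_self hj']
  have h2 : (initial (w.length - j) (-target r (x, w), w.reverse)) =
      (-target r (final r j (x, w)), (w.take j).reverse) := by
    refine Prod.ext ?_ ?_
    · rw [target_final]; rfl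
    · change w.reverse.drop (w.length - j) = (w.take j).reverse
      rw [List.drop_reverse, Nat.sub_sub_self hj']
  rw [h1, h2, antipodeMap_ofPath, antipodeMap_ofPath, TensorProduct.smul_tmul_smul]
  congr 1
  conv_lhs => rw [← List.take_append_drop j w]
  rw [antipodeCoeff_append, mul_comm]
  rfl

theorem comul_antipodeMap : CoalgebraStruct.comul ∘ₗ D.antipodeMap =
    (TensorProduct.comm k _ _).toLinearMap ∘ₗ TensorProduct.map D.antipodeMap D.antipodeMap ∘ₗ
      CoalgebraStruct.comul (R := k) := by
  refine hom_ext fun p => ?_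
  rw [LinearMap.comp_apply, comul_antipodeMap_ofPath]
  simp [comul_ofPath]

theorem dropLast_antipodeMap_nil (i : ι) (x : G) :
    dropLast k r i (D.antipodeMap (ofPath k r (x, []))) = 0 := by
  simp [antipodeMap_ofPath]

open scoped Classical in
theorem dropLast_antipodeMap_concat (i j : ι) (x : G) (w : List ι) :
    dropLast k r i (D.antipodeMap (ofPath k r (x, w ++ [j]))) =
      if j = i then D.arrowAntipode x j • D.antipodeMap (ofPath k r (r j + x, w)) else 0 := by
  rw [antipodeMap_ofPath, antipodeMap_ofPath, map_smul, target_concat, List.reverse_concat,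
    dropLast_cons, antipodeCoeff_concat, smul_ite, smul_zero, smul_smul]

theorem dropFirst_antipodeMap_nil (i : ι) (x : G) :
    dropFirst k r i (D.antipodeMap (ofPath k r (x, []))) = 0 := by
  simp [antipodeMap_ofPath]

open scoped Classical in
theorem dropFirst_antipodeMap_cons (i j : ι) (x : G) (w : List ι) :
    dropFirst k r i (D.antipodeMap (ofPath k r (x, j :: w))) =
      if j = i then D.arrowAntipode (target r (x, w)) j • D.antipodeMap (ofPath k r (x, w))
      else 0 := by
  rw [antipodeMap_ofPath, antipodeMap_ofPath, map_smul, target_cons, List.reverse_cons,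
    dropFirst_concat, antipodeCoeff, smul_ite, smul_zero, smul_smul]
  have : r j + -(r j + target r (x, w)) = -target r (x, w) := by abel
  rw [this]

/-- Reversal makes the letter at position `j` the last arrow of both `S(final (j + 1))` and `initial
j`. After deletion of a last arrow, the two neighbouring terms involve the same product and cancel
by `arrowAntipode_left`. -/
theorem sum_antipodeMap_mul (p : HopfPath G ι) (hp : p.length ≠ 0) :
    ∑ j ∈ Finset.range (p.length + 1), D.mulMap (D.antipodeMap (ofPath k r (p.final r j)) ⊗ₜ
      ofPath k r (p.initial j)) = 0 := by
  classical
  refine ext_dropLast ?_ fun i => ?_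
  · rw [map_sum, map_zero]
    refine Finset.sum_eq_zero fun j hj => ?_
    rw [vertexPart_mulMap, antipodeMap_ofPath, map_smul, vertexPart_ofPath, vertexPart_ofPath]
    have hj' : j ≤ p.length := by simpa [Nat.lt_succ_iff] using hj
    by_cases h : j = p.length
    · have h2 : HopfPath.length (-target r (p.final r j), (p.final r j).2.reverse) ≠ 0 := by
        change (p.final r j).2.reverse.length ≠ 0
        rw [List.length_reverse]
        change (p.final r j).length ≠ 0
        rw [length_final r hj']
        omega
      rw [if_neg h2, smul_zero, TensorProduct.zero_tmul, map_zero]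
    · have h2 : (p.initial j).length ≠ 0 := by rw [length_initial]; omega
      rw [if_neg h2, TensorProduct.tmul_zero, map_zero]
  · obtain ⟨x, w⟩ := p
    rw [map_sum, map_zero]
    have e (j) := D.dropLast_mulMap i (D.antipodeMap_mem_between (final r j (x, w)))
      (ofPath_mem_between (k := k) r (initial j (x, w)))
    simp only [e]
    refine sum_range_succ_add_eq_zero ?_ ?_ fun j hj => ?_
    · have : final r 0 (x, w) = (target r (x, w), []) := rfl
      rw [this, dropLast_antipodeMap_nil, TensorProduct.zero_tmul, map_zero, smul_zero]
    · have : initial (HopfPath.length (x, w)) (x, w) = (x, []) := by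
        simp [initial, HopfPath.length]
      rw [this, dropLast_nil, TensorProduct.tmul_zero, map_zero, smul_zero]
    · have hj' : j < w.length := hj
      have h1 : initial j (x, w) = (x, w[j] :: w.drop (j + 1)) := by
        simp [initial]
      have h2 : initial (j + 1) (x, w) = (x, w.drop (j + 1)) := rfl
      have h3 : final r (j + 1) (x, w) = (target r (x, w.drop (j + 1)), w.take j ++ [w[j]]) := by
        simp [final, initial]
      have h4 : final r j (x, w) = (r w[j] + target r (x, w.drop (j + 1)), w.take j) := by
        rw [final, h1, target_cons]
      rw [h1, h2, h3, h4, dropLast_antipodeMap_concat, dropLast_cons]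
      by_cases h : w[j] = i
      · simp only [h, if_true, target_cons]
        rw [← TensorProduct.smul_tmul', map_smul, smul_smul, ← add_smul, add_sub_cancel_left]
        have := D.arrowAntipode_left (target r (x, w.drop (j + 1))) i
        rw [show -target r (x, w.drop (j + 1)) - r i = -(r i + target r (x, w.drop (j + 1))) by
          abel, this, zero_smul]
      · simp [h]

/-- The mirror argument: the letter at position `j` is the first arrow of both `final (j + 1)` and
`S(initial j)`, so first arrows are deleted and `arrowAntipode_right` gives the cancellation. -/
theorem sum_mul_antipodeMap (hφ : IsNormalizedCocycle φ) (p : HopfPath G ι) (hp : p.length ≠ 0) :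
    ∑ j ∈ Finset.range (p.length + 1),
      (φ (target r (p.initial j)) (-target r (p.initial j)) (target r (p.initial j)))⁻¹ •
        D.mulMap (ofPath k r (p.final r j) ⊗ₜ D.antipodeMap (ofPath k r (p.initial j))) = 0 := by
  classical
  refine ext_dropFirst ?_ fun i => ?_
  · rw [map_sum, map_zero]
    refine Finset.sum_eq_zero fun j hj => ?_
    rw [map_smul, vertexPart_mulMap, antipodeMap_ofPath, map_smul, vertexPart_ofPath,
      vertexPart_ofPath]
    have hj' : j ≤ p.length := by simpa [Nat.lt_succ_iff] using hj
    by_cases h : j = p.length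
    · have h2 : (p.final r j).length ≠ 0 := by
        rw [length_final r hj']
        omega
      rw [if_neg h2, TensorProduct.zero_tmul, map_zero, smul_zero]
    · have h2 : HopfPath.length (-target r (p.initial j), (p.initial j).2.reverse) ≠ 0 := by
        change (p.initial j).2.reverse.length ≠ 0
        rw [List.length_reverse]
        change (p.initial j).length ≠ 0
        rw [length_initial]; omega
      rw [if_neg h2, smul_zero, TensorProduct.tmul_zero, map_zero, smul_zero]
  · obtain ⟨x, w⟩ := p
    rw [map_sum, map_zero]
    have e (j) : dropFirst k r i (D.mulMap (ofPath k r (final r j (x, w)) ⊗ₜ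
          D.antipodeMap (ofPath k r (initial j (x, w))))) =
        D.R (target r (initial j (x, w))) i (-target r (initial j (x, w))) •
          D.mulMap (dropFirst k r i (ofPath k r (final r j (x, w))) ⊗ₜ
            D.antipodeMap (ofPath k r (initial j (x, w)))) +
        D.L (target r (initial j (x, w))) (-target r (initial j (x, w))) i •
          D.mulMap (ofPath k r (final r j (x, w)) ⊗ₜ
            dropFirst k r i (D.antipodeMap (ofPath k r (initial j (x, w))))) := by
      simp only [antipodeMap_ofPath, TensorProduct.tmul_smul, map_smul, dropFirst_mulMap_ofPath,
        smul_add, smul_comm (D.antipodeCoeff _ _)]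
      rfl
    simp only [map_smul, e, smul_add]
    refine sum_range_succ_add_eq_zero ?_ ?_ fun j hj => ?_
    · have : final r 0 (x, w) = (target r (x, w), []) := rfl
      rw [this, dropFirst_nil, TensorProduct.zero_tmul, map_zero, smul_zero, smul_zero]
    · have : initial (HopfPath.length (x, w)) (x, w) = (x, []) := by
        simp [initial, HopfPath.length]
      rw [this, dropFirst_antipodeMap_nil, TensorProduct.tmul_zero, map_zero, smul_zero,
        smul_zero]
    · have hj' : j < w.length := hj
      have h1 : initial j (x, w) = (x, w[j] :: w.drop (j + 1)) := by
        simp [initial]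
      have h2 : initial (j + 1) (x, w) = (x, w.drop (j + 1)) := rfl
      have h3 : final r (j + 1) (x, w) = (target r (x, w.drop (j + 1)), w.take j ++ [w[j]]) := by
        simp [final, initial]
      have h4 : final r j (x, w) = (r w[j] + target r (x, w.drop (j + 1)), w.take j) := by
        rw [final, h1, target_cons]
      rw [h1, h2, h3, h4, dropFirst_antipodeMap_cons, dropFirst_concat]
      by_cases h : w[j] = i
      · simp only [h, if_true, target_cons]
        rw [TensorProduct.tmul_smul, map_smul, smul_smul, smul_smul, smul_smul, ← add_smul]
        have := D.arrowAntipode_right hφ (target r (x, w.drop (j + 1))) i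
        rw [this, zero_smul]
      · simp [h]

end ArrowBimodule

/-! ### Degree-zero functionals on paths -/

namespace PathCoalgebra

open HopfPath

variable {k : Type*} [Field k] {G ι : Type*} [AddCommGroup G] {r : ι → G}

theorem length_vertex (x : G) : (vertex x : HopfPath G ι).length = 0 := rfl

theorem target_vertex (x : G) : target r (vertex x : HopfPath G ι) = x := target_nil r x

theorem fst_vertex (x : G) : (vertex x : HopfPath G ι).1 = x := rfl

theorem convAlong_vertex {V : Type*} [AddCommGroup V] [Module k V] (x : G)
    {U W : Type*} [AddCommGroup U] [Module k U] [AddCommGroup W] [Module k W]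
    (B : U ⊗[k] W →ₗ[k] V) (f : PathCoalgebra k r →ₗ[k] U) (g : PathCoalgebra k r →ₗ[k] W) :
    convAlong B f g (ofPath k r (vertex x)) =
      B (f (ofPath k r (vertex x)) ⊗ₜ g (ofPath k r (vertex x))) := by
  simp [convAlong, comul_vertex]

theorem convAlong_ofPath {V : Type*} [AddCommGroup V] [Module k V]
    {U W : Type*} [AddCommGroup U] [Module k U] [AddCommGroup W] [Module k W]
    (B : U ⊗[k] W →ₗ[k] V) (f : PathCoalgebra k r →ₗ[k] U) (g : PathCoalgebra k r →ₗ[k] W)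
    (p : HopfPath G ι) :
    convAlong B f g (ofPath k r p) = ∑ j ∈ Finset.range (p.length + 1),
      B (f (ofPath k r (p.final r j)) ⊗ₜ g (ofPath k r (p.initial j))) := by
  simp [convAlong, comul_ofPath]

/-- The functional given by `b` on vertices and vanishing on paths of positive length. -/
def vertexWeight (r : ι → G) (b : G → k) : PathCoalgebra k r →ₗ[k] k :=
  lift fun p => if p.length = 0 then b p.1 else 0

theorem vertexWeight_ofPath (b : G → k) (p : HopfPath G ι) :
    vertexWeight r b (ofPath k r p) = if p.length = 0 then b p.1 else 0 :=
  lift_ofPath _ _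

theorem convRight_vertexWeight {V : Type*} [AddCommGroup V] [Module k V] (b : G → k)
    (F : PathCoalgebra k r →ₗ[k] V) (p : HopfPath G ι) :
    convRight F (vertexWeight r b) (ofPath k r p) = b p.1 • F (ofPath k r p) := by
  have : vertexWeight r b ∘ₗ vertexPart k r = vertexWeight r b := by
    refine hom_ext fun q => ?_
    by_cases h : q.length = 0 <;> simp [vertexPart_ofPath, vertexWeight_ofPath, h]
  rw [convRight_apply_of_lTensor this F (lTensor_vertexPart_comul p), vertexWeight_ofPath,
    if_pos (length_vertex _)]
  rfl

theorem vertexFunctional_eq_zero_of_mem (φ : G → G → G → k) {s t s' t' s'' t'' : G}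
    {n n' n'' : ℕ} (hn : n + n' + n'' ≠ 0) {u v w : PathCoalgebra k r}
    (hu : u ∈ between k r s t n) (hv : v ∈ between k r s' t' n')
    (hw : w ∈ between k r s'' t'' n'') :
    vertexFunctional r φ (u ⊗ₜ (v ⊗ₜ w)) = 0 := by
  refine eqOn_between (f := vertexFunctional r φ ∘ₗ
    (TensorProduct.mk k _ _).flip (v ⊗ₜ w)) (g := 0) (fun p _ _ hp => ?_) hu
  refine eqOn_between (f := vertexFunctional r φ ∘ₗ TensorProduct.mk k _ _ (ofPath k r p) ∘ₗ
    (TensorProduct.mk k _ _).flip w) (g := 0) (fun q _ _ hq => ?_) hv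
  refine eqOn_between (f := vertexFunctional r φ ∘ₗ TensorProduct.mk k _ _ (ofPath k r p) ∘ₗ
    TensorProduct.mk k _ _ (ofPath k r q)) (g := 0) (fun s _ _ hs => ?_) hw
  subst hp hq hs
  exact (vertexFunctional_ofPath φ p q s).trans (if_neg hn)

theorem vertexFunctional_conv_inv (φ ψ : G → G → G → k) (h : ∀ x y z, φ x y z * ψ x y z = 1) :
    convLeft (vertexFunctional r φ) (vertexFunctional r ψ) = CoalgebraStruct.counit := by
  refine TensorProduct.ext (hom_ext fun p => TensorProduct.ext (hom_ext fun q =>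
    hom_ext fun s => ?_))
  change convLeft (vertexFunctional r φ) (vertexFunctional r ψ)
    (ofPath k r p ⊗ₜ (ofPath k r q ⊗ₜ ofPath k r s)) =
      CoalgebraStruct.counit (R := k) (ofPath k r p ⊗ₜ[k] (ofPath k r q ⊗ₜ[k] ofPath k r s))
  rw [convLeft_vertexFunctional, vertexFunctional_ofPath, TensorProduct.counit_tmul,
    TensorProduct.counit_tmul, counit_ofPath, counit_ofPath, counit_ofPath]
  by_cases hp : p.length = 0
  · by_cases hq : q.length = 0
    · by_cases hs : s.length = 0
      · rw [HopfPath.length_eq_zero hp, HopfPath.length_eq_zero hq, HopfPath.length_eq_zero hs]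
        simp [length_vertex, target_vertex, fst_vertex, h]
      · simp [hs]
    · simp [hq]
  · simp [hp]

end PathCoalgebra

/-! ### The Majid algebra of a quasi-bimodule -/

namespace ArrowBimodule

open HopfPath PathCoalgebra

variable {k : Type*} [Field k] {G ι : Type*} [AddCommGroup G] {φ : G → G → G → k} {r : ι → G}
  (D : ArrowBimodule φ r)

theorem quasi_assoc :
    convRight (D.mulMap ∘ₗ D.mulMap.lTensor _) (vertexFunctional r φ) =
      convLeft (vertexFunctional r φ) (D.mulMap ∘ₗ D.mulMap.rTensor _ ∘ₗ
        (TensorProduct.assoc k _ _ _).symm.toLinearMap) := by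
  refine TensorProduct.ext (hom_ext fun p => TensorProduct.ext (hom_ext fun q =>
    hom_ext fun s => ?_))
  change convRight _ _ (ofPath k r p ⊗ₜ (ofPath k r q ⊗ₜ ofPath k r s)) =
    convLeft _ _ (ofPath k r p ⊗ₜ (ofPath k r q ⊗ₜ ofPath k r s))
  rw [convLeft_vertexFunctional, convRight_vertexFunctional]
  exact D.mulMap_assoc_ofPath p q s

/-- Taking vertex parts is multiplicative, so this functional on four factors is still concentrated
in degree zero. The next two lemmas say the same of the other functionals by which the pentagon
convolves. -/
theorem vertexFunctional_comp_mul_right :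
    (vertexFunctional r φ ∘ₗ (D.mulMap.lTensor (PathCoalgebra k r)).lTensor (PathCoalgebra k r)) ∘ₗ
      TensorProduct.map (vertexPart k r) (TensorProduct.map (vertexPart k r)
        (TensorProduct.map (vertexPart k r) (vertexPart k r))) =
      vertexFunctional r φ ∘ₗ (D.mulMap.lTensor (PathCoalgebra k r)).lTensor (PathCoalgebra k r) := by
  refine TensorProduct.ext (LinearMap.ext fun u => TensorProduct.ext (LinearMap.ext fun v =>
    TensorProduct.ext (LinearMap.ext fun w => LinearMap.ext fun z => ?_)))
  change vertexFunctional r φ (vertexPart k r u ⊗ₜ (vertexPart k r v ⊗ₜ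
    D.mulMap (vertexPart k r w ⊗ₜ vertexPart k r z))) =
      vertexFunctional r φ (u ⊗ₜ (v ⊗ₜ D.mulMap (w ⊗ₜ z)))
  rw [← vertexPart_mulMap, vertexFunctional_vertexPart]

theorem vertexFunctional_comp_mul_middle :
    (vertexFunctional r φ ∘ₗ (D.mulMap.rTensor (PathCoalgebra k r) ∘ₗ
      (TensorProduct.assoc k (PathCoalgebra k r) (PathCoalgebra k r)
        (PathCoalgebra k r)).symm.toLinearMap).lTensor (PathCoalgebra k r)) ∘ₗ
      TensorProduct.map (vertexPart k r) (TensorProduct.map (vertexPart k r)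
        (TensorProduct.map (vertexPart k r) (vertexPart k r))) =
      vertexFunctional r φ ∘ₗ (D.mulMap.rTensor (PathCoalgebra k r) ∘ₗ
        (TensorProduct.assoc k (PathCoalgebra k r) (PathCoalgebra k r)
          (PathCoalgebra k r)).symm.toLinearMap).lTensor (PathCoalgebra k r) := by
  refine TensorProduct.ext (LinearMap.ext fun u => TensorProduct.ext (LinearMap.ext fun v =>
    TensorProduct.ext (LinearMap.ext fun w => LinearMap.ext fun z => ?_)))
  change vertexFunctional r φ (vertexPart k r u ⊗ₜ (
    D.mulMap (vertexPart k r v ⊗ₜ vertexPart k r w) ⊗ₜ vertexPart k r z)) =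
      vertexFunctional r φ (u ⊗ₜ (D.mulMap (v ⊗ₜ w) ⊗ₜ z))
  rw [← vertexPart_mulMap, vertexFunctional_vertexPart]

theorem counit_vertexFunctional_comp_map :
    ((TensorProduct.lid k k).toLinearMap ∘ₗ
      TensorProduct.map (CoalgebraStruct.counit (R := k) (A := PathCoalgebra k r))
        (vertexFunctional r φ)) ∘ₗ
      TensorProduct.map (vertexPart k r) (TensorProduct.map (vertexPart k r)
        (TensorProduct.map (vertexPart k r) (vertexPart k r))) =
      (TensorProduct.lid k k).toLinearMap ∘ₗ
        TensorProduct.map (CoalgebraStruct.counit (R := k) (A := PathCoalgebra k r))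
          (vertexFunctional r φ) := by
  refine TensorProduct.ext (LinearMap.ext fun u => TensorProduct.ext (LinearMap.ext fun v =>
    TensorProduct.ext (LinearMap.ext fun w => LinearMap.ext fun z => ?_)))
  change CoalgebraStruct.counit (R := k) (vertexPart k r u) •
    vertexFunctional r φ (vertexPart k r v ⊗ₜ (vertexPart k r w ⊗ₜ vertexPart k r z)) =
      CoalgebraStruct.counit (R := k) u • vertexFunctional r φ (v ⊗ₜ (w ⊗ₜ z))
  rw [vertexFunctional_vertexPart, counit_vertexPart]

/-- On vertices this is the cocycle identity; as soon as one path has positive length, both sides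
vanish. -/
theorem pentagon_ofPath (hφ : IsNormalizedCocycle φ) (p q s t : HopfPath G ι) :
    φ (target r p) (target r q) (target r s + target r t) *
      vertexFunctional r φ (D.mulMap (ofPath k r p ⊗ₜ ofPath k r q) ⊗ₜ
        (ofPath k r s ⊗ₜ ofPath k r t)) =
    φ (target r q) (target r s) (target r t) *
      (φ (target r p) (target r q + target r s) (target r t) *
        (CoalgebraStruct.counit (R := k) (ofPath k r t) *
          vertexFunctional r φ (ofPath k r p ⊗ₜ (ofPath k r q ⊗ₜ ofPath k r s)))) := by
  by_cases hl : p.length + q.length + (s.length + t.length) = 0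
  · rw [HopfPath.length_eq_zero (p := p) (by omega), HopfPath.length_eq_zero (p := q) (by omega),
      HopfPath.length_eq_zero (p := s) (by omega), HopfPath.length_eq_zero (p := t) (by omega)]
    simp only [mulMap_vertex, target_vertex, vertexFunctional_vertex, counit_ofPath,
      length_vertex, if_true, one_mul]
    exact hφ.cocycle _ _ _ _
  · have z1 : vertexFunctional r φ (D.mulMap (ofPath k r p ⊗ₜ ofPath k r q) ⊗ₜ
        (ofPath k r s ⊗ₜ ofPath k r t)) = 0 :=
      vertexFunctional_eq_zero_of_mem φ (by omega) (D.mulMap_mem_between_ofPath p q)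
        (ofPath_mem_between r s) (ofPath_mem_between r t)
    rw [z1, vertexFunctional_ofPath φ p q s, counit_ofPath (k := k) r t]
    by_cases ht : t.length = 0
    · have : ¬ p.length + q.length + s.length = 0 := by omega
      rw [if_neg this]
      simp
    · simp [ht]

set_option maxHeartbeats 4000000 in
theorem pentagon (hφ : IsNormalizedCocycle φ) :
    convLeft
      (vertexFunctional r φ ∘ₗ
        (D.mulMap.lTensor (PathCoalgebra k r)).lTensor (PathCoalgebra k r))
      (vertexFunctional r φ ∘ₗ D.mulMap.rTensor (PathCoalgebra k r ⊗[k] PathCoalgebra k r) ∘ₗ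
        (TensorProduct.assoc k (PathCoalgebra k r) (PathCoalgebra k r)
          (PathCoalgebra k r ⊗[k] PathCoalgebra k r)).symm.toLinearMap) =
    convLeft
      ((TensorProduct.lid k k).toLinearMap ∘ₗ
        TensorProduct.map (CoalgebraStruct.counit (R := k) (A := PathCoalgebra k r))
          (vertexFunctional r φ))
      (convLeft
        (vertexFunctional r φ ∘ₗ (D.mulMap.rTensor (PathCoalgebra k r) ∘ₗ
          (TensorProduct.assoc k (PathCoalgebra k r) (PathCoalgebra k r)
            (PathCoalgebra k r)).symm.toLinearMap).lTensor (PathCoalgebra k r))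
        ((TensorProduct.rid k k).toLinearMap ∘ₗ
          TensorProduct.map (vertexFunctional r φ)
            (CoalgebraStruct.counit (R := k) (A := PathCoalgebra k r)) ∘ₗ
          (TensorProduct.assoc k (PathCoalgebra k r) (PathCoalgebra k r ⊗[k] PathCoalgebra k r)
            (PathCoalgebra k r)).symm.toLinearMap ∘ₗ
          (TensorProduct.assoc k (PathCoalgebra k r) (PathCoalgebra k r)
            (PathCoalgebra k r)).symm.toLinearMap.lTensor (PathCoalgebra k r))) := by
  refine TensorProduct.ext (hom_ext fun p => TensorProduct.ext (hom_ext fun q =>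
    TensorProduct.ext (hom_ext fun s => hom_ext fun t => ?_)))
  have hc := rTensor_map_comul_tmul (rTensor_vertexPart_comul (k := k) (r := r) p)
    (rTensor_map_comul_tmul (rTensor_vertexPart_comul (k := k) (r := r) q)
      (rTensor_map_comul_tmul (rTensor_vertexPart_comul (k := k) (r := r) s)
        (rTensor_vertexPart_comul (k := k) (r := r) t)))
  have e := D.pentagon_ofPath hφ p q s t
  change convLeft _ _ (ofPath k r p ⊗ₜ (ofPath k r q ⊗ₜ (ofPath k r s ⊗ₜ ofPath k r t))) =
    convLeft _ _ (ofPath k r p ⊗ₜ (ofPath k r q ⊗ₜ (ofPath k r s ⊗ₜ ofPath k r t)))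
  rw [convLeft_apply_of_rTensor D.vertexFunctional_comp_mul_right _ hc]
  rw [convLeft_apply_of_rTensor counit_vertexFunctional_comp_map _ hc]
  rw [convLeft_apply_of_rTensor D.vertexFunctional_comp_mul_middle _ hc]
  have f1 : (vertexFunctional r φ ∘ₗ
        (D.mulMap.lTensor (PathCoalgebra k r)).lTensor (PathCoalgebra k r))
      (ofPath k r (vertex (target r p)) ⊗ₜ (ofPath k r (vertex (target r q)) ⊗ₜ
        (ofPath k r (vertex (target r s)) ⊗ₜ ofPath k r (vertex (target r t))))) =
      φ (target r p) (target r q) (target r s + target r t) := by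
    simp only [LinearMap.comp_apply, LinearMap.lTensor_tmul, mulMap_vertex,
      vertexFunctional_vertex]
  have f2 : ((TensorProduct.lid k k).toLinearMap ∘ₗ
        TensorProduct.map (CoalgebraStruct.counit (R := k) (A := PathCoalgebra k r))
          (vertexFunctional r φ))
      (ofPath k r (vertex (target r p)) ⊗ₜ (ofPath k r (vertex (target r q)) ⊗ₜ
        (ofPath k r (vertex (target r s)) ⊗ₜ ofPath k r (vertex (target r t))))) =
      φ (target r q) (target r s) (target r t) := by
    simp [vertexFunctional_vertex, counit_ofPath, length_vertex]
  have f3 : (vertexFunctional r φ ∘ₗ (D.mulMap.rTensor (PathCoalgebra k r) ∘ₗ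
          (TensorProduct.assoc k (PathCoalgebra k r) (PathCoalgebra k r)
            (PathCoalgebra k r)).symm.toLinearMap).lTensor (PathCoalgebra k r))
      (ofPath k r (vertex (target r p)) ⊗ₜ (ofPath k r (vertex (target r q)) ⊗ₜ
        (ofPath k r (vertex (target r s)) ⊗ₜ ofPath k r (vertex (target r t))))) =
      φ (target r p) (target r q + target r s) (target r t) := by
    simp [vertexFunctional_vertex, mulMap_vertex]
  rw [f1, f2, f3]
  exact e

/-- The graded Majid algebra structure on the path coalgebra determined by a quasi-bimodule
structure on the arrows. -/
def majidAlgebra (hφ : IsNormalizedCocycle φ) : MajidAlgebra k (PathCoalgebra k r) where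
  mul := D.mulHom
  one := ofPath k r (vertex 0)
  assoc := vertexFunctional r φ
  assocInv := vertexFunctional r fun x y z => (φ x y z)⁻¹
  antipode := D.antipodeMap
  α := CoalgebraStruct.counit
  -- With `α = ε`, the axiom `assoc_antipode` on vertices forces this weight.
  β := vertexWeight r fun x => (φ x (-x) x)⁻¹
  one_isGroupLike := isGroupLikeElem_vertex 0
  one_mul := D.mulMap_vertex_zero_left
  mul_one := D.mulMap_vertex_zero_right
  assoc_conv_assocInv :=
    vertexFunctional_conv_inv _ _ fun x y z => mul_inv_cancel₀ (hφ.ne_zero x y z)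
  assocInv_conv_assoc :=
    vertexFunctional_conv_inv _ _ fun x y z => inv_mul_cancel₀ (hφ.ne_zero x y z)
  quasi_assoc := D.quasi_assoc
  pentagon := D.pentagon hφ
  assoc_one := fun a b => by
    have : vertexFunctional r φ ∘ₗ (TensorProduct.mk k _ _ (ofPath k r (vertex 0))).lTensor _ =
        (TensorProduct.lid k k).toLinearMap ∘ₗ
          TensorProduct.map CoalgebraStruct.counit CoalgebraStruct.counit := by
      refine TensorProduct.ext (hom_ext fun p => hom_ext fun q => ?_)
      change vertexFunctional r φ (ofPath k r p ⊗ₜ (ofPath k r (vertex 0) ⊗ₜ ofPath k r q)) =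
        CoalgebraStruct.counit (R := k) (ofPath k r p) •
          CoalgebraStruct.counit (R := k) (ofPath k r q)
      rw [vertexFunctional_ofPath, counit_ofPath, counit_ofPath, fst_vertex, hφ.apply_zero]
      by_cases hp : p.length = 0 <;> by_cases hq : q.length = 0 <;>
        simp [hp, hq, length_vertex]
    exact LinearMap.congr_fun this (a ⊗ₜ b)
  comul_antipode := D.comul_antipodeMap
  counit_antipode := hom_ext fun p => by
    simp only [LinearMap.comp_apply, counit_ofPath]
    split_ifs with h
    · rw [HopfPath.length_eq_zero h, antipodeMap_vertex, counit_ofPath, if_pos (length_vertex _)]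
    · exact counit_eq_zero_of_mem h (D.antipodeMap_mem_between p)
  antipode_left := hom_ext fun p => by
    rw [convRight_counit, LinearMap.smulRight_apply, counit_ofPath]
    split_ifs with h
    · rw [HopfPath.length_eq_zero h, convAlong_vertex, antipodeMap_vertex, one_smul]
      exact (D.mulMap_vertex _ _).trans (by rw [neg_add_cancel])
    · rw [zero_smul, convAlong_ofPath]
      exact D.sum_antipodeMap_mul p h
  antipode_right := hom_ext fun p => by
    rw [LinearMap.smulRight_apply, vertexWeight_ofPath]
    split_ifs with h
    · rw [HopfPath.length_eq_zero h, convAlong_vertex, convRight_vertexWeight, antipodeMap_vertex,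
        ← TensorProduct.smul_tmul', map_smul]
      exact congrArg _ ((D.mulMap_vertex _ _).trans (by rw [add_neg_cancel]))
    · rw [zero_smul, convAlong_ofPath]
      simp only [convRight_vertexWeight, ← TensorProduct.smul_tmul', map_smul]
      exact D.sum_mul_antipodeMap hφ p h
  assoc_antipode := hom_ext fun p => by
    rw [convRight_counit, counit_ofPath]
    split_ifs with h
    · rw [HopfPath.length_eq_zero h, convAlong_vertex, convAlong_vertex, convRight_vertexWeight,
        antipodeMap_vertex, ← TensorProduct.smul_tmul', map_smul]
      change _ • vertexFunctional r φ (_ ⊗ₜ (_ ⊗ₜ _)) = _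
      rw [LinearMap.id_apply, vertexFunctional_vertex]
      exact inv_mul_cancel₀ (hφ.ne_zero _ _ _)
    · rw [convAlong_ofPath]
      refine Finset.sum_eq_zero fun j hj => ?_
      rw [convAlong_ofPath, TensorProduct.tmul_sum, map_sum]
      refine Finset.sum_eq_zero fun l hl => ?_
      rw [convRight_vertexWeight, ← TensorProduct.smul_tmul', map_smul]
      change _ • vertexFunctional r φ (ofPath k r _ ⊗ₜ (D.antipodeMap _ ⊗ₜ ofPath k r _)) = 0
      rw [vertexFunctional_eq_zero_of_mem φ ?_ (ofPath_mem_between r _)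
        (D.antipodeMap_mem_between _) (ofPath_mem_between r _), smul_zero]
      rw [Finset.mem_range] at hj hl
      rw [length_final r (by omega), length_final r (by omega), length_initial, length_initial]
      rw [length_initial] at hl
      omega
  assocInv_antipode := hom_ext fun p => by
    rw [convRight_counit, counit_ofPath]
    split_ifs with h
    · rw [HopfPath.length_eq_zero h, convAlong_vertex, convAlong_vertex, convRight_vertexWeight,
        antipodeMap_vertex]
      change vertexFunctional r _ (_ ⊗ₜ ((_ • LinearMap.id (ofPath k r _)) ⊗ₜ _)) = _
      rw [← TensorProduct.smul_tmul', TensorProduct.tmul_smul, map_smul, LinearMap.id_apply,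
        vertexFunctional_vertex, smul_eq_mul, ← mul_inv, fst_vertex, hφ.neg_mul_neg, inv_one]
    · rw [convAlong_ofPath]
      refine Finset.sum_eq_zero fun j hj => ?_
      rw [convAlong_ofPath, TensorProduct.tmul_sum, map_sum]
      refine Finset.sum_eq_zero fun l hl => ?_
      rw [convRight_vertexWeight]
      change vertexFunctional r _ (D.antipodeMap _ ⊗ₜ
        ((_ • LinearMap.id (ofPath k r _)) ⊗ₜ D.antipodeMap _)) = 0
      rw [← TensorProduct.smul_tmul', TensorProduct.tmul_smul, map_smul, LinearMap.id_apply,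
        vertexFunctional_eq_zero_of_mem _ ?_ (D.antipodeMap_mem_between _)
        (ofPath_mem_between r _) (D.antipodeMap_mem_between _), smul_zero]
      rw [Finset.mem_range] at hj hl
      rw [length_final r (by omega), length_final r (by omega), length_initial, length_initial]
      rw [length_initial] at hl
      omega

theorem majidAlgebra_prod (hφ : IsNormalizedCocycle φ) (u v : PathCoalgebra k r) :
    (D.majidAlgebra hφ).prod u v = D.mulMap (u ⊗ₜ v) := rfl

theorem majidAlgebra_antipode (hφ : IsNormalizedCocycle φ) :
    (D.majidAlgebra hφ).antipode = D.antipodeMap := rfl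

theorem majidAlgebra_one (hφ : IsNormalizedCocycle φ) :
    (D.majidAlgebra hφ).one = ofPath k r (vertex 0) := rfl

theorem majidAlgebra_assoc (hφ : IsNormalizedCocycle φ) :
    (D.majidAlgebra hφ).assoc = vertexFunctional r φ := rfl

theorem majidAlgebra_α (hφ : IsNormalizedCocycle φ) :
    (D.majidAlgebra hφ).α = CoalgebraStruct.counit := rfl

theorem majidAlgebra_β (hφ : IsNormalizedCocycle φ) :
    (D.majidAlgebra hφ).β = vertexWeight r fun x => (φ x (-x) x)⁻¹ := rfl

theorem isGraded_majidAlgebra (hφ : IsNormalizedCocycle φ) : (D.majidAlgebra hφ).IsGraded φ where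
  one_eq := D.majidAlgebra_one hφ
  vertex_mul x y := by rw [majidAlgebra_prod, mulMap_vertex]
  assoc_vertex x y z := by rw [majidAlgebra_assoc, vertexFunctional_vertex]
  assoc_eq_zero p q s h := by rw [majidAlgebra_assoc, vertexFunctional_ofPath, if_neg h.ne']
  prod_mem p q := by
    rw [majidAlgebra_prod]
    exact between_le_homogeneous _ _ _ (D.mulMap_mem_between_ofPath p q)
  antipode_mem p := by
    rw [majidAlgebra_antipode]
    exact between_le_homogeneous _ _ _ (D.antipodeMap_mem_between p)
  α_eq_zero p h := by rw [majidAlgebra_α, counit_ofPath, if_neg h.ne']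
  β_eq_zero p h := by rw [majidAlgebra_β, vertexWeight_ofPath, if_neg h.ne']

end ArrowBimodule

/-! ### Arbitrary graded structures: sources, targets and quasi-associativity -/

namespace MajidAlgebra

section Linear

variable {k H : Type*} [Field k] [AddCommGroup H] [Module k H] [Coalgebra k H]
  (M : MajidAlgebra k H)

theorem add_prod (u v w : H) : M.prod (u + v) w = M.prod u w + M.prod v w := by
  simp [prod, TensorProduct.add_tmul]

theorem prod_add (u v w : H) : M.prod u (v + w) = M.prod u v + M.prod u w := by
  simp [prod, TensorProduct.tmul_add]

theorem smul_prod (c : k) (u v : H) : M.prod (c • u) v = c • M.prod u v := by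
  simp [prod, ← TensorProduct.smul_tmul']

theorem prod_smul (c : k) (u v : H) : M.prod u (c • v) = c • M.prod u v := by
  simp [prod]

theorem zero_prod (u : H) : M.prod 0 u = 0 := by simp [prod]

theorem prod_zero (u : H) : M.prod u 0 = 0 := by simp [prod]

end Linear

end MajidAlgebra

namespace PathCoalgebra

open HopfPath

variable {k : Type*} [Field k] {G ι : Type*} [AddCommGroup G] {r : ι → G}

open scoped Classical in
/-- The functional that is `1` on the vertex `x` and `0` on all other paths. -/
def vertexCoeff (k : Type*) [Field k] (r : ι → G) (x : G) : PathCoalgebra k r →ₗ[k] k :=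
  vertexWeight r fun y => if y = x then 1 else 0

theorem vertexCoeff_vertex (x : G) : vertexCoeff k r x (ofPath k r (vertex x)) = 1 := by
  simp [vertexCoeff, vertexWeight_ofPath, length_vertex, fst_vertex]

theorem vertexCoeff_eq_zero (x : G) {n : ℕ} (hn : n ≠ 0) {u : PathCoalgebra k r}
    (hu : u ∈ homogeneous k r n) : vertexCoeff k r x u = 0 := by
  induction hu using Submodule.span_induction with
  | mem x hx =>
    obtain ⟨p, hp, rfl⟩ := hx
    rw [vertexCoeff, vertexWeight_ofPath, if_neg]
    exact fun h => hn (hp.symm.trans h)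
  | zero => simp
  | add x y _ _ hx hy => simp [hx, hy]
  | smul c x _ hx => simp [hx]

theorem vertexCoeff_comp_vertexPart (x : G) :
    vertexCoeff k r x ∘ₗ vertexPart k r = vertexCoeff k r x := by
  refine hom_ext fun p => ?_
  by_cases h : p.length = 0 <;>
    simp [vertexPart_ofPath, vertexCoeff, vertexWeight_ofPath, h]

open scoped Classical in
theorem convLeft_vertexCoeff (x : G) (p : HopfPath G ι) :
    convLeft (vertexCoeff k r x) LinearMap.id (ofPath k r p) =
      if target r p = x then ofPath k r p else 0 := by
  rw [convLeft_apply_of_rTensor (vertexCoeff_comp_vertexPart x) _ (rTensor_vertexPart_comul p)]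
  by_cases h : target r p = x <;>
    simp [vertexCoeff, vertexWeight_ofPath, length_vertex, fst_vertex, h]

open scoped Classical in
theorem convRight_vertexCoeff (x : G) (p : HopfPath G ι) :
    convRight LinearMap.id (vertexCoeff k r x) (ofPath k r p) =
      if p.1 = x then ofPath k r p else 0 := by
  rw [convRight_apply_of_lTensor (vertexCoeff_comp_vertexPart x) _ (lTensor_vertexPart_comul p)]
  by_cases h : p.1 = x <;>
    simp [vertexCoeff, vertexWeight_ofPath, length_vertex, fst_vertex, h]

/-- Convolution with the indicator of a vertex projects onto the paths with that source or target,
so both ends of an element are visible to the coalgebra structure. -/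
theorem mem_between_of_conv {s t : G} {n : ℕ} {u : PathCoalgebra k r}
    (hu : u ∈ homogeneous k r n)
    (hs : convRight LinearMap.id (vertexCoeff k r s) u = u)
    (ht : convLeft (vertexCoeff k r t) LinearMap.id u = u) : u ∈ between k r s t n := by
  classical
  rw [← ht, ← hs]
  clear hs ht
  induction hu using Submodule.span_induction with
  | mem x hx =>
    obtain ⟨p, hp, rfl⟩ := hx
    rw [convRight_vertexCoeff]
    split_ifs with h1
    · rw [convLeft_vertexCoeff]
      split_ifs with h2
      · exact mem_between_of_eq (ofPath_mem_between r p) h1 h2 hp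
      · exact zero_mem _
    · rw [map_zero]
      exact zero_mem _
  | zero => simp
  | add x y _ _ hx hy => rw [map_add, map_add]; exact add_mem hx hy
  | smul c x _ hx => rw [map_smul, map_smul]; exact Submodule.smul_mem _ _ hx

theorem vertex_mem_between (x : G) : ofPath k r (vertex x) ∈ between k r x x 0 :=
  mem_between_of_eq (ofPath_mem_between r _) rfl (target_vertex x) rfl

theorem arrow_mem_between (i : ι) : ofPath k r (arrow 0 i) ∈ between k r 0 (r i) 1 :=
  mem_between_of_eq (ofPath_mem_between r _) rfl (by simp [arrow]) rfl

end PathCoalgebra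

namespace MajidAlgebra

open HopfPath PathCoalgebra

variable {k : Type*} [Field k] {G ι : Type*} [AddCommGroup G] {φ : G → G → G → k} {r : ι → G}

namespace IsGraded

variable {M : MajidAlgebra k (PathCoalgebra k r)} (hM : M.IsGraded φ)
include hM

theorem assoc_eq : M.assoc = vertexFunctional r φ :=
  eq_vertexFunctional hM.assoc_vertex hM.assoc_eq_zero

theorem vertexCoeff_prod (x : G) :
    (vertexCoeff k r x ∘ₗ M.mul.toLinearMap) ∘ₗ
      TensorProduct.map (vertexPart k r) (vertexPart k r) =
      vertexCoeff k r x ∘ₗ M.mul.toLinearMap := by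
  refine TensorProduct.ext (hom_ext fun p => hom_ext fun q => ?_)
  change vertexCoeff k r x (M.prod (vertexPart k r (ofPath k r p)) (vertexPart k r (ofPath k r q))) =
    vertexCoeff k r x (M.prod (ofPath k r p) (ofPath k r q))
  rw [vertexPart_ofPath, vertexPart_ofPath]
  by_cases h : p.length + q.length = 0
  · rw [if_pos (by omega), if_pos (by omega)]
  · rw [vertexCoeff_eq_zero x h (hM.prod_mem p q)]
    by_cases hp : p.length = 0
    · rw [if_neg (show ¬ q.length = 0 by omega), prod_zero, map_zero]
    · rw [if_neg hp, zero_prod, map_zero]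

/-- The multiplication is a coalgebra map and vertices multiply as in `G`, so the projections onto
given ends are compatible with products. -/
theorem prod_mem_between_ofPath (p q : HopfPath G ι) :
    M.prod (ofPath k r p) (ofPath k r q) ∈
      between k r (p.1 + q.1) (target r p + target r q) (p.length + q.length) := by
  refine mem_between_of_conv (hM.prod_mem p q) ?_ ?_
  · rw [prod, convRight_comp_coalgHom,
      convRight_apply_of_lTensor (hM.vertexCoeff_prod _) _
        (lTensor_map_comul_tmul (lTensor_vertexPart_comul p) (lTensor_vertexPart_comul q))]
    change vertexCoeff k r _ (M.prod _ _) • M.prod _ _ = M.prod _ _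
    rw [hM.vertex_mul, vertexCoeff_vertex, one_smul]
  · rw [prod, convLeft_comp_coalgHom,
      convLeft_apply_of_rTensor (hM.vertexCoeff_prod _) _
        (rTensor_map_comul_tmul (rTensor_vertexPart_comul p) (rTensor_vertexPart_comul q))]
    change vertexCoeff k r _ (M.prod _ _) • M.prod _ _ = M.prod _ _
    rw [hM.vertex_mul, vertexCoeff_vertex, one_smul]

theorem prod_mem_between {s t s' t' : G} {n n' : ℕ} {u v : PathCoalgebra k r}
    (hu : u ∈ between k r s t n) (hv : v ∈ between k r s' t' n') :
    M.prod u v ∈ between k r (s + s') (t + t') (n + n') := by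
  refine between_induction (P := fun u => M.prod u v ∈ between k r (s + s') (t + t') (n + n'))
    (by simp [zero_prod]) (fun a b ha hb => by rw [add_prod]; exact add_mem ha hb)
    (fun c a ha => by rw [smul_prod]; exact Submodule.smul_mem _ _ ha) (fun p h1 h2 h3 => ?_) hu
  refine between_induction (P := fun v => M.prod (ofPath k r p) v ∈
      between k r (s + s') (t + t') (n + n'))
    (by simp [prod_zero]) (fun a b ha hb => by rw [prod_add]; exact add_mem ha hb)
    (fun c a ha => by rw [prod_smul]; exact Submodule.smul_mem _ _ ha) (fun q h4 h5 h6 => ?_) hv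
  subst h1 h2 h3 h4 h5 h6
  exact hM.prod_mem_between_ofPath p q

theorem prod_assoc_ofPath (p q s : HopfPath G ι) :
    φ p.1 q.1 s.1 • M.prod (ofPath k r p) (M.prod (ofPath k r q) (ofPath k r s)) =
      φ (target r p) (target r q) (target r s) •
        M.prod (M.prod (ofPath k r p) (ofPath k r q)) (ofPath k r s) := by
  have := LinearMap.congr_fun M.quasi_assoc
    (ofPath k r p ⊗ₜ (ofPath k r q ⊗ₜ ofPath k r s))
  rw [hM.assoc_eq, convLeft_vertexFunctional, convRight_vertexFunctional] at this
  exact this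

theorem prod_assoc {s t s' t' s'' t'' : G} {n n' n'' : ℕ} {u v w : PathCoalgebra k r}
    (hu : u ∈ between k r s t n) (hv : v ∈ between k r s' t' n') (hw : w ∈ between k r s'' t'' n'') :
    φ s s' s'' • M.prod u (M.prod v w) = φ t t' t'' • M.prod (M.prod u v) w := by
  refine between_induction (P := fun u => φ s s' s'' • M.prod u (M.prod v w) =
      φ t t' t'' • M.prod (M.prod u v) w) (by simp [zero_prod])
    (fun a b ha hb => by simp only [add_prod, smul_add, ha, hb])
    (fun c a ha => by simp only [smul_prod, smul_comm _ c, ha]) (fun p h1 h2 h3 => ?_) hu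
  refine between_induction (P := fun v => φ s s' s'' • M.prod (ofPath k r p) (M.prod v w) =
      φ t t' t'' • M.prod (M.prod (ofPath k r p) v) w) (by simp [zero_prod, prod_zero])
    (fun a b ha hb => by simp only [add_prod, prod_add, smul_add, ha, hb])
    (fun c a ha => by simp only [smul_prod, prod_smul, smul_comm _ c, ha])
    (fun q h4 h5 h6 => ?_) hv
  refine between_induction (P := fun w => φ s s' s'' • M.prod (ofPath k r p)
      (M.prod (ofPath k r q) w) = φ t t' t'' • M.prod (M.prod (ofPath k r p) (ofPath k r q)) w)
    (by simp [prod_zero])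
    (fun a b ha hb => by simp only [prod_add, smul_add, ha, hb])
    (fun c a ha => by simp only [prod_smul, smul_comm _ c, ha])
    (fun z h7 h8 h9 => ?_) hw
  subst h1 h2 h3 h4 h5 h6 h7 h8 h9
  exact hM.prod_assoc_ofPath p q z

theorem vertex_zero_prod (u : PathCoalgebra k r) : M.prod (ofPath k r (vertex 0)) u = u := by
  rw [← hM.one_eq]; exact M.one_mul u

theorem prod_vertex_zero (u : PathCoalgebra k r) : M.prod u (ofPath k r (vertex 0)) = u := by
  rw [← hM.one_eq]; exact M.mul_one u

/-- For paths starting at the unit, the Leibniz rule for first arrows is untwisted and holds in any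
graded structure: no knowledge of the products of vertices with arrows is needed. -/
theorem dropFirst_prod_ofPath (i : ι) (p q : HopfPath G ι) (hp : p.1 = 0) (hq : q.1 = 0) :
    dropFirst k r i (M.prod (ofPath k r p) (ofPath k r q)) =
      M.prod (dropFirst k r i (ofPath k r p)) (ofPath k r q) +
        M.prod (ofPath k r p) (dropFirst k r i (ofPath k r q)) := by
  classical
  -- A product of two paths of positive length has degree at least two and no arrow coefficient.
  -- Otherwise one factor is the vertex `0`, which is the unit.
  have key : ∀ p q : HopfPath G ι, p.1 = 0 → q.1 = 0 →
      arrowCoeff k r i (M.mul (ofPath k r p ⊗ₜ ofPath k r q)) =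
        1 * (arrowCoeff k r i (ofPath k r p) * CoalgebraStruct.counit (R := k) (ofPath k r q)) +
        1 * (CoalgebraStruct.counit (R := k) (ofPath k r p) * arrowCoeff k r i (ofPath k r q)) := by
    intro p q hp hq
    change arrowCoeff k r i (M.prod (ofPath k r p) (ofPath k r q)) = _
    rw [_root_.one_mul, _root_.one_mul, counit_ofPath, counit_ofPath]
    by_cases hp0 : p.length = 0
    · have hp' := HopfPath.length_eq_zero hp0
      rw [hp] at hp'
      have h0 : arrowCoeff k r i (ofPath k r p) = 0 := by
        rw [hp', arrowCoeff_ofPath, vertex, if_neg (by simp)]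
      rw [h0, if_pos hp0, hp', hM.vertex_zero_prod]
      simp
    · by_cases hq0 : q.length = 0
      · have hq' := HopfPath.length_eq_zero hq0
        rw [hq] at hq'
        have h0 : arrowCoeff k r i (ofPath k r q) = 0 := by
          rw [hq', arrowCoeff_ofPath, vertex, if_neg (by simp)]
        rw [h0, if_pos hq0, hq', hM.prod_vertex_zero]
        simp
      · rw [if_neg hp0, if_neg hq0, arrowCoeff_eq_zero i (by omega) (hM.prod_mem p q)]
        simp
  have := dropFirst_mul M.mul i p q 1 1 fun j l => key _ _ hp hq
  rw [one_smul, one_smul] at this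
  exact this

theorem dropFirst_prod (i : ι) {t t' : G} {n n' : ℕ} {u v : PathCoalgebra k r}
    (hu : u ∈ between k r 0 t n) (hv : v ∈ between k r 0 t' n') :
    dropFirst k r i (M.prod u v) =
      M.prod (dropFirst k r i u) v + M.prod u (dropFirst k r i v) := by
  refine between_induction (P := fun u => dropFirst k r i (M.prod u v) =
      M.prod (dropFirst k r i u) v + M.prod u (dropFirst k r i v)) (by simp [zero_prod])
    (fun a b ha hb => by simp only [add_prod, map_add, ha, hb]; abel)
    (fun c a ha => by simp only [smul_prod, map_smul, ha, smul_add]) (fun p h1 _ _ => ?_) hu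
  refine between_induction (P := fun v => dropFirst k r i (M.prod (ofPath k r p) v) =
      M.prod (dropFirst k r i (ofPath k r p)) v + M.prod (ofPath k r p) (dropFirst k r i v))
    (by simp [prod_zero])
    (fun a b ha hb => by simp only [prod_add, map_add, ha, hb]; abel)
    (fun c a ha => by simp only [prod_smul, map_smul, ha, smul_add]) (fun q h4 _ _ => ?_) hv
  exact hM.dropFirst_prod_ofPath i p q h1 h4

end IsGraded

/-! ### Commutation scalars of vertices and arrows -/

/-- The arrow `X` with label `i` starting at the unit and the vertex `f` satisfy
`f X = t X f`. -/
def Commutes (M : MajidAlgebra k (PathCoalgebra k r)) (f : G) (i : ι) (t : k) : Prop :=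
  M.prod (ofPath k r (vertex f)) (ofPath k r (arrow 0 i)) =
    t • M.prod (ofPath k r (arrow 0 i)) (ofPath k r (vertex f))

namespace IsGraded

variable {M : MajidAlgebra k (PathCoalgebra k r)} (hM : M.IsGraded φ)
  (hφ : IsNormalizedCocycle φ)
include hM hφ

theorem prod_vertex_ne_zero {s t : G} {n : ℕ} {u : PathCoalgebra k r}
    (hu : u ∈ between k r s t n) (h0 : u ≠ 0) (f : G) : M.prod u (ofPath k r (vertex f)) ≠ 0 := by
  intro h
  have := hM.prod_assoc hu (vertex_mem_between f) (vertex_mem_between (-f))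
  rw [h, zero_prod, smul_zero, hM.vertex_mul, add_neg_cancel, hM.prod_vertex_zero] at this
  exact (smul_ne_zero (hφ.ne_zero _ _ _) h0) this

theorem commutes_unique {f : G} {i : ι} {t t' : k} (h : M.Commutes f i t)
    (h' : M.Commutes f i t') : t = t' :=
  smul_left_injective k (hM.prod_vertex_ne_zero hφ (arrow_mem_between i)
    (ofPath_ne_zero _ _) f) (h.symm.trans h')

theorem commutes_zero (i : ι) : M.Commutes 0 i 1 := by
  rw [Commutes, hM.vertex_zero_prod, hM.prod_vertex_zero, one_smul]

/-- Moving `X` through `f f'` passes through the bracketings of `(f, f', X)`, `(f, X, f')` and `(X,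
f, f')`. Each rebracketing contributes one value of `φ` at the targets; the value at the sources is
`1`, since `X` starts at the unit and `φ` is normalized. -/
theorem commutes_add {f f' : G} {i : ι} {t t' : k} (h : M.Commutes f i t)
    (h' : M.Commutes f' i t') :
    M.Commutes (f + f') i (t * t' * (φ f (r i) f' / (φ f f' (r i) * φ (r i) f f'))) := by
  have hX := arrow_mem_between (k := k) (r := r) i
  have hf := vertex_mem_between (k := k) (r := r) f
  have hf' := vertex_mem_between (k := k) (r := r) f'
  have e1 := hM.prod_assoc hf hf' hX
  have e2 := hM.prod_assoc hf hX hf'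
  have e3 := hM.prod_assoc hX hf hf'
  rw [hM.vertex_mul] at e1 e3
  rw [h', prod_smul, hφ.zero_right, one_smul] at e1
  rw [h, smul_prod, hφ.apply_zero, one_smul] at e2
  rw [hφ.zero_left, one_smul] at e3
  rw [Commutes, e3]
  rw [e2] at e1
  have n1 := hφ.ne_zero f f' (r i)
  have n2 := hφ.ne_zero (r i) f f'
  refine smul_right_injective _ n1 ?_
  simp only
  rw [← e1, smul_smul, smul_smul, smul_smul, smul_smul]
  congr 1
  field_simp

theorem commutes_nsmul {f : G} {i : ι} {t : k} (h : M.Commutes f i t) (n : ℕ) :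
    M.Commutes (n • f) i (t ^ n * ∏ j ∈ Finset.range n,
      (φ f (r i) (j • f) / (φ f (j • f) (r i) * φ (r i) f (j • f)))) := by
  induction n with
  | zero => simpa using hM.commutes_zero hφ i
  | succ n ih =>
    rw [succ_nsmul', Finset.prod_range_succ]
    convert hM.commutes_add hφ h ih using 1
    ring

/-- Multiply `(f X) f⁻¹ = μ X` by `f` on the right and rebracket; the quotient compares `φ` at the
target and at the source of `f X`. -/
theorem commutes_of_act {f : G} {i : ι} {μ : k}
    (h : M.act f (ofPath k r (arrow 0 i)) = μ • ofPath k r (arrow 0 i)) :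
    M.Commutes f i (μ * (φ (f + r i) (-f) f / φ f (-f) f)) := by
  have hX := arrow_mem_between (k := k) (r := r) i
  have hf := vertex_mem_between (k := k) (r := r) f
  have e := hM.prod_assoc (hM.prod_mem_between hf hX) (vertex_mem_between (-f)) hf
  rw [hM.vertex_mul, neg_add_cancel, hM.prod_vertex_zero] at e
  rw [act] at h
  rw [h, smul_prod, add_zero] at e
  rw [Commutes]
  have n1 := hφ.ne_zero f (-f) f
  refine smul_right_injective _ n1 ?_
  simp only
  rw [e, smul_smul, smul_smul]
  congr 1
  field_simp

end IsGraded

/-! ### Powers of an arrow and quantum integers -/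

/-- The left-normed powers of the arrow with label `i` starting at the unit. -/
def arrowPow (M : MajidAlgebra k (PathCoalgebra k r)) (i : ι) : ℕ → PathCoalgebra k r
  | 0 => ofPath k r (vertex 0)
  | n + 1 => M.prod (M.arrowPow i n) (ofPath k r (arrow 0 i))

end MajidAlgebra

namespace PathCoalgebra

open HopfPath

variable {k : Type*} [Field k] {G ι : Type*} [AddCommGroup G] {r : ι → G}

theorem dropFirst_vertex (i : ι) (x : G) : dropFirst k r i (ofPath k r (vertex x)) = 0 :=
  dropFirst_nil i x

theorem dropFirst_arrow_self (i : ι) :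
    dropFirst k r i (ofPath k r (arrow 0 i)) = ofPath k r (vertex (r i)) := by
  have := dropFirst_concat (k := k) (r := r) i 0 [] i
  rw [if_pos rfl, add_zero] at this
  exact this

theorem dropFirst_arrow_of_ne {i j : ι} (h : j ≠ i) :
    dropFirst k r i (ofPath k r (arrow 0 j)) = 0 := by
  have := dropFirst_concat (k := k) (r := r) i 0 [] j
  rw [if_neg h] at this
  exact this

theorem eq_zero_of_dropFirst {s t : G} {n : ℕ} (hn : n ≠ 0) {u : PathCoalgebra k r}
    (hu : u ∈ between k r s t n) (h : ∀ i, dropFirst k r i u = 0) : u = 0 := by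
  refine ext_dropFirst ?_ fun i => by rw [h, map_zero]
  rw [map_zero]
  exact eqOn_between (f := vertexPart k r) (g := 0)
    (fun p _ _ hp => by rw [vertexPart_ofPath, if_neg (by omega)]; rfl) hu

end PathCoalgebra

namespace MajidAlgebra

open HopfPath PathCoalgebra

variable {k : Type*} [Field k] {G ι : Type*} [AddCommGroup G] {φ : G → G → G → k} {r : ι → G}

namespace IsGraded

variable {M : MajidAlgebra k (PathCoalgebra k r)} (hM : M.IsGraded φ)
include hM

theorem arrowPow_mem_between (i : ι) (n : ℕ) :
    M.arrowPow i n ∈ between k r 0 (n • r i) n := by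
  induction n with
  | zero => simpa [arrowPow] using vertex_mem_between (k := k) (r := r) 0
  | succ n ih =>
    exact mem_between_of_eq (hM.prod_mem_between ih (arrow_mem_between i)) (add_zero 0)
      (succ_nsmul _ _).symm rfl

theorem dropFirst_arrowPow_of_ne {i j : ι} (h : i ≠ j) (n : ℕ) :
    dropFirst k r j (M.arrowPow i n) = 0 := by
  induction n with
  | zero => exact dropFirst_vertex _ _
  | succ n ih =>
    rw [arrowPow, hM.dropFirst_prod j (hM.arrowPow_mem_between i n) (arrow_mem_between i), ih,
      dropFirst_arrow_of_ne h, zero_prod, prod_zero, add_zero]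

theorem prod_vertex_arrow (hφ : IsNormalizedCocycle φ) {i : ι} {t : k}
    (h : M.Commutes (r i) i t) {s : G} {n : ℕ} {u : PathCoalgebra k r}
    (hu : u ∈ between k r 0 s n) :
    M.prod (M.prod u (ofPath k r (vertex (r i)))) (ofPath k r (arrow 0 i)) =
      t • M.prod (M.prod u (ofPath k r (arrow 0 i))) (ofPath k r (vertex (r i))) := by
  have hX := arrow_mem_between (k := k) (r := r) i
  have hf := vertex_mem_between (k := k) (r := r) (r i)
  have e1 := hM.prod_assoc hu hf hX
  have e2 := hM.prod_assoc hu hX hf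
  rw [h, prod_smul, hφ.zero_left, one_smul] at e1
  rw [hφ.zero_left, one_smul] at e2
  rw [e2] at e1
  refine smul_right_injective _ (hφ.ne_zero s (r i) (r i)) ?_
  simp only
  rw [← e1, smul_comm]

/-- The quantum version of the derivative of a power: each time the deleted arrow leaves its target
vertex behind, moving that vertex past one more factor costs `t`. -/
theorem dropFirst_arrowPow (hφ : IsNormalizedCocycle φ) {i : ι} {t : k}
    (h : M.Commutes (r i) i t) (n : ℕ) :
    dropFirst k r i (M.arrowPow i (n + 1)) =
      (∑ j ∈ Finset.range (n + 1), t ^ j) •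
        M.prod (M.arrowPow i n) (ofPath k r (vertex (r i))) := by
  induction n with
  | zero =>
    have hz : M.arrowPow i 0 = ofPath k r (vertex 0) := rfl
    have h1 : M.arrowPow i (0 + 1) = ofPath k r (arrow 0 i) := hM.vertex_zero_prod _
    rw [h1, hz, hM.vertex_zero_prod, dropFirst_arrow_self]
    simp
  | succ n ih =>
    rw [arrowPow, hM.dropFirst_prod i (hM.arrowPow_mem_between i (n + 1)) (arrow_mem_between i),
      ih, dropFirst_arrow_self, smul_prod,
      hM.prod_vertex_arrow hφ h (hM.arrowPow_mem_between i n), smul_smul,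
      geom_sum_succ (n := n + 1), add_smul, one_smul, mul_comm t]
    rfl

theorem arrowPow_ne_zero (hφ : IsNormalizedCocycle φ) {i : ι} {t : k}
    (h : M.Commutes (r i) i t) (ht : ∀ n, ∑ j ∈ Finset.range (n + 1), t ^ j ≠ 0) (n : ℕ) :
    M.arrowPow i n ≠ 0 := by
  induction n with
  | zero => exact ofPath_ne_zero _ _
  | succ n ih =>
    intro h0
    have e := hM.dropFirst_arrowPow hφ h n
    rw [h0, map_zero] at e
    exact smul_ne_zero (ht n) (hM.prod_vertex_ne_zero hφ (hM.arrowPow_mem_between i n) ih _) e.symm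

/-- All its first-arrow derivatives vanish, the one with label `i` through the quantum integer and
the others because only arrows with label `i` occur; an element of positive degree with this
property is zero. -/
theorem arrowPow_eq_zero (hφ : IsNormalizedCocycle φ) {i : ι} {t : k}
    (h : M.Commutes (r i) i t) {n : ℕ} (ht : ∑ j ∈ Finset.range (n + 1), t ^ j = 0) :
    M.arrowPow i (n + 1) = 0 := by
  refine eq_zero_of_dropFirst (Nat.succ_ne_zero n) (hM.arrowPow_mem_between i (n + 1)) fun j => ?_
  by_cases hj : i = j
  · subst hj
    rw [hM.dropFirst_arrowPow hφ h n, ht, zero_smul]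
  · exact hM.dropFirst_arrowPow_of_ne hj _

/-- Applying the two derivations to `XY = qYX` replaces one arrow by its target vertex and leaves
the other in place. -/
theorem commutes_of_skewCommute {i j : ι} (hij : i ≠ j) {q : k} (hq : q ≠ 0)
    (h : M.prod (ofPath k r (arrow 0 i)) (ofPath k r (arrow 0 j)) =
      q • M.prod (ofPath k r (arrow 0 j)) (ofPath k r (arrow 0 i))) :
    M.Commutes (r i) j q ∧ M.Commutes (r j) i q⁻¹ := by
  have hi := arrow_mem_between (k := k) (r := r) i
  have hj := arrow_mem_between (k := k) (r := r) j
  have e1 := congrArg (dropFirst k r i) h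
  have e2 := congrArg (dropFirst k r j) h
  rw [map_smul, hM.dropFirst_prod i hi hj, hM.dropFirst_prod i hj hi, dropFirst_arrow_self,
    dropFirst_arrow_of_ne hij.symm, prod_zero, zero_prod, add_zero, zero_add] at e1
  rw [map_smul, hM.dropFirst_prod j hi hj, hM.dropFirst_prod j hj hi, dropFirst_arrow_self,
    dropFirst_arrow_of_ne hij, prod_zero, zero_prod, add_zero, zero_add] at e2
  refine ⟨e1, ?_⟩
  rw [Commutes, e2, smul_smul, inv_mul_cancel₀ hq, one_smul]

end IsGraded

end MajidAlgebra

namespace PathCoalgebra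

open HopfPath

variable {k : Type*} [Field k] {G ι : Type*} [AddCommGroup G] {r : ι → G}

theorem coord_eq_zero {p : HopfPath G ι} {n : ℕ} (hn : p.length ≠ n) {u : PathCoalgebra k r}
    (hu : u ∈ homogeneous k r n) : (basis k r).coord p u = 0 := by
  classical
  induction hu using Submodule.span_induction with
  | mem x hx =>
    obtain ⟨q, hq, rfl⟩ := hx
    rw [coord_ofPath, if_neg]
    rintro rfl
    exact hn hq
  | zero => simp
  | add x y _ _ hx hy => rw [map_add, hx, hy, add_zero]
  | smul c x _ hx => rw [map_smul, hx, smul_zero]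

theorem linearIndependent_of_mem_homogeneous {u : ℕ → PathCoalgebra k r}
    (hu : ∀ n, u n ∈ homogeneous k r n) (h0 : ∀ n, u n ≠ 0) : LinearIndependent k u := by
  have hp (n) : ∃ p : HopfPath G ι, p.length = n ∧ (basis k r).coord p (u n) ≠ 0 := by
    by_contra! h
    refine h0 n ((basis k r).ext_elem fun p => ?_)
    rw [map_zero]
    change (basis k r).coord p (u n) = 0
    by_cases hp : p.length = n
    · exact h p hp
    · exact coord_eq_zero hp (hu n)
  choose p hp1 hp2 using hp
  refine linearIndependent_iff'.2 fun s g hg i hi => ?_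
  have := congrArg ((basis k r).coord (p i)) hg
  rw [map_sum, map_zero, Finset.sum_eq_single i] at this
  · rw [map_smul, smul_eq_mul] at this
    exact (mul_eq_zero.1 this).resolve_right (hp2 i)
  · intro j _ hj
    rw [map_smul, coord_eq_zero (by rw [hp1]; exact hj.symm) (hu j), smul_zero]
  · exact fun h => absurd hi h

/-- Two vectors are nonzero multiples of each other. -/
def SameLine {V : Type*} (k : Type*) [Field k] [AddCommGroup V] [Module k V] (u v : V) : Prop :=
  ∃ c : k, c ≠ 0 ∧ u = c • v

end PathCoalgebra

namespace PathCoalgebra.SameLine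

variable {k V : Type*} [Field k] [AddCommGroup V] [Module k V] {u v w : V}

theorem refl (u : V) : SameLine k u u := ⟨1, one_ne_zero, (one_smul k u).symm⟩

theorem symm (h : SameLine k u v) : SameLine k v u := by
  obtain ⟨c, hc, rfl⟩ := h
  exact ⟨c⁻¹, inv_ne_zero hc, by rw [smul_smul, inv_mul_cancel₀ hc, one_smul]⟩

theorem trans (h : SameLine k u v) (h' : SameLine k v w) : SameLine k u w := by
  obtain ⟨c, hc, rfl⟩ := h
  obtain ⟨d, hd, rfl⟩ := h'
  exact ⟨c * d, mul_ne_zero hc hd, smul_smul _ _ _⟩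

theorem of_smul_eq {c d : k} (hc : c ≠ 0) (hd : d ≠ 0) (h : c • u = d • v) : SameLine k u v :=
  ⟨c⁻¹ * d, mul_ne_zero (inv_ne_zero hc) hd, by
    rw [mul_smul, ← h, smul_smul, inv_mul_cancel₀ hc, one_smul]⟩

variable {H : Type*} [AddCommGroup H] [Module k H] [Coalgebra k H] (M : MajidAlgebra k H)
  {a b c : H}

theorem prod_left (h : SameLine k a b) (c : H) : SameLine k (M.prod a c) (M.prod b c) := by
  obtain ⟨x, hx, rfl⟩ := h
  exact ⟨x, hx, M.smul_prod x b c⟩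

theorem prod_right (h : SameLine k a b) (c : H) : SameLine k (M.prod c a) (M.prod c b) := by
  obtain ⟨x, hx, rfl⟩ := h
  exact ⟨x, hx, M.prod_smul x c b⟩

end PathCoalgebra.SameLine

/-! ### Monomials, the subalgebra they span, and finite dimension -/

namespace MajidAlgebra

open HopfPath PathCoalgebra

variable {k : Type*} [Field k] {G ι : Type*} [AddCommGroup G] {φ : G → G → G → k} {r : ι → G}

theorem arrowPow_mem {M : MajidAlgebra k (PathCoalgebra k r)} (hM : M.IsGraded φ)
    {N : Submodule k (PathCoalgebra k r)} (hN : M.IsMajidSubalgebra N) {i : ι}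
    (hi : ofPath k r (arrow 0 i) ∈ N) (n : ℕ) : M.arrowPow i n ∈ N := by
  induction n with
  | zero => rw [arrowPow, ← hM.one_eq]; exact hN.one_mem
  | succ n ih => exact hN.prod_mem _ ih _ hi

theorem not_finiteDimensional_of_arrowPow {M : MajidAlgebra k (PathCoalgebra k r)}
    (hM : M.IsGraded φ) {i : ι} (h0 : ∀ n, M.arrowPow i n ≠ 0)
    {N : Submodule k (PathCoalgebra k r)} (hN : ∀ n, M.arrowPow i n ∈ N) :
    ¬ FiniteDimensional k N := by
  intro hfin
  have h1 : LinearIndependent k (M.arrowPow i) := linearIndependent_of_mem_homogeneous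
    (fun n => between_le_homogeneous _ _ _ (hM.arrowPow_mem_between i n)) h0
  have h2 : LinearIndependent k (fun n => (⟨M.arrowPow i n, hN n⟩ : N)) :=
    LinearIndependent.of_comp N.subtype h1
  exact not_finite_iff_infinite.2 (inferInstance : Infinite ℕ) h2.finite

/-- Iterated products of vertices and of arrows starting at the unit, with their source, target
and degree. -/
inductive IsMonomial (M : MajidAlgebra k (PathCoalgebra k r)) :
    G → G → ℕ → PathCoalgebra k r → Prop
  | vertex (x : G) : IsMonomial M x x 0 (ofPath k r (.vertex x))
  | arrow (i : ι) : IsMonomial M 0 (r i) 1 (ofPath k r (.arrow 0 i))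
  | prod {s t s' t' : G} {n n' : ℕ} {u u' : PathCoalgebra k r} :
    IsMonomial M s t n u → IsMonomial M s' t' n' u' →
      IsMonomial M (s + s') (t + t') (n + n') (M.prod u u')

/-- The span of the monomials. -/
def monomialSpan (M : MajidAlgebra k (PathCoalgebra k r)) : Submodule k (PathCoalgebra k r) :=
  Submodule.span k {u | ∃ s t n, M.IsMonomial s t n u}

/-- The span of the tensors of two monomials, the first of degree less than `n`. -/
def monomialTensors (M : MajidAlgebra k (PathCoalgebra k r)) (n : ℕ) :
    Submodule k (PathCoalgebra k r ⊗[k] PathCoalgebra k r) :=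
  Submodule.span k {z | ∃ s t m u s' t' m' u', m < n ∧ M.IsMonomial s t m u ∧
    M.IsMonomial s' t' m' u' ∧ z = u ⊗ₜ[k] u'}

theorem IsMonomial.mem_monomialSpan {M : MajidAlgebra k (PathCoalgebra k r)} {s t : G} {n : ℕ}
    {u : PathCoalgebra k r} (h : M.IsMonomial s t n u) : u ∈ M.monomialSpan :=
  Submodule.subset_span ⟨s, t, n, h⟩

theorem prod_mem_monomialSpan (M : MajidAlgebra k (PathCoalgebra k r)) {u v : PathCoalgebra k r}
    (hu : u ∈ M.monomialSpan) (hv : v ∈ M.monomialSpan) : M.prod u v ∈ M.monomialSpan := by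
  induction hu using Submodule.span_induction with
  | mem x hx =>
    obtain ⟨s, t, n, hx⟩ := hx
    induction hv using Submodule.span_induction with
    | mem y hy =>
      obtain ⟨s', t', n', hy⟩ := hy
      exact (hx.prod hy).mem_monomialSpan
    | zero => rw [prod_zero]; exact zero_mem _
    | add a b _ _ ha hb => rw [prod_add]; exact add_mem ha hb
    | smul c a _ ha => rw [prod_smul]; exact Submodule.smul_mem _ _ ha
  | zero => rw [zero_prod]; exact zero_mem _
  | add a b _ _ ha hb => rw [add_prod]; exact add_mem ha hb
  | smul c a _ ha => rw [smul_prod]; exact Submodule.smul_mem _ _ ha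

theorem monomialTensors_mono (M : MajidAlgebra k (PathCoalgebra k r)) {n n' : ℕ} (h : n ≤ n') :
    M.monomialTensors n ≤ M.monomialTensors n' := by
  refine Submodule.span_mono ?_
  rintro z ⟨s, t, m, u, s', t', m', u', hm, hz⟩
  exact ⟨s, t, m, u, s', t', m', u', hm.trans_le h, hz⟩

theorem tmul_mem_monomialTensors (M : MajidAlgebra k (PathCoalgebra k r)) {s t s' t' : G}
    {m m' n : ℕ} {u u' : PathCoalgebra k r} (hu : M.IsMonomial s t m u)
    (hu' : M.IsMonomial s' t' m' u') (h : m < n) : u ⊗ₜ[k] u' ∈ M.monomialTensors n :=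
  Submodule.subset_span ⟨s, t, m, u, s', t', m', u', h, hu, hu', rfl⟩

/-- The componentwise product on `H ⊗ H`. -/
def prod₂ (M : MajidAlgebra k (PathCoalgebra k r)) :
    (PathCoalgebra k r ⊗[k] PathCoalgebra k r) ⊗[k]
      (PathCoalgebra k r ⊗[k] PathCoalgebra k r) →ₗ[k]
        PathCoalgebra k r ⊗[k] PathCoalgebra k r :=
  TensorProduct.map M.mul.toLinearMap M.mul.toLinearMap ∘ₗ
    (TensorProduct.AlgebraTensorModule.tensorTensorTensorComm k k k k _ _ _ _).toLinearMap

theorem prod₂_tmul (M : MajidAlgebra k (PathCoalgebra k r)) (a b c d : PathCoalgebra k r) :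
    M.prod₂ ((a ⊗ₜ b) ⊗ₜ (c ⊗ₜ d)) = M.prod a c ⊗ₜ M.prod b d := by
  simp [prod₂, prod]

theorem comul_prod (M : MajidAlgebra k (PathCoalgebra k r)) (u v : PathCoalgebra k r) :
    CoalgebraStruct.comul (R := k) (M.prod u v) =
      M.prod₂ (CoalgebraStruct.comul (R := k) u ⊗ₜ CoalgebraStruct.comul (R := k) v) :=
  (LinearMap.congr_fun M.mul.map_comp_comul (u ⊗ₜ v)).symm

theorem prod₂_mem_monomialTensors (M : MajidAlgebra k (PathCoalgebra k r)) {m m' n : ℕ}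
    (h : m + m' ≤ n + 1) {z z' : PathCoalgebra k r ⊗[k] PathCoalgebra k r}
    (hz : z ∈ M.monomialTensors m) (hz' : z' ∈ M.monomialTensors m') :
    M.prod₂ (z ⊗ₜ z') ∈ M.monomialTensors n := by
  induction hz using Submodule.span_induction with
  | mem x hx =>
    obtain ⟨_, _, d, _, _, _, _, _, hd, h1, h2, rfl⟩ := hx
    induction hz' using Submodule.span_induction with
    | mem y hy =>
      obtain ⟨_, _, d', _, _, _, _, _, hd', h3, h4, rfl⟩ := hy
      rw [prod₂_tmul]
      exact M.tmul_mem_monomialTensors (h1.prod h3) (h2.prod h4) (by omega)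
    | zero => rw [TensorProduct.tmul_zero, map_zero]; exact zero_mem _
    | add a b _ _ ha hb => rw [TensorProduct.tmul_add, map_add]; exact add_mem ha hb
    | smul c a _ ha => rw [TensorProduct.tmul_smul, map_smul]; exact Submodule.smul_mem _ _ ha
  | zero => rw [TensorProduct.zero_tmul, map_zero]; exact zero_mem _
  | add a b _ _ ha hb => rw [TensorProduct.add_tmul, map_add]; exact add_mem ha hb
  | smul c a _ ha =>
    rw [← TensorProduct.smul_tmul', map_smul]; exact Submodule.smul_mem _ _ ha

namespace IsGraded

variable {M : MajidAlgebra k (PathCoalgebra k r)} (hM : M.IsGraded φ)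
include hM

theorem isMonomial_mem_between {s t : G} {n : ℕ} {u : PathCoalgebra k r}
    (h : M.IsMonomial s t n u) : u ∈ between k r s t n := by
  induction h with
  | vertex x => exact vertex_mem_between x
  | arrow i => exact arrow_mem_between i
  | prod _ _ h h' => exact hM.prod_mem_between h h'

/-- Isolates the leading term of `Δ u`, whose left factor is `u` itself. All other left factors are
monomials of smaller degree, which permits induction on the degree. -/
theorem comul_sub_mem {s t : G} {n : ℕ} {u : PathCoalgebra k r} (h : M.IsMonomial s t n u) :
    CoalgebraStruct.comul (R := k) u - u ⊗ₜ[k] ofPath k r (vertex s) ∈ M.monomialTensors n := by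
  induction h with
  | vertex x => rw [comul_vertex, sub_self]; exact zero_mem _
  | arrow i =>
    rw [comul_arrow, add_sub_cancel_left]
    exact M.tmul_mem_monomialTensors (.vertex _) (.arrow i) one_pos
  | @prod s t s' t' n n' u u' h h' ih ih' =>
    -- The usual splitting of a difference of products, `A A' - B B' = B (A' - B') + (A - B) A'`.
    have e : CoalgebraStruct.comul (R := k) (M.prod u u') -
        M.prod u u' ⊗ₜ[k] ofPath k r (vertex (s + s')) =
        M.prod₂ ((u ⊗ₜ ofPath k r (vertex s)) ⊗ₜ
          (CoalgebraStruct.comul (R := k) u' - u' ⊗ₜ[k] ofPath k r (vertex s'))) +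
        M.prod₂ ((CoalgebraStruct.comul (R := k) u - u ⊗ₜ[k] ofPath k r (vertex s)) ⊗ₜ
          CoalgebraStruct.comul (R := k) u') := by
      rw [comul_prod, TensorProduct.tmul_sub, TensorProduct.sub_tmul, map_sub, map_sub,
        prod₂_tmul, hM.vertex_mul]
      abel
    rw [e]
    refine add_mem (M.prod₂_mem_monomialTensors (m := n + 1) (m' := n') (by omega)
      (M.tmul_mem_monomialTensors h (.vertex s) (Nat.lt_succ_self n)) ih')
      (M.prod₂_mem_monomialTensors (m := n) (m' := n' + 1) (by omega) ih ?_)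
    have := add_mem (M.monomialTensors_mono (Nat.le_succ n') ih')
      (M.tmul_mem_monomialTensors h' (.vertex s') (Nat.lt_succ_self n'))
    rwa [sub_add_cancel] at this

theorem α_eq : M.α = vertexWeight r fun x => M.α (ofPath k r (vertex x)) := by
  refine hom_ext fun p => ?_
  rw [vertexWeight_ofPath]
  split_ifs with h
  · rw [← HopfPath.length_eq_zero h]
  · exact hM.α_eq_zero p (Nat.pos_of_ne_zero h)

/-- If it vanished, the axiom `assoc_antipode` at the vertex `x` would read `0 = 1`. -/
theorem α_vertex_ne_zero (x : G) : M.α (ofPath k r (vertex x)) ≠ 0 := by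
  intro h
  have := LinearMap.congr_fun M.assoc_antipode (ofPath k r (vertex x))
  rw [convAlong_vertex, convAlong_vertex, counit_ofPath, if_pos (length_vertex x)] at this
  have h0 : convRight M.antipode M.α (ofPath k r (vertex x)) = 0 := by
    rw [convRight, convAlong_vertex, h, TensorProduct.tmul_zero, map_zero]
  rw [h0, TensorProduct.zero_tmul, map_zero, TensorProduct.tmul_zero, map_zero] at this
  exact zero_ne_one this

/-- Induction on the degree: `S(a₁) α(a₂) a₃ = α(a) 1` is solved for its leading term, a nonzero
multiple of `S(u)` times the source vertex of `u`. That vertex is then cancelled, for which `hS`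
provides the ends of `S(u)`. -/
theorem antipode_mem_monomialSpan (hφ : IsNormalizedCocycle φ)
    (hS : ∀ p : HopfPath G ι, M.antipode (ofPath k r p) ∈ between k r (-target r p) (-p.1) p.length)
    {s t : G} {n : ℕ} {u : PathCoalgebra k r} (h : M.IsMonomial s t n u) :
    M.antipode u ∈ M.monomialSpan := by
  induction n using Nat.strong_induction_on generalizing s t u with
  | _ n ih =>
  -- As `α` lives in degree zero, it only sees the common source `s`.
  have hconv {s t : G} {n : ℕ} {u : PathCoalgebra k r} (h : M.IsMonomial s t n u) :
      convRight M.antipode M.α u = M.α (ofPath k r (vertex s)) • M.antipode u := by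
    refine eqOn_between (g := M.α (ofPath k r (vertex s)) • M.antipode)
      (fun p hp _ _ => ?_) (hM.isMonomial_mem_between h)
    rw [hM.α_eq, convRight_vertexWeight, ← hM.α_eq, hp]
    rfl
  have hSu : M.antipode u ∈ between k r (-t) (-s) n := by
    refine between_induction (P := fun u => M.antipode u ∈ between k r (-t) (-s) n)
      (by simp) (fun a b ha hb => by rw [map_add]; exact add_mem ha hb)
      (fun c a ha => by rw [map_smul]; exact Submodule.smul_mem _ _ ha)
      (fun p h1 h2 h3 => ?_) (hM.isMonomial_mem_between h)
    subst h1 h2 h3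
    exact hS p
  set F : PathCoalgebra k r ⊗[k] PathCoalgebra k r →ₗ[k] PathCoalgebra k r :=
    M.mul.toLinearMap ∘ₗ TensorProduct.map (convRight M.antipode M.α) LinearMap.id with hF
  have hFt (a b) : F (a ⊗ₜ b) = M.prod (convRight M.antipode M.α a) b := rfl
  have hone : M.one ∈ M.monomialSpan := by
    rw [hM.one_eq]; exact (IsMonomial.vertex 0).mem_monomialSpan
  have h1 : F (CoalgebraStruct.comul (R := k) u) ∈ M.monomialSpan := by
    have := LinearMap.congr_fun M.antipode_left u
    rw [LinearMap.smulRight_apply] at this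
    exact this ▸ Submodule.smul_mem _ _ hone
  have h2 : F (CoalgebraStruct.comul (R := k) u - u ⊗ₜ[k] ofPath k r (vertex s)) ∈
      M.monomialSpan := by
    have hle : M.monomialTensors n ≤ M.monomialSpan.comap F := by
      refine Submodule.span_le.2 ?_
      rintro z ⟨_, _, m, _, _, _, _, _, hm, h1, h2, rfl⟩
      change F _ ∈ M.monomialSpan
      rw [hFt, hconv h1, smul_prod]
      exact Submodule.smul_mem _ _ (M.prod_mem_monomialSpan (ih m hm h1) h2.mem_monomialSpan)
    exact hle (hM.comul_sub_mem h)
  have h3 := sub_mem h1 h2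
  rw [← map_sub, sub_sub_cancel, hFt, hconv h, smul_prod] at h3
  have h4 : M.prod (M.antipode u) (ofPath k r (vertex s)) ∈ M.monomialSpan :=
    (Submodule.smul_mem_iff _ (hM.α_vertex_ne_zero s)).1 h3
  have h5 := M.prod_mem_monomialSpan h4 (IsMonomial.vertex (M := M) (-s)).mem_monomialSpan
  have e := hM.prod_assoc hSu (vertex_mem_between s) (vertex_mem_between (-s))
  rw [hM.vertex_mul, add_neg_cancel, hM.prod_vertex_zero] at e
  exact (Submodule.smul_mem_iff _ (hφ.ne_zero _ _ _)).1 (e ▸ Submodule.smul_mem _ _ h5)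

theorem isMajidSubalgebra_monomialSpan (hφ : IsNormalizedCocycle φ)
    (hS : ∀ p : HopfPath G ι,
      M.antipode (ofPath k r p) ∈ between k r (-target r p) (-p.1) p.length) :
    M.IsMajidSubalgebra M.monomialSpan where
  one_mem := by rw [hM.one_eq]; exact (IsMonomial.vertex 0).mem_monomialSpan
  prod_mem u hu v hv := M.prod_mem_monomialSpan hu hv
  antipode_mem u hu := by
    have hle : M.monomialSpan ≤ M.monomialSpan.comap M.antipode := by
      refine Submodule.span_le.2 ?_
      rintro z ⟨_, _, _, hz⟩
      exact hM.antipode_mem_monomialSpan hφ hS hz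
    exact hle hu
  comul_mem u hu := by
    have hle : M.monomialSpan ≤ (LinearMap.range (TensorProduct.map M.monomialSpan.subtype
        M.monomialSpan.subtype)).comap (CoalgebraStruct.comul (R := k)) := by
      refine Submodule.span_le.2 ?_
      rintro z ⟨s, _, n, hz⟩
      have h1 := add_mem (M.monomialTensors_mono (Nat.le_succ n) (hM.comul_sub_mem hz))
        (M.tmul_mem_monomialTensors hz (.vertex s) (Nat.lt_succ_self n))
      rw [sub_add_cancel] at h1
      have h2 : M.monomialTensors (n + 1) ≤ LinearMap.range
          (TensorProduct.map M.monomialSpan.subtype M.monomialSpan.subtype) := by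
        refine Submodule.span_le.2 ?_
        rintro z ⟨_, _, _, u, _, _, _, u', _, h3, h4, rfl⟩
        exact ⟨(⟨u, h3.mem_monomialSpan⟩ : M.monomialSpan) ⊗ₜ
          (⟨u', h4.mem_monomialSpan⟩ : M.monomialSpan), rfl⟩
      exact h2 h1
    exact hle hu

theorem sameLine_assoc (hφ : IsNormalizedCocycle φ) {s t s' t' s'' t'' : G} {n n' n'' : ℕ}
    {u v w : PathCoalgebra k r} (hu : M.IsMonomial s t n u) (hv : M.IsMonomial s' t' n' v)
    (hw : M.IsMonomial s'' t'' n'' w) :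
    SameLine k (M.prod u (M.prod v w)) (M.prod (M.prod u v) w) :=
  .of_smul_eq (hφ.ne_zero _ _ _) (hφ.ne_zero _ _ _) (hM.prod_assoc
    (hM.isMonomial_mem_between hu) (hM.isMonomial_mem_between hv) (hM.isMonomial_mem_between hw))

/-- Rebracketing costs only nonzero scalars, so up to scalars a monomial can be moved through a
product one factor at a time, as in an associative algebra. -/
theorem sameLine_comm_of_generators (hφ : IsNormalizedCocycle φ) {s t s' t' : G} {n n' : ℕ}
    {g u : PathCoalgebra k r} (hg : M.IsMonomial s t n g)
    (hv : ∀ x, SameLine k (M.prod g (ofPath k r (vertex x))) (M.prod (ofPath k r (vertex x)) g))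
    (ha : ∀ i, SameLine k (M.prod g (ofPath k r (arrow 0 i)))
      (M.prod (ofPath k r (arrow 0 i)) g))
    (hu : M.IsMonomial s' t' n' u) : SameLine k (M.prod g u) (M.prod u g) := by
  induction hu with
  | vertex x => exact hv x
  | arrow i => exact ha i
  | prod h h' ih ih' =>
    exact (hM.sameLine_assoc hφ hg h h').trans <| (ih.prod_left M _).trans <|
      (hM.sameLine_assoc hφ h hg h').symm.trans <| (ih'.prod_right M _).trans <|
        hM.sameLine_assoc hφ h h' hg

theorem sameLine_comm (hφ : IsNormalizedCocycle φ)
    (hv : ∀ x i, SameLine k (M.prod (ofPath k r (vertex x)) (ofPath k r (arrow 0 i)))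
      (M.prod (ofPath k r (arrow 0 i)) (ofPath k r (vertex x))))
    (ha : ∀ i j, SameLine k (M.prod (ofPath k r (arrow 0 i)) (ofPath k r (arrow 0 j)))
      (M.prod (ofPath k r (arrow 0 j)) (ofPath k r (arrow 0 i))))
    {s t s' t' : G} {n n' : ℕ} {u v : PathCoalgebra k r} (hu : M.IsMonomial s t n u)
    (hv' : M.IsMonomial s' t' n' v) : SameLine k (M.prod u v) (M.prod v u) := by
  refine hM.sameLine_comm_of_generators hφ hu (fun x => ?_) (fun i => ?_) hv'
  · refine (hM.sameLine_comm_of_generators hφ (.vertex x) (fun y => ?_) (hv x) hu).symm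
    rw [hM.vertex_mul, hM.vertex_mul, add_comm]
    exact .refl _
  · exact (hM.sameLine_comm_of_generators hφ (.arrow i) (fun x => (hv x i).symm) (ha i) hu).symm

theorem isMonomial_arrowPow (i : ι) (n : ℕ) : M.IsMonomial 0 (n • r i) n (M.arrowPow i n) := by
  induction n with
  | zero => simpa [arrowPow] using IsMonomial.vertex (M := M) 0
  | succ n ih => simpa [arrowPow, succ_nsmul] using ih.prod (.arrow i)

theorem sameLine_arrowPow_add (hφ : IsNormalizedCocycle φ) (i : ι) (m n : ℕ) :
    SameLine k (M.prod (M.arrowPow i m) (M.arrowPow i n)) (M.arrowPow i (m + n)) := by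
  induction n with
  | zero =>
    rw [show M.arrowPow i 0 = ofPath k r (vertex 0) from rfl, hM.prod_vertex_zero]
    exact .refl _
  | succ n ih =>
    exact (hM.sameLine_assoc hφ (hM.isMonomial_arrowPow i m) (hM.isMonomial_arrowPow i n)
      (.arrow i)).trans (ih.prod_left M _)

theorem sameLine_medial (hφ : IsNormalizedCocycle φ)
    (hcomm : ∀ {s t s' t' : G} {n n' : ℕ} {u v : PathCoalgebra k r}, M.IsMonomial s t n u →
      M.IsMonomial s' t' n' v → SameLine k (M.prod u v) (M.prod v u))
    {s₁ t₁ s₂ t₂ s₃ t₃ s₄ t₄ : G} {n₁ n₂ n₃ n₄ : ℕ} {a b c d : PathCoalgebra k r}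
    (ha : M.IsMonomial s₁ t₁ n₁ a) (hb : M.IsMonomial s₂ t₂ n₂ b)
    (hc : M.IsMonomial s₃ t₃ n₃ c) (hd : M.IsMonomial s₄ t₄ n₄ d) :
    SameLine k (M.prod (M.prod a b) (M.prod c d)) (M.prod (M.prod a c) (M.prod b d)) :=
  (hM.sameLine_assoc hφ ha hb (hc.prod hd)).symm.trans <|
    (((hM.sameLine_assoc hφ hb hc hd).trans <| ((hcomm hb hc).prod_left M d).trans
      (hM.sameLine_assoc hφ hc hb hd).symm).prod_right M a).trans
      (hM.sameLine_assoc hφ ha hc (hb.prod hd))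

end IsGraded

section Plane

variable {r : Fin 2 → G}

/-- The ordered monomials in two arrows and a vertex. -/
def planeMonomial (M : MajidAlgebra k (PathCoalgebra k r)) (a b : ℕ) (x : G) :
    PathCoalgebra k r :=
  M.prod (M.prod (M.arrowPow 0 a) (M.arrowPow 1 b)) (ofPath k r (vertex x))

variable {M : MajidAlgebra k (PathCoalgebra k r)} (hM : M.IsGraded φ)
include hM

namespace IsGraded

/-- Once all monomials commute up to nonzero scalars, products of ordered monomials can be reordered
by the medial law `(ab)(cd) ~ (ac)(bd)`. Nonassociativity never has to be tracked beyond lines. -/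
theorem sameLine_planeMonomial (hφ : IsNormalizedCocycle φ)
    (hcomm : ∀ {s t s' t' : G} {n n' : ℕ} {u v : PathCoalgebra k r}, M.IsMonomial s t n u →
      M.IsMonomial s' t' n' v → SameLine k (M.prod u v) (M.prod v u))
    {s t : G} {n : ℕ} {u : PathCoalgebra k r} (hu : M.IsMonomial s t n u) :
    ∃ a b x, SameLine k u (M.planeMonomial a b x) := by
  have hz (i) : M.arrowPow i 0 = ofPath k r (vertex 0) := rfl
  have h1 (i) : M.arrowPow i 1 = ofPath k r (arrow 0 i) := by
    rw [arrowPow, hz, hM.vertex_zero_prod]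
  induction hu with
  | vertex x =>
    refine ⟨0, 0, x, ?_⟩
    rw [planeMonomial, hz, hz, hM.vertex_zero_prod, hM.vertex_zero_prod]
    exact .refl _
  | arrow i =>
    fin_cases i
    · refine ⟨1, 0, 0, ?_⟩
      rw [planeMonomial, h1, hz, hM.prod_vertex_zero, hM.prod_vertex_zero]
      exact .refl _
    · refine ⟨0, 1, 0, ?_⟩
      rw [planeMonomial, h1, hz, hM.prod_vertex_zero, hM.vertex_zero_prod]
      exact .refl _
  | prod _ _ ih ih' =>
    obtain ⟨a, b, x, h⟩ := ih
    obtain ⟨a', b', x', h'⟩ := ih'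
    refine ⟨a + a', b + b', x + x', ((h.prod_left M _).trans (h'.prod_right M _)).trans ?_⟩
    have pa := hM.isMonomial_arrowPow (0 : Fin 2) a
    have pa' := hM.isMonomial_arrowPow (0 : Fin 2) a'
    have pb := hM.isMonomial_arrowPow (1 : Fin 2) b
    have pb' := hM.isMonomial_arrowPow (1 : Fin 2) b'
    refine (hM.sameLine_medial hφ hcomm (pa.prod pb) (.vertex x) (pa'.prod pb')
      (.vertex x')).trans ?_
    rw [hM.vertex_mul]
    refine SameLine.prod_left M ?_ _
    refine (hM.sameLine_medial hφ hcomm pa pb pa' pb').trans ?_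
    exact ((hM.sameLine_arrowPow_add hφ 0 a a').prod_left M _).trans
      ((hM.sameLine_arrowPow_add hφ 1 b b').prod_right M _)

theorem finiteDimensional_monomialSpan [Finite G] (hφ : IsNormalizedCocycle φ)
    (hcomm : ∀ {s t s' t' : G} {n n' : ℕ} {u v : PathCoalgebra k r}, M.IsMonomial s t n u →
      M.IsMonomial s' t' n' v → SameLine k (M.prod u v) (M.prod v u))
    {N : ℕ} (h0 : M.arrowPow 0 N = 0) (h1 : M.arrowPow 1 N = 0) :
    FiniteDimensional k M.monomialSpan := by
  have hle (i : Fin 2) (h : M.arrowPow i N = 0) (n) (hn : N ≤ n) : M.arrowPow i n = 0 := by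
    induction n, hn using Nat.le_induction with
    | base => exact h
    | succ n _ ih => rw [arrowPow, ih, zero_prod]
  have : FiniteDimensional k (Submodule.span k (Set.range
      fun p : Fin N × Fin N × G => M.planeMonomial p.1 p.2.1 p.2.2)) :=
    FiniteDimensional.span_of_finite k (Set.finite_range _)
  refine Submodule.finiteDimensional_of_le (Submodule.span_le.2 ?_) (S₂ := Submodule.span k
    (Set.range fun p : Fin N × Fin N × G => M.planeMonomial p.1 p.2.1 p.2.2))
  rintro u ⟨s, t, n, hu⟩
  obtain ⟨a, b, x, c, -, rfl⟩ := hM.sameLine_planeMonomial hφ hcomm hu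
  refine Submodule.smul_mem _ _ ?_
  by_cases ha : a < N
  · by_cases hb : b < N
    · exact Submodule.subset_span ⟨(⟨a, ha⟩, ⟨b, hb⟩, x), rfl⟩
    · rw [planeMonomial, hle 1 h1 b (by omega), prod_zero, zero_prod]
      exact zero_mem _
  · rw [planeMonomial, hle 0 h0 a (by omega), zero_prod, zero_prod]
    exact zero_mem _

/-- If the two arrows are skew-commutative and nilpotent, the Majid subalgebra that they generate
together with the vertices is finite dimensional and satisfies (R1) and (R2). -/
theorem planeSatisfiesR1R2 [Finite G] (hφ : IsNormalizedCocycle φ)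
    (hS : ∀ p : HopfPath G (Fin 2),
      M.antipode (ofPath k r p) ∈ between k r (-target r p) (-p.1) p.length)
    (hv : ∀ x i, SameLine k (M.prod (ofPath k r (vertex x)) (ofPath k r (arrow 0 i)))
      (M.prod (ofPath k r (arrow 0 i)) (ofPath k r (vertex x))))
    {q : k} (hq : q ≠ 0) (hXY : M.prod (ofPath k r (arrow 0 0)) (ofPath k r (arrow 0 1)) =
      q • M.prod (ofPath k r (arrow 0 1)) (ofPath k r (arrow 0 0)))
    {N : ℕ} (h0 : M.arrowPow 0 N = 0) (h1 : M.arrowPow 1 N = 0) : M.PlaneSatisfiesR1R2 where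
  finiteDimensional := by
    have ha : ∀ i j : Fin 2, SameLine k (M.prod (ofPath k r (arrow 0 i)) (ofPath k r (arrow 0 j)))
        (M.prod (ofPath k r (arrow 0 j)) (ofPath k r (arrow 0 i))) := by
      have hs : SameLine k _ _ := ⟨q, hq, hXY⟩
      intro i j
      fin_cases i <;> fin_cases j
      exacts [.refl _, hs, hs.symm, .refl _]
    have := hM.finiteDimensional_monomialSpan hφ
      (fun hu hv' => hM.sameLine_comm hφ hv ha hu hv') h0 h1
    -- The span of monomials is one of the Majid subalgebras in the intersection defining the
    -- generated one.
    refine Submodule.finiteDimensional_of_le (S₂ := M.monomialSpan) (sInf_le ⟨?_, ?_⟩)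
    · exact hM.isMajidSubalgebra_monomialSpan hφ hS
    · rintro u (⟨x, rfl⟩ | rfl | rfl)
      · exact (IsMonomial.vertex x).mem_monomialSpan
      · exact (IsMonomial.arrow 0).mem_monomialSpan
      · exact (IsMonomial.arrow 1).mem_monomialSpan
  isGroupLike := isGroupLikeElem_vertex
  map_add x y := (hM.vertex_mul x y).symm
  isSkewPrimitive_left := ⟨_, ⟨0, rfl⟩, _, ⟨_, rfl⟩, comul_arrow 0 0⟩
  isSkewPrimitive_right := ⟨_, ⟨0, rfl⟩, _, ⟨_, rfl⟩, comul_arrow 0 1⟩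
  generates := rfl
  skewCommute := ⟨q, hq, hXY⟩

/-- If the plane satisfies (R1) and (R2), the braidings of its two generators with themselves are
nontrivial, and the mutual braidings are inverse to each other. -/
theorem commutes_of_planeSatisfiesR1R2 [CharZero k] (hφ : IsNormalizedCocycle φ)
    (h : M.PlaneSatisfiesR1R2) :
    (∃ q : k, q ≠ 0 ∧ M.Commutes (r 0) 1 q ∧ M.Commutes (r 1) 0 q⁻¹) ∧
      ∀ i, ¬ M.Commutes (r i) i 1 := by
  refine ⟨?_, fun i hi => ?_⟩
  · obtain ⟨q, hq, hXY⟩ := h.skewCommute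
    exact ⟨q, hq, hM.commutes_of_skewCommute (by decide) hq hXY⟩
  -- For `t = 1` the quantum integers are ordinary positive integers, nonzero in characteristic
  -- zero, so no power of the arrow vanishes.
  · refine not_finiteDimensional_of_arrowPow hM (i := i)
      (hM.arrowPow_ne_zero hφ hi fun n => ?_) (fun n => ?_) h.finiteDimensional
    · simpa using Nat.cast_add_one_ne_zero (R := k) n
    · refine Submodule.mem_sInf.2 fun N hN => arrowPow_mem hM hN.1 (hN.2 ?_) n
      fin_cases i <;> simp

end IsGraded

end Plane

end MajidAlgebra

/-! ### The explicit cocycles, built from carries -/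

namespace IsNormalizedCocycle

variable {k G : Type*} [Field k] [AddCommGroup G]

theorem mul {φ ψ : G → G → G → k} (hφ : IsNormalizedCocycle φ) (hψ : IsNormalizedCocycle ψ) :
    IsNormalizedCocycle fun x y z => φ x y z * ψ x y z where
  ne_zero x y z := mul_ne_zero (hφ.ne_zero x y z) (hψ.ne_zero x y z)
  apply_zero x z := by rw [hφ.apply_zero, hψ.apply_zero, mul_one]
  cocycle x y z w := by
    rw [mul_mul_mul_comm, hφ.cocycle, hψ.cocycle]
    ring

end IsNormalizedCocycle

namespace ZMod

variable {m : ℕ} [NeZero m]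

/-- The carry of the addition of two residues modulo `m`. -/
def carry (x y : ZMod m) : ℕ := (x.val + y.val) / m

theorem carry_comm (x y : ZMod m) : carry x y = carry y x := by
  rw [carry, carry, Nat.add_comm]

theorem val_add_carry (x y : ZMod m) : (x + y).val + m * carry x y = x.val + y.val := by
  rw [ZMod.val_add, carry, Nat.mod_add_div]

theorem carry_zero_right (x : ZMod m) : carry x 0 = 0 := by
  rw [carry, ZMod.val_zero, add_zero]
  exact Nat.div_eq_of_lt (ZMod.val_lt x)

theorem carry_zero_left (x : ZMod m) : carry 0 x = 0 := by
  rw [carry_comm, carry_zero_right]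

/-- Carrying is a 2-cocycle: both sides count how many multiples of `m` are removed when adding the
three representatives. -/
theorem carry_add (x y z : ZMod m) :
    carry x (y + z) + carry y z = carry (x + y) z + carry x y := by
  have h1 := val_add_carry x (y + z)
  have h2 := val_add_carry y z
  have h3 := val_add_carry (x + y) z
  have h4 := val_add_carry x y
  rw [← add_assoc] at h1
  refine Nat.eq_of_mul_eq_mul_left (NeZero.pos m) ?_
  rw [mul_add, mul_add]
  omega

theorem pow_val_add {k : Type*} [Field k] {ζ : k} (hζ : ζ ^ m = 1) (x y : ZMod m) :
    ζ ^ (x + y).val = ζ ^ x.val * ζ ^ y.val := by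
  rw [← pow_add, ← val_add_carry x y, pow_add, pow_mul, hζ, one_pow, mul_one]

end ZMod

-- The cup product of the character `x ↦ ζ ^ (g x).val` with the 2-cocycle of carries along `f`. All
-- cocycles of the theorem are products of cocycles of this kind.
open ZMod in
theorem isNormalizedCocycle_carry {k G : Type*} [Field k] [AddCommGroup G] {m N : ℕ} [NeZero m]
    [NeZero N] (f : G →+ ZMod m) (g : G →+ ZMod N) {ζ : k} (hζ : ζ ^ N = 1) (a : ℕ) :
    IsNormalizedCocycle fun x y z => ζ ^ (a * carry (f y) (f z) * (g x).val) where
  ne_zero x y z := pow_ne_zero _ fun h => by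
    rw [h, zero_pow (NeZero.ne N)] at hζ
    exact zero_ne_one hζ
  apply_zero x z := by rw [map_zero, carry_zero_left, mul_zero, zero_mul, pow_zero]
  cocycle x y z w := by
    have h := carry_add (f y) (f z) (f w)
    have h1 : ζ ^ (a * carry (f z) (f w) * (g (x + y)).val) =
        ζ ^ (a * carry (f z) (f w) * (g x).val) * ζ ^ (a * carry (f z) (f w) * (g y).val) := by
      rw [mul_comm _ (ZMod.val _), pow_mul, map_add, pow_val_add hζ, mul_pow, ← pow_mul,
        ← pow_mul, mul_comm _ (ZMod.val _), mul_comm _ (ZMod.val _)]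
    rw [h1, ← mul_assoc, ← pow_add, map_add, map_add, ← add_mul, ← mul_add, h, mul_add, add_mul,
      pow_add]
    ring

open ZMod in
theorem isNormalizedCocycle_cocycleCyclic {k : Type*} [Field k] {m : ℕ} [NeZero m] {ζ : k}
    (hζ : ζ ^ m = 1) (a : ℕ) : IsNormalizedCocycle (cocycleCyclic m ζ a) :=
  isNormalizedCocycle_carry (AddMonoidHom.id _) (AddMonoidHom.id _) hζ a

open ZMod in
theorem isNormalizedCocycle_cocycleProd {k : Type*} [Field k] {m n : ℕ} [NeZero m] [NeZero n]
    {ζm ζn : k} (hm : ζm ^ m = 1) (hn : ζn ^ n = 1) (a b c : ℕ) :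
    IsNormalizedCocycle (cocycleProd m n ζm ζn a b c) := by
  have h := ((isNormalizedCocycle_carry (AddMonoidHom.fst (ZMod m) (ZMod n))
    (AddMonoidHom.fst (ZMod m) (ZMod n)) hm a).mul
    (isNormalizedCocycle_carry (AddMonoidHom.fst (ZMod m) (ZMod n))
      (AddMonoidHom.snd (ZMod m) (ZMod n)) hn b)).mul
    (isNormalizedCocycle_carry (AddMonoidHom.snd (ZMod m) (ZMod n))
      (AddMonoidHom.snd (ZMod m) (ZMod n)) hn c)
  convert h using 4 with x y z
  simp only [cocycleProd, carry, AddMonoidHom.coe_fst, AddMonoidHom.coe_snd,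
    Nat.add_comm (ZMod.val z.1)]

/-! ### Quasi-bimodules for cyclic groups -/

namespace ArrowBimodule

open HopfPath PathCoalgebra MajidAlgebra

section Operations

variable {k G G' ι : Type*} [Field k] [AddCommGroup G] [AddCommGroup G']

/-- Pull-back of a quasi-bimodule structure along a group homomorphism. -/
def comap {φ : G → G → G → k} (f : G' →+ G) (r : ι → G')
    (D : ArrowBimodule φ fun i => f (r i)) :
    ArrowBimodule (fun x y z => φ (f x) (f y) (f z)) r where
  L x y i := D.L (f x) (f y) i
  R x i y := D.R (f x) i (f y)
  L_zero x i := by rw [map_zero, D.L_zero]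
  R_zero x i := by rw [map_zero, D.R_zero]
  R_ne_zero x i y := D.R_ne_zero _ _ _
  left_assoc g g' x i := by simpa only [map_add] using D.left_assoc (f g) (f g') (f x) i
  middle_assoc g x i g' := by simpa only [map_add] using D.middle_assoc (f g) (f x) i (f g')
  right_assoc x i g g' := by simpa only [map_add] using D.right_assoc (f x) i (f g) (f g')

/-- The product of two quasi-bimodule structures. -/
def mul {φ ψ : G → G → G → k} {r : ι → G} (D : ArrowBimodule φ r) (E : ArrowBimodule ψ r) :
    ArrowBimodule (fun x y z => φ x y z * ψ x y z) r where
  L x y i := D.L x y i * E.L x y i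
  R x i y := D.R x i y * E.R x i y
  L_zero x i := by rw [D.L_zero, E.L_zero, _root_.mul_one]
  R_zero x i := by rw [D.R_zero, E.R_zero, _root_.mul_one]
  R_ne_zero x i y := mul_ne_zero (D.R_ne_zero _ _ _) (E.R_ne_zero _ _ _)
  left_assoc f f' x i := by
    have h := congrArg₂ (· * ·) (D.left_assoc f f' x i) (E.left_assoc f f' x i)
    linear_combination h
  middle_assoc f x i f' := by
    have h := congrArg₂ (· * ·) (D.middle_assoc f x i f') (E.middle_assoc f x i f')
    linear_combination h
  right_assoc x i f f' := by
    have h := congrArg₂ (· * ·) (D.right_assoc x i f f') (E.right_assoc x i f f')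
    linear_combination h

end Operations

open ZMod in
/-- The quasi-bimodule structure on the arrows of the Hopf quiver of `ℤ_m` with left action
twisted by characters `e ↦ ω i`. -/
def cyclic {k ι : Type*} [Field k] {m : ℕ} [NeZero m] {ζ ξ : k} (hζ : ζ ^ m = 1)
    (hξ : ξ ^ m = ζ) (a : ℕ) (r : ι → ZMod m) (ω : ι → k) (hω : ∀ i, ω i ^ m = 1) :
    ArrowBimodule (cocycleCyclic m ζ a) r where
  L f x i := ω i ^ f.val * (ζ ^ (a * carry x (r i))) ^ f.val
  -- The right axiom asks for a function of `y` that is multiplicative up to `ζ` raised to minus `a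
  -- * (r i).val` times the carry. An `m`-th root of `ζ` provides it, since a carry changes the
  -- exponent by a multiple of `m`.
  R _ i y := (ξ⁻¹) ^ (a * (r i).val * y.val)
  L_zero x i := by rw [ZMod.val_zero, pow_zero, pow_zero, _root_.mul_one]
  R_zero x i := by rw [ZMod.val_zero, mul_zero, pow_zero]
  R_ne_zero x i y := pow_ne_zero _ <| inv_ne_zero fun h => by
    rw [h, zero_pow (NeZero.ne m)] at hξ
    rw [← hξ, zero_pow (NeZero.ne m)] at hζ
    exact zero_ne_one hζ
  left_assoc f f' x i := by
    have hz (n : ℕ) : (ζ ^ n) ^ m = 1 := by rw [pow_right_comm, hζ, one_pow]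
    have h := carry_add f' x (r i)
    rw [pow_val_add (hω i), pow_val_add (hz _), add_comm (r i) x]
    simp only [cocycleCyclic]
    change ζ ^ (a * carry f' x * f.val) * _ = ζ ^ (a * carry f' (x + r i) * f.val) * _
    have e : ζ ^ (a * carry f' x * f.val) * (ζ ^ (a * carry (f' + x) (r i))) ^ f.val =
        ζ ^ (a * carry f' (x + r i) * f.val) * (ζ ^ (a * carry x (r i))) ^ f.val := by
      rw [← pow_mul, ← pow_mul, ← pow_add, ← pow_add, ← add_mul, ← add_mul, ← mul_add,
        ← mul_add, h, add_comm (carry f' x)]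
    linear_combination (ω i ^ f'.val * (ζ ^ (a * carry x (r i))) ^ f'.val * ω i ^ f.val) * e
  middle_assoc f x i f' := by
    have h := carry_add f' x (r i)
    simp only [cocycleCyclic]
    change ζ ^ (a * carry x f' * f.val) * _ = ζ ^ (a * carry (r i + x) f' * f.val) * _
    have e : ζ ^ (a * carry x f' * f.val) * (ζ ^ (a * carry (x + f') (r i))) ^ f.val =
        ζ ^ (a * carry (r i + x) f' * f.val) * (ζ ^ (a * carry x (r i))) ^ f.val := by
      rw [← pow_mul, ← pow_mul, ← pow_add, ← pow_add, ← add_mul, ← add_mul, ← mul_add,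
        ← mul_add, carry_comm x f', add_comm x f', add_comm (r i) x, carry_comm (x + r i), h,
        add_comm (carry f' x)]
    linear_combination ((ξ⁻¹) ^ (a * (r i).val * f'.val) * ω i ^ f.val) * e
  right_assoc x i f f' := by
    have hz (n : ℕ) : (ζ ^ n) ^ m = 1 := by rw [pow_right_comm, hζ, one_pow]
    have h := val_add_carry f f'
    simp only [cocycleCyclic]
    change ζ ^ (a * carry f f' * x.val) * _ = ζ ^ (a * carry f f' * (r i + x).val) * _
    have hξ0 : ξ ≠ 0 := fun h => by
      rw [h, zero_pow (NeZero.ne m)] at hξ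
      rw [← hξ, zero_pow (NeZero.ne m)] at hζ
      exact zero_ne_one hζ
    have e₁ : ζ ^ (a * carry f f' * (r i + x).val) =
        ζ ^ (a * carry f f' * (r i).val) * ζ ^ (a * carry f f' * x.val) := by
      rw [pow_mul, pow_val_add (hz _), ← pow_mul, ← pow_mul]
    have e₂ : (ξ⁻¹) ^ (a * (r i).val * f.val) * (ξ⁻¹) ^ (a * (r i).val * f'.val) =
        (ξ⁻¹) ^ (a * (r i).val * (f + f').val) * (ξ⁻¹) ^ (a * (r i).val * (m * carry f f')) := by
      rw [← pow_add, ← pow_add, ← mul_add, ← mul_add, h]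
    have e : (ξ⁻¹) ^ (a * (r i).val * (m * carry f f')) * ζ ^ (a * carry f f' * (r i).val) = 1 := by
      rw [← hξ, ← pow_mul, inv_pow, show a * (r i).val * (m * carry f f') =
        m * (a * carry f f' * (r i).val) by ring, inv_mul_cancel₀ (pow_ne_zero _ hξ0)]
    rw [e₁]
    linear_combination (-ζ ^ (a * carry f f' * x.val) * (ξ⁻¹) ^ (a * (r i).val * (f + f').val)) * e
      - ζ ^ (a * carry f f' * (r i).val) * ζ ^ (a * carry f f' * x.val) * e₂

section Plane

variable {k : Type*} [Field k] {G ι : Type*} [AddCommGroup G] {φ : G → G → G → k} {r : ι → G}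
  (D : ArrowBimodule φ r)

/-- The scalar `t` with `f X = t X f` for the arrow `X` with label `i` starting at the unit. -/
def braiding (f : G) (i : ι) : k := D.L f 0 i / D.R 0 i f

/-- The scalar by which a vertex acts on the arrow with label `i` starting at the unit. -/
def actionScalar (f : G) (i : ι) : k := D.L f 0 i * D.R f i (-f)

theorem L_ne_zero (hφ : IsNormalizedCocycle φ) (f x : G) (i : ι) : D.L f x i ≠ 0 := by
  intro h
  have := D.left_assoc (-f) f x i
  rw [h, zero_mul, mul_zero, neg_add_cancel, D.L_zero, _root_.mul_one] at this
  exact hφ.ne_zero _ _ _ this.symm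

theorem vertex_mul_arrow (f x : G) (i : ι) :
    D.mulMap (ofPath k r (vertex f) ⊗ₜ ofPath k r (arrow x i)) =
      D.L f x i • ofPath k r (arrow (f + x) i) := by
  rw [mulMap_ofPath, vertex, arrow, shuffle, shuffle, pathCons_ofPath, target_nil]
  rfl

theorem arrow_mul_vertex (f x : G) (i : ι) :
    D.mulMap (ofPath k r (arrow x i) ⊗ₜ ofPath k r (vertex f)) =
      D.R x i f • ofPath k r (arrow (x + f) i) := by
  rw [mulMap_ofPath, vertex, arrow, shuffle, shuffle, pathCons_ofPath, target_nil]
  rfl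

theorem arrow_mul_arrow (i j : ι) :
    D.mulMap (ofPath k r (arrow 0 i) ⊗ₜ ofPath k r (arrow 0 j)) =
      D.R 0 i (r j) • ofPath k r (0, [i, j]) + D.L (r i) 0 j • ofPath k r (0, [j, i]) := by
  rw [mulMap_ofPath, arrow, arrow]
  simp [shuffle, D.L_zero, D.R_zero]

theorem act_majidAlgebra (hφ : IsNormalizedCocycle φ) (f : G) (i : ι) :
    (D.majidAlgebra hφ).act f (ofPath k r (arrow 0 i)) =
      D.actionScalar f i • ofPath k r (arrow 0 i) := by
  rw [act, majidAlgebra_prod, majidAlgebra_prod, vertex_mul_arrow, add_zero,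
    ← TensorProduct.smul_tmul', map_smul, arrow_mul_vertex, add_neg_cancel, smul_smul,
    actionScalar]

theorem commutes_majidAlgebra (hφ : IsNormalizedCocycle φ) (f : G) (i : ι) :
    (D.majidAlgebra hφ).Commutes f i (D.braiding f i) := by
  rw [Commutes, majidAlgebra_prod, majidAlgebra_prod, vertex_mul_arrow, arrow_mul_vertex,
    smul_smul, braiding, div_mul_cancel₀ _ (D.R_ne_zero _ _ _), add_zero, zero_add]

theorem planeSatisfiesR1R2_majidAlgebra [Finite G] {r : Fin 2 → G} (D : ArrowBimodule φ r)
    (hφ : IsNormalizedCocycle φ) (hXY : D.braiding (r 0) 1 * D.braiding (r 1) 0 = 1)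
    {N : ℕ} (hN : N ≠ 0) (ht : ∀ i, D.braiding (r i) i ^ N = 1)
    (ht1 : ∀ i, D.braiding (r i) i ≠ 1) :
    (D.majidAlgebra hφ).PlaneSatisfiesR1R2 := by
  have hM := D.isGraded_majidAlgebra hφ
  have hp (i) : (D.majidAlgebra hφ).arrowPow i N = 0 := by
    obtain ⟨N, rfl⟩ := Nat.exists_eq_succ_of_ne_zero hN
    refine hM.arrowPow_eq_zero hφ (D.commutes_majidAlgebra hφ (r i) i) ?_
    -- From `t ^ N = 1` and `t ≠ 1`, the quantum integer of `N` vanishes.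
    have := geom_sum_mul (D.braiding (r i) i) (N + 1)
    rw [ht i, sub_self] at this
    exact (mul_eq_zero.1 this).resolve_right (sub_ne_zero.2 (ht1 i))
  have hL (x i) : D.braiding x i ≠ 0 := div_ne_zero (D.L_ne_zero hφ _ _ _) (D.R_ne_zero _ _ _)
  -- `XY` and `YX` are combinations of the same two paths of length two. With `q = D.braiding (r 0)
  -- 1`, the coefficients at the word `[1, 0]` agree by definition, and those at `[0, 1]` by this
  -- identity.
  have hXY' : D.L (r 0) 0 1 * D.L (r 1) 0 0 = D.R 0 0 (r 1) * D.R 0 1 (r 0) := by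
    have h0 := D.R_ne_zero 0 0 (r 1)
    have h1 := D.R_ne_zero 0 1 (r 0)
    simp only [braiding] at hXY
    field_simp at hXY
    linear_combination hXY
  refine hM.planeSatisfiesR1R2 hφ D.antipodeMap_mem_between (fun x i => ⟨_, hL x i,
    D.commutes_majidAlgebra hφ x i⟩) (hL (r 0) 1) ?_ (hp 0) (hp 1)
  rw [majidAlgebra_prod, majidAlgebra_prod, arrow_mul_arrow, arrow_mul_arrow, smul_add,
    smul_smul, smul_smul, add_comm, braiding, div_mul_cancel₀ _ (D.R_ne_zero _ _ _),
    div_mul_eq_mul_div, hXY', mul_div_cancel_right₀ _ (D.R_ne_zero _ _ _)]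

end Plane

section Operations

variable {k G G' ι : Type*} [Field k] [AddCommGroup G] [AddCommGroup G']

theorem braiding_comap {φ : G → G → G → k} (f : G' →+ G) (r : ι → G')
    (D : ArrowBimodule φ fun i => f (r i)) (x : G') (i : ι) :
    (D.comap f r).braiding x i = D.braiding (f x) i := by
  simp only [braiding, comap, map_zero]

theorem actionScalar_comap {φ : G → G → G → k} (f : G' →+ G) (r : ι → G')
    (D : ArrowBimodule φ fun i => f (r i)) (x : G') (i : ι) :
    (D.comap f r).actionScalar x i = D.actionScalar (f x) i := by
  simp only [actionScalar, comap, map_zero, map_neg]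

theorem braiding_mul {φ ψ : G → G → G → k} {r : ι → G} (D : ArrowBimodule φ r)
    (E : ArrowBimodule ψ r) (x : G) (i : ι) :
    (D.mul E).braiding x i = D.braiding x i * E.braiding x i :=
  mul_div_mul_comm _ _ _ _

theorem actionScalar_mul {φ ψ : G → G → G → k} {r : ι → G} (D : ArrowBimodule φ r)
    (E : ArrowBimodule ψ r) (x : G) (i : ι) :
    (D.mul E).actionScalar x i = D.actionScalar x i * E.actionScalar x i :=
  mul_mul_mul_comm _ _ _ _

theorem actionScalar_zero {φ : G → G → G → k} {r : ι → G} (D : ArrowBimodule φ r) (i : ι) :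
    D.actionScalar 0 i = 1 := by
  rw [actionScalar, neg_zero, D.L_zero, D.R_zero, _root_.mul_one]

end Operations

section Cyclic

open ZMod

variable {k ι : Type*} [Field k] {m : ℕ} [NeZero m] {ζ ξ : k}

theorem pow_root_ne_zero (hζ : ζ ^ m = 1) (hξ : ξ ^ m = ζ) : ξ ≠ 0 := fun h => by
  rw [h, zero_pow (NeZero.ne m)] at hξ
  rw [← hξ, zero_pow (NeZero.ne m)] at hζ
  exact zero_ne_one hζ

/-- The quasi-bimodule structure on the arrows of the Hopf quiver of `ℤ_m` for which the
generator of `ℤ_m` acts on the arrows starting at the unit by the scalars `μ i`. -/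
def cyclicOfAction (hζ : ζ ^ m = 1) (hξ : ξ ^ m = ζ) (a : ℕ) (r : ι → ZMod m) (μ : ι → k)
    (hμ : ∀ i, μ i ^ m = ζ ^ (a * (r i).val)) : ArrowBimodule (cocycleCyclic m ζ a) r :=
  -- The action scalar of `1` is `ω i` times `ξ⁻¹` to the power `a * (r i).val * (m - 1)`. Setting
  -- it equal to `μ i` gives this `ω i`, and `hμ` becomes `ω i ^ m = 1`.
  cyclic hζ hξ a r (fun i => μ i * ζ ^ (a * (r i).val) * (ξ⁻¹) ^ (a * (r i).val)) fun i => by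
    have h0 := pow_root_ne_zero hζ hξ
    rw [mul_pow, mul_pow, hμ, pow_right_comm ζ, hζ, one_pow, _root_.mul_one, pow_right_comm,
      inv_pow, hξ, inv_pow]
    exact mul_inv_cancel₀ (pow_ne_zero _ (hξ ▸ pow_ne_zero _ h0))

variable (hζ : ζ ^ m = 1) (hξ : ξ ^ m = ζ) (a : ℕ) (r : ι → ZMod m) (μ : ι → k)
  (hμ : ∀ i, μ i ^ m = ζ ^ (a * (r i).val))

theorem braiding_cyclicOfAction (y : ZMod m) (i : ι) :
    (cyclicOfAction hζ hξ a r μ hμ).braiding y i = (μ i * ζ ^ (a * (r i).val)) ^ y.val := by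
  have h0 := pow_root_ne_zero hζ hξ
  simp only [braiding, cyclicOfAction, cyclic, carry_zero_left, mul_zero, pow_zero, one_pow,
    _root_.mul_one]
  rw [mul_pow _ ((ξ⁻¹) ^ _), ← pow_mul]
  exact mul_div_cancel_right₀ _ (pow_ne_zero _ (inv_ne_zero h0))

theorem actionScalar_cyclicOfAction (hm : 1 < m) (i : ι) :
    (cyclicOfAction hζ hξ a r μ hμ).actionScalar 1 i = μ i := by
  have h0 := pow_root_ne_zero hζ hξ
  have h1 : (1 : ZMod m).val = 1 := ZMod.val_one'' hm.ne'
  have h2 : (-1 : ZMod m).val + 1 = m := by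
    obtain ⟨l, rfl⟩ := Nat.exists_eq_succ_of_ne_zero (NeZero.ne m)
    rw [ZMod.val_neg_one]
  simp only [actionScalar, cyclicOfAction, cyclic, carry_zero_left, mul_zero, pow_zero,
    _root_.mul_one, h1, pow_one]
  have h3 : (ξ⁻¹) ^ (a * (r i).val) * (ξ⁻¹) ^ (a * (r i).val * (-1 : ZMod m).val) =
      (ζ ^ (a * (r i).val))⁻¹ := by
    rw [← pow_add, add_comm, ← Nat.mul_succ, Nat.succ_eq_add_one, h2, mul_comm _ m, pow_mul,
      inv_pow, hξ, inv_pow]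
  have h4 : ζ ^ (a * (r i).val) ≠ 0 := pow_ne_zero _ (hξ ▸ pow_ne_zero _ h0)
  rw [mul_assoc, h3, mul_assoc, mul_inv_cancel₀ h4, _root_.mul_one]

end Cyclic

end ArrowBimodule

/-! ### Carries of multiples of the generator -/

namespace ZMod

variable {m : ℕ}

theorem carry_one_natCast (hm : 1 < m) {j : ℕ} (hj : j < m) :
    carry (1 : ZMod m) (j : ZMod m) = if j + 1 = m then 1 else 0 := by
  rw [carry, ZMod.val_one'' hm.ne', ZMod.val_natCast_of_lt hj]
  split_ifs with h
  · rw [add_comm, h, Nat.div_self (by omega)]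
  · exact Nat.div_eq_of_lt (by omega)

/-- Adding `1` repeatedly, starting from `0`, carries exactly once per turn, at `j = m - 1`. -/
theorem prod_pow_carry {k : Type*} [Field k] (hm : 1 < m) (A : k) :
    ∏ j ∈ Finset.range m, A ^ carry (1 : ZMod m) (j : ZMod m) = A := by
  rw [Finset.prod_eq_single (m - 1)]
  · rw [carry_one_natCast hm (by omega), if_pos (by omega), pow_one]
  · intro j hj hj'
    rw [carry_one_natCast hm (Finset.mem_range.1 hj), if_neg (by omega), pow_zero]
  · intro h
    exact absurd (Finset.mem_range.2 (by omega)) h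

theorem prod_pow_carry_of_lt {k : Type*} [Field k] (hm : 1 < m) (A : k) {n : ℕ} (hn : n < m) :
    ∏ j ∈ Finset.range n, A ^ carry (1 : ZMod m) (j : ZMod m) = 1 :=
  Finset.prod_eq_one fun j hj => by
    have := Finset.mem_range.1 hj
    rw [carry_one_natCast hm (by omega), if_neg (by omega), pow_zero]

theorem carry_neg_one_one (hm : 1 < m) : carry (-1 : ZMod m) 1 = 1 := by
  obtain ⟨l, rfl⟩ := Nat.exists_eq_succ_of_ne_zero (by omega : m ≠ 0)
  rw [carry, ZMod.val_neg_one, ZMod.val_one'' hm.ne', Nat.div_self (by omega)]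

end ZMod

/-! ### Constraints on commutation scalars for the explicit cocycles -/

namespace MajidAlgebra.IsGraded

open ZMod PathCoalgebra HopfPath

section Cyclic

variable {k ι : Type*} [Field k] {m : ℕ} [NeZero m] {ζ : k} {a : ℕ} {r : ι → ZMod m}
  {M : MajidAlgebra k (PathCoalgebra k r)} (hM : M.IsGraded (cocycleCyclic m ζ a))

include hM

/-- Of the three values of `φ` in `commutes_nsmul`, those with first argument `1` cancel by symmetry
of the carry; only the one with first argument `r i` survives. -/
theorem commutes_natCast_cyclic (hζ : ζ ^ m = 1) {i : ι} {t : k}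
    (h : M.Commutes 1 i t) (n : ℕ) :
    M.Commutes (n : ZMod m) i (t ^ n * ∏ j ∈ Finset.range n,
      ((ζ ^ (a * (r i).val))⁻¹) ^ carry (1 : ZMod m) (j : ZMod m)) := by
  have hφ := isNormalizedCocycle_cocycleCyclic hζ a
  have hζ0 : ζ ≠ 0 := fun h => by
    rw [h, zero_pow (NeZero.ne m)] at hζ
    exact zero_ne_one hζ
  convert hM.commutes_nsmul hφ h n using 1
  · rw [nsmul_one]
  congr 1
  refine Finset.prod_congr rfl fun j _ => ?_
  rw [nsmul_one, eq_div_iff (mul_ne_zero (hφ.ne_zero _ _ _) (hφ.ne_zero _ _ _))]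
  change _ * (ζ ^ (a * carry (j : ZMod m) (r i) * (1 : ZMod m).val) *
    ζ ^ (a * carry (1 : ZMod m) j * (r i).val)) =
      ζ ^ (a * carry (r i) (j : ZMod m) * (1 : ZMod m).val)
  rw [carry_comm (r i), mul_right_comm a _ (r i).val, pow_mul ζ (a * (r i).val), mul_left_comm,
    ← mul_pow, inv_mul_cancel₀ (pow_ne_zero _ hζ0), one_pow, _root_.mul_one]

theorem commutes_natCast_cyclic_of_lt (hm : 1 < m) (hζ : ζ ^ m = 1) {i : ι} {t : k}
    (h : M.Commutes 1 i t) {n : ℕ} (hn : n < m) : M.Commutes (n : ZMod m) i (t ^ n) := by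
  simpa only [prod_pow_carry_of_lt hm _ hn, _root_.mul_one] using
    hM.commutes_natCast_cyclic hζ h n

/-- After `m` steps the vertex is again the unit, whose scalar is `1`, while exactly one carry has
occurred. -/
theorem pow_eq_of_commutes_cyclic (hm : 1 < m) (hζ : ζ ^ m = 1) {i : ι} {t : k}
    (h : M.Commutes 1 i t) : t ^ m = ζ ^ (a * (r i).val) := by
  have hφ := isNormalizedCocycle_cocycleCyclic hζ a
  have hζ0 : ζ ≠ 0 := fun h => by
    rw [h, zero_pow (NeZero.ne m)] at hζ
    exact zero_ne_one hζ
  have h1 := hM.commutes_natCast_cyclic hζ h m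
  rw [prod_pow_carry hm, ZMod.natCast_self] at h1
  have h2 := hM.commutes_unique hφ h1 (hM.commutes_zero hφ i)
  rwa [mul_inv_eq_one₀ (pow_ne_zero _ hζ0)] at h2

theorem commutes_of_act_cyclic (hm : 1 < m) (hζ : ζ ^ m = 1) {i : ι} {μ : k}
    (h : M.act 1 (ofPath k r (arrow 0 i)) = μ • ofPath k r (arrow 0 i)) :
    M.Commutes 1 i (μ * ζ ^ (a * (r i).val)) := by
  have hφ := isNormalizedCocycle_cocycleCyclic hζ a
  have hζ0 : ζ ≠ 0 := fun h => by
    rw [h, zero_pow (NeZero.ne m)] at hζ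
    exact zero_ne_one hζ
  convert hM.commutes_of_act hφ h using 2
  rw [eq_div_iff (hφ.ne_zero _ _ _)]
  change _ * ζ ^ (a * carry (-1 : ZMod m) 1 * (1 : ZMod m).val) =
    ζ ^ (a * carry (-1 : ZMod m) 1 * (1 + r i).val)
  rw [carry_neg_one_one hm, _root_.mul_one, pow_mul, pow_mul, pow_mul, pow_val_add (by
    rw [pow_right_comm, hζ, one_pow]), mul_comm]

end Cyclic

section Prod

variable {k ι : Type*} [Field k] {m n : ℕ} [NeZero m] [NeZero n] {ζm ζn : k} {a b c : ℕ}
  {r : ι → ZMod m × ZMod n} {M : MajidAlgebra k (PathCoalgebra k r)}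
  (hM : M.IsGraded (cocycleProd m n ζm ζn a b c))

include hM

/-- A full turn in the first factor produces one carry there. The cocycle pairs that carry with both
coordinates of `r i`, through `a` and through `b`; this is where `b` constrains the arrow in the
second direction. -/
theorem pow_eq_of_commutes_left (hm : 1 < m) (hζm : ζm ^ m = 1) (hζn : ζn ^ n = 1) {i : ι}
    {t : k} (h : M.Commutes (1, 0) i t) :
    t ^ m = ζm ^ (a * (r i).1.val) * ζn ^ (b * (r i).2.val) := by
  have hφ := isNormalizedCocycle_cocycleProd hζm hζn a b c
  have hζm0 : ζm ≠ 0 := fun h => by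
    rw [h, zero_pow (NeZero.ne m)] at hζm
    exact zero_ne_one hζm
  have hζn0 : ζn ≠ 0 := fun h => by
    rw [h, zero_pow (NeZero.ne n)] at hζn
    exact zero_ne_one hζn
  have hA : ζm ^ (a * (r i).1.val) * ζn ^ (b * (r i).2.val) ≠ 0 :=
    mul_ne_zero (pow_ne_zero _ hζm0) (pow_ne_zero _ hζn0)
  have h1 := hM.commutes_nsmul hφ h m
  have h2 : m • ((1, 0) : ZMod m × ZMod n) = 0 := by ext <;> simp
  rw [h2] at h1
  have h3 := hM.commutes_unique hφ h1 (hM.commutes_zero hφ i)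
  rw [Finset.prod_congr rfl (g := fun j : ℕ => ((ζm ^ (a * (r i).1.val) *
    ζn ^ (b * (r i).2.val))⁻¹) ^ carry (1 : ZMod m) (j : ZMod m)), prod_pow_carry hm] at h3
  · rwa [mul_inv_eq_one₀ hA] at h3
  intro j _
  have e : j • ((1, 0) : ZMod m × ZMod n) = ((j : ZMod m), 0) := by ext <;> simp
  rw [e, div_eq_iff (mul_ne_zero (hφ.ne_zero _ _ _) (hφ.ne_zero _ _ _))]
  change ζm ^ (a * carry (j : ZMod m) (r i).1 * (1 : ZMod m).val) *
    ζn ^ (b * carry (j : ZMod m) (r i).1 * (0 : ZMod n).val) *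
    ζn ^ (c * carry (r i).2 0 * (0 : ZMod n).val) = _ *
    ((ζm ^ (a * carry (r i).1 (j : ZMod m) * (1 : ZMod m).val) *
      ζn ^ (b * carry (r i).1 (j : ZMod m) * (0 : ZMod n).val) *
      ζn ^ (c * carry 0 (r i).2 * (0 : ZMod n).val)) *
    (ζm ^ (a * carry (j : ZMod m) 1 * (r i).1.val) *
      ζn ^ (b * carry (j : ZMod m) 1 * (r i).2.val) *
      ζn ^ (c * carry (0 : ZMod n) 0 * (r i).2.val)))
  have e1 : ζm ^ (a * carry (j : ZMod m) 1 * (r i).1.val) *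
      ζn ^ (b * carry (j : ZMod m) 1 * (r i).2.val) =
      (ζm ^ (a * (r i).1.val) * ζn ^ (b * (r i).2.val)) ^ carry (1 : ZMod m) (j : ZMod m) := by
    rw [carry_comm (j : ZMod m), mul_pow, ← pow_mul, ← pow_mul, mul_right_comm a,
      mul_right_comm b]
  rw [e1, carry_comm (r i).1, ZMod.val_zero, carry_zero_left, carry_zero_left, carry_zero_right,
    inv_pow]
  simp only [mul_zero, zero_mul, pow_zero, _root_.mul_one]
  rw [mul_left_comm, inv_mul_cancel₀ (pow_ne_zero _ hA), _root_.mul_one]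

/-- A carry in the second factor is paired only with the second coordinate, through `c`. The
asymmetry with the first factor is what forces `b = 0` in the end. -/
theorem pow_eq_of_commutes_right (hn : 1 < n) (hζm : ζm ^ m = 1) (hζn : ζn ^ n = 1) {i : ι}
    {t : k} (h : M.Commutes (0, 1) i t) : t ^ n = ζn ^ (c * (r i).2.val) := by
  have hφ := isNormalizedCocycle_cocycleProd hζm hζn a b c
  have hζn0 : ζn ≠ 0 := fun h => by
    rw [h, zero_pow (NeZero.ne n)] at hζn
    exact zero_ne_one hζn
  have hA : ζn ^ (c * (r i).2.val) ≠ 0 := pow_ne_zero _ hζn0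
  have h1 := hM.commutes_nsmul hφ h n
  have h2 : n • ((0, 1) : ZMod m × ZMod n) = 0 := by ext <;> simp
  rw [h2] at h1
  have h3 := hM.commutes_unique hφ h1 (hM.commutes_zero hφ i)
  rw [Finset.prod_congr rfl (g := fun j : ℕ => ((ζn ^ (c * (r i).2.val))⁻¹) ^
    carry (1 : ZMod n) (j : ZMod n)), prod_pow_carry hn] at h3
  · rwa [mul_inv_eq_one₀ hA] at h3
  intro j _
  have e : j • ((0, 1) : ZMod m × ZMod n) = (0, (j : ZMod n)) := by ext <;> simp
  rw [e, div_eq_iff (mul_ne_zero (hφ.ne_zero _ _ _) (hφ.ne_zero _ _ _))]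
  change ζm ^ (a * carry 0 (r i).1 * (0 : ZMod m).val) *
    ζn ^ (b * carry 0 (r i).1 * (1 : ZMod n).val) *
    ζn ^ (c * carry (r i).2 (j : ZMod n) * (1 : ZMod n).val) = _ *
    ((ζm ^ (a * carry (r i).1 0 * (0 : ZMod m).val) *
      ζn ^ (b * carry (r i).1 0 * (1 : ZMod n).val) *
      ζn ^ (c * carry (j : ZMod n) (r i).2 * (1 : ZMod n).val)) *
    (ζm ^ (a * carry (0 : ZMod m) 0 * (r i).1.val) *
      ζn ^ (b * carry (0 : ZMod m) 0 * (r i).2.val) *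
      ζn ^ (c * carry (1 : ZMod n) (j : ZMod n) * (r i).2.val)))
  rw [mul_right_comm c _ (r i).2.val, pow_mul ζn (c * (r i).2.val), carry_comm (r i).2,
    carry_zero_left, carry_zero_left, carry_zero_right, inv_pow]
  simp only [mul_zero, zero_mul, pow_zero, _root_.one_mul]
  rw [mul_left_comm, inv_mul_cancel₀ (pow_ne_zero _ hA), _root_.mul_one]

theorem commutes_of_act_left (hm : 1 < m) (hζm : ζm ^ m = 1) (hζn : ζn ^ n = 1) {i : ι}
    (hr : (r i).2 = 0) {μ : k}
    (h : M.act (1, 0) (ofPath k r (arrow 0 i)) = μ • ofPath k r (arrow 0 i)) :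
    M.Commutes (1, 0) i (μ * ζm ^ (a * (r i).1.val)) := by
  have hφ := isNormalizedCocycle_cocycleProd hζm hζn a b c
  convert hM.commutes_of_act hφ h using 2
  rw [eq_div_iff (hφ.ne_zero _ _ _)]
  change _ * (ζm ^ (a * carry (1 : ZMod m) (-1) * (1 : ZMod m).val) *
    ζn ^ (b * carry (1 : ZMod m) (-1) * (0 : ZMod n).val) *
    ζn ^ (c * carry (-0 : ZMod n) 0 * (0 : ZMod n).val)) =
    ζm ^ (a * carry (1 : ZMod m) (-1) * (1 + (r i).1).val) *
    ζn ^ (b * carry (1 : ZMod m) (-1) * (0 + (r i).2).val) *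
    ζn ^ (c * carry (-0 : ZMod n) 0 * (0 + (r i).2).val)
  rw [hr, add_zero, carry_comm, carry_neg_one_one hm, ZMod.val_zero]
  simp only [mul_zero, pow_zero, _root_.mul_one]
  rw [pow_mul, pow_mul, pow_mul, pow_val_add (by rw [pow_right_comm, hζm, one_pow]), mul_comm]

theorem commutes_of_act_right (hn : 1 < n) (hζm : ζm ^ m = 1) (hζn : ζn ^ n = 1) {i : ι} {μ : k}
    (h : M.act (0, 1) (ofPath k r (arrow 0 i)) = μ • ofPath k r (arrow 0 i)) :
    M.Commutes (0, 1) i (μ * ζn ^ (c * (r i).2.val)) := by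
  have hφ := isNormalizedCocycle_cocycleProd hζm hζn a b c
  convert hM.commutes_of_act hφ h using 2
  rw [eq_div_iff (hφ.ne_zero _ _ _)]
  change _ * (ζm ^ (a * carry (0 : ZMod m) (-0) * (0 : ZMod m).val) *
    ζn ^ (b * carry (0 : ZMod m) (-0) * (1 : ZMod n).val) *
    ζn ^ (c * carry (-1 : ZMod n) 1 * (1 : ZMod n).val)) =
    ζm ^ (a * carry (0 : ZMod m) (-0) * (0 + (r i).1).val) *
    ζn ^ (b * carry (0 : ZMod m) (-0) * (1 + (r i).2).val) *
    ζn ^ (c * carry (-1 : ZMod n) 1 * (1 + (r i).2).val)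
  rw [carry_zero_left, carry_neg_one_one hn]
  simp only [mul_zero, zero_mul, pow_zero, _root_.mul_one, _root_.one_mul]
  rw [pow_mul, pow_mul, pow_mul, pow_val_add (by rw [pow_right_comm, hζn, one_pow]), mul_comm]

end Prod

end MajidAlgebra.IsGraded

/-! ### Quasi-bimodules for products of two cyclic groups -/

namespace ArrowBimodule

open ZMod

/-- The quasi-bimodule structure on the arrows of the Hopf quiver of `ℤ_m × ℤ_n` for which the
generators of the two factors act on the arrows starting at the unit by `μ i` and `ν i`. -/
def prodOfAction {k ι : Type*} [Field k] {m n : ℕ} [NeZero m] [NeZero n] {ζm ξm ζn ξn : k}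
    (hζm : ζm ^ m = 1) (hξm : ξm ^ m = ζm) (hζn : ζn ^ n = 1) (hξn : ξn ^ n = ζn) (a c : ℕ)
    (r : ι → ZMod m × ZMod n) (μ ν : ι → k) (hμ : ∀ i, μ i ^ m = ζm ^ (a * (r i).1.val))
    (hν : ∀ i, ν i ^ n = ζn ^ (c * (r i).2.val)) :
    ArrowBimodule (fun x y z => cocycleCyclic m ζm a x.1 y.1 z.1 *
      cocycleCyclic n ζn c x.2 y.2 z.2) r :=
  ((cyclicOfAction hζm hξm a (fun i => AddMonoidHom.fst _ _ (r i)) μ hμ).comap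
    (AddMonoidHom.fst _ _) r).mul
    ((cyclicOfAction hζn hξn c (fun i => AddMonoidHom.snd _ _ (r i)) ν hν).comap
      (AddMonoidHom.snd _ _) r)

variable {k ι : Type*} [Field k] {m n : ℕ} [NeZero m] [NeZero n] {ζm ξm ζn ξn : k}
  (hζm : ζm ^ m = 1) (hξm : ξm ^ m = ζm) (hζn : ζn ^ n = 1) (hξn : ξn ^ n = ζn) (a c : ℕ)
  (r : ι → ZMod m × ZMod n) (μ ν : ι → k) (hμ : ∀ i, μ i ^ m = ζm ^ (a * (r i).1.val))
  (hν : ∀ i, ν i ^ n = ζn ^ (c * (r i).2.val))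

theorem braiding_prodOfAction (x : ZMod m × ZMod n) (i : ι) :
    (prodOfAction hζm hξm hζn hξn a c r μ ν hμ hν).braiding x i =
      (μ i * ζm ^ (a * (r i).1.val)) ^ x.1.val * (ν i * ζn ^ (c * (r i).2.val)) ^ x.2.val :=
  (braiding_mul _ _ _ _).trans <| congrArg₂ _
    ((braiding_comap _ _ _ _ _).trans (braiding_cyclicOfAction _ _ _ _ _ _ _ _))
    ((braiding_comap _ _ _ _ _).trans (braiding_cyclicOfAction _ _ _ _ _ _ _ _))

theorem actionScalar_prodOfAction_left (hm : 1 < m) (i : ι) :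
    (prodOfAction hζm hξm hζn hξn a c r μ ν hμ hν).actionScalar (1, 0) i = μ i :=
  ((actionScalar_mul _ _ _ _).trans <| congrArg₂ _
    ((actionScalar_comap _ _ _ _ _).trans (actionScalar_cyclicOfAction _ _ _ _ _ _ hm _))
    ((actionScalar_comap _ _ _ _ _).trans (actionScalar_zero _ _))).trans (mul_one _)

theorem actionScalar_prodOfAction_right (hn : 1 < n) (i : ι) :
    (prodOfAction hζm hξm hζn hξn a c r μ ν hμ hν).actionScalar (0, 1) i = ν i :=
  ((actionScalar_mul _ _ _ _).trans <| congrArg₂ _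
    ((actionScalar_comap _ _ _ _ _).trans (actionScalar_zero _ _))
    ((actionScalar_comap _ _ _ _ _).trans (actionScalar_cyclicOfAction _ _ _ _ _ _ hn _))).trans
      (one_mul _)

end ArrowBimodule

/-- Without the mixed term, the associator is the one carried by the product of two pulled-back
cyclic bimodules. -/
theorem cocycleProd_zero_eq {k : Type*} [Field k] (m n : ℕ) (ζm ζn : k) (a c : ℕ) :
    cocycleProd m n ζm ζn a 0 c = fun x y z => cocycleCyclic m ζm a x.1 y.1 z.1 *
      cocycleCyclic n ζn c x.2 y.2 z.2 := by
  funext x y z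
  rw [cocycleProd, cocycleCyclic, cocycleCyclic, zero_mul, zero_mul, pow_zero, mul_one,
    Nat.add_comm z.1.val]

/-! ### Roots of unity and the two congruences -/

section PrimitiveRoots

variable {k : Type*} [Field k] {m : ℕ} {ζ ξ : k}

/-- An `m`-th root of a primitive `m`-th root of unity is a primitive `m²`-th root of unity. -/
theorem zpow_eq_one_iff_of_pow_eq (hζ : IsPrimitiveRoot ζ m) (hξ : ξ ^ m = ζ)
    (E : ℤ) : ξ ^ E = 1 ↔ (m ^ 2 : ℤ) ∣ E := by
  have h (F : ℤ) : ξ ^ ((m : ℤ) * F) = ζ ^ F := by rw [zpow_mul, zpow_natCast, hξ]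
  constructor
  · intro h1
    have h2 : ζ ^ E = 1 := by rw [← h, mul_comm, zpow_mul, h1, one_zpow]
    obtain ⟨F, rfl⟩ := (hζ.zpow_eq_one_iff_dvd E).1 h2
    rw [h] at h1
    rw [pow_two]
    exact mul_dvd_mul_left _ ((hζ.zpow_eq_one_iff_dvd F).1 h1)
  · rintro ⟨F, rfl⟩
    rw [pow_two, mul_assoc, h, zpow_mul, zpow_natCast, hζ.pow_eq_one, one_zpow]

theorem exists_eq_mul_zpow (hm : m ≠ 0) (hζ : IsPrimitiveRoot ζ m) (hξ : ξ ^ m = ζ) {N : ℕ}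
    {μ : k} (h : μ ^ m = ζ ^ N) : ∃ x : ℤ, μ = ξ ^ N * ζ ^ x := by
  have : NeZero m := ⟨hm⟩
  have h0 : ξ ≠ 0 := ArrowBimodule.pow_root_ne_zero hζ.pow_eq_one hξ
  have h1 : (μ / ξ ^ N) ^ m = 1 := by
    rw [div_pow, h, pow_right_comm, hξ, div_self]
    exact pow_ne_zero _ (hξ ▸ pow_ne_zero _ h0)
  obtain ⟨x, -, hx⟩ := hζ.eq_pow_of_pow_eq_one h1
  refine ⟨x, ?_⟩
  rw [zpow_natCast, hx, mul_div_cancel₀ _ (pow_ne_zero _ h0)]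

/-- The origin of the congruence modulo `m²`: with `ζ = ξ ^ m`, the left side is the product of the
two mutual braidings. -/
theorem pow_mul_pow_eq_zpow (h0 : ξ ≠ 0) (α β a : ℕ) (x y : ℤ) :
    (ξ ^ (a * α) * (ξ ^ m) ^ x * (ξ ^ m) ^ (a * α)) ^ β *
      (ξ ^ (a * β) * (ξ ^ m) ^ y * (ξ ^ m) ^ (a * β)) ^ α =
      ξ ^ (m * (β * x + α * y + 2 * a * α * β) + 2 * a * α * β : ℤ) := by
  simp only [← zpow_natCast, ← zpow_mul, ← zpow_add₀ h0]
  congr 1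
  push_cast
  ring

end PrimitiveRoots

/-- Modulo `gcd(m, n)` every term of the congruence except `b` vanishes. -/
theorem dvd_of_congruence {m n b : ℕ} {x y : ℤ}
    (h : (m * x + n * y + (m + 1) * b : ℤ) ≡ 0 [ZMOD (m * n : ℤ)]) : Nat.gcd m n ∣ b := by
  have h1 := Int.modEq_zero_iff_dvd.1 h
  have hm : ((Nat.gcd m n : ℕ) : ℤ) ∣ m := Int.natCast_dvd_natCast.2 (Nat.gcd_dvd_left m n)
  have hn : ((Nat.gcd m n : ℕ) : ℤ) ∣ n := Int.natCast_dvd_natCast.2 (Nat.gcd_dvd_right m n)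
  have h2 := (hm.mul_right n).trans h1
  rw [add_mul, one_mul, ← add_assoc] at h2
  exact Int.natCast_dvd_natCast.1 <| (dvd_add_right (((hm.mul_right x).add (hn.mul_right y)).add
    (hm.mul_right b))).1 h2

/-- Writing `q = ζ ^ u` turns the first equation into `u m ≡ b` modulo `n`, which is read modulo
`gcd(m, n)`. -/
theorem gcd_dvd_of_pow_eq {k : Type*} [Field k] {m n b : ℕ} (hn : n ≠ 0) {ζ q : k}
    (hζ : IsPrimitiveRoot ζ n) (h1 : q ^ m = ζ ^ b) (h2 : q ^ n = 1) : Nat.gcd m n ∣ b := by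
  have : NeZero n := ⟨hn⟩
  obtain ⟨u, -, rfl⟩ := hζ.eq_pow_of_pow_eq_one h2
  rw [← pow_mul] at h1
  have h3 : ((u * m : ℕ) : ℤ) ≡ b [ZMOD n] := by
    rw [Int.modEq_iff_dvd, ← hζ.zpow_eq_one_iff_dvd, zpow_sub₀ (hζ.ne_zero hn), zpow_natCast,
      zpow_natCast, h1, div_self (pow_ne_zero _ (hζ.ne_zero hn))]
  have h4 := (Int.natCast_modEq_iff.1 h3).of_dvd (Nat.gcd_dvd_right m n)
  exact (h4.dvd_iff dvd_rfl).1 ((Nat.gcd_dvd_left m n).mul_left u)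

/-! ### The two equivalences -/

open ZMod in
theorem exists_graded_prod_iff {k : Type*} [Field k] [IsAlgClosed k] [CharZero k] {m n : ℕ}
    (hm : 1 < m) (hn : 1 < n) {ζm ζn : k} (hζm : IsPrimitiveRoot ζm m)
    (hζn : IsPrimitiveRoot ζn n) {a b c : ℕ} (hb : b < Nat.gcd m n) (lam₁ eta₂ : k) :
    (∃ M : MajidAlgebra k (PathCoalgebra k (![(1, 0), (0, 1)] : Fin 2 → ZMod m × ZMod n)),
      M.IsGraded (cocycleProd m n ζm ζn a b c) ∧
      M.act (1, 0) (PathCoalgebra.ofPath k _ (.arrow 0 0)) =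
        lam₁ • PathCoalgebra.ofPath k _ (.arrow 0 0) ∧
      M.act (0, 1) (PathCoalgebra.ofPath k _ (.arrow 0 1)) =
        eta₂ • PathCoalgebra.ofPath k _ (.arrow 0 1) ∧
      M.PlaneSatisfiesR1R2) ↔
    (lam₁ ^ m = ζm ^ a ∧ eta₂ ^ n = ζn ^ c ∧
      (∃ x y : ℤ, (m * x + n * y + (m + 1) * b : ℤ) ≡ 0 [ZMOD (m * n : ℤ)]) ∧
      lam₁ ≠ 1 ∧ eta₂ ≠ 1) := by
  have : NeZero m := ⟨by omega⟩
  have : NeZero n := ⟨by omega⟩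
  have hm1 : (1 : ZMod m).val = 1 := ZMod.val_one'' hm.ne'
  have hn1 : (1 : ZMod n).val = 1 := ZMod.val_one'' hn.ne'
  have hζm1 := hζm.pow_eq_one
  have hζn1 := hζn.pow_eq_one
  constructor
  · rintro ⟨M, hM, hX, hY, h⟩
    have hφ := isNormalizedCocycle_cocycleProd hζm1 hζn1 a b c
    obtain ⟨⟨q, -, hq, hq'⟩, hne⟩ := hM.commutes_of_planeSatisfiesR1R2 hφ h
    have hX' : M.Commutes (1, 0) 0 (lam₁ * ζm ^ (a * (1 : ZMod m).val)) :=
      hM.commutes_of_act_left hm hζm1 hζn1 (i := 0) rfl hX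
    have hY' : M.Commutes (0, 1) 1 (eta₂ * ζn ^ (c * (1 : ZMod n).val)) :=
      hM.commutes_of_act_right hn hζm1 hζn1 (i := 1) hY
    rw [hm1, mul_one] at hX'
    rw [hn1, mul_one] at hY'
    have h1 : (lam₁ * ζm ^ a) ^ m =
        ζm ^ (a * (1 : ZMod m).val) * ζn ^ (b * (0 : ZMod n).val) :=
      hM.pow_eq_of_commutes_left hm hζm1 hζn1 hX'
    have h2 : (eta₂ * ζn ^ c) ^ n = ζn ^ (c * (1 : ZMod n).val) :=
      hM.pow_eq_of_commutes_right hn hζm1 hζn1 hY'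
    have h3 : q ^ m = ζm ^ (a * (0 : ZMod m).val) * ζn ^ (b * (1 : ZMod n).val) :=
      hM.pow_eq_of_commutes_left hm hζm1 hζn1 hq
    have h4 : q⁻¹ ^ n = ζn ^ (c * (0 : ZMod n).val) :=
      hM.pow_eq_of_commutes_right hn hζm1 hζn1 hq'
    rw [ZMod.val_zero, mul_zero, pow_zero, mul_one, hm1, mul_one, mul_pow, pow_right_comm ζm,
      hζm1, one_pow, mul_one] at h1
    rw [hn1, mul_one, mul_pow, pow_right_comm ζn, hζn1, one_pow, mul_one] at h2
    rw [ZMod.val_zero, mul_zero, pow_zero, one_mul, hn1, mul_one] at h3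
    rw [ZMod.val_zero, mul_zero, pow_zero, inv_pow, inv_eq_one] at h4
    -- The scalar `q` of `g` with `Y` satisfies `q ^ m = ζn ^ b`, while its inverse, the scalar of
    -- `h` with `X`, has `n`-th power `1`. Once `b = 0`, the congruence is solved by `(0, 0)`.
    have hb0 : b = 0 := Nat.eq_zero_of_dvd_of_lt (gcd_dvd_of_pow_eq (by omega) hζn h3 h4) hb
    refine ⟨h1, h2, ⟨0, 0, by simp [hb0]⟩, fun e => hne 0 ?_, fun e => hne 1 ?_⟩
    · rw [e, one_pow] at h1
      rwa [← h1, e, mul_one] at hX'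
    · rw [e, one_pow] at h2
      rwa [← h2, e, mul_one] at hY'
  · rintro ⟨h1, h2, ⟨x, y, hxy⟩, h3, h4⟩
    obtain rfl : b = 0 := Nat.eq_zero_of_dvd_of_lt (dvd_of_congruence hxy) hb
    obtain ⟨ξm, hξm⟩ := IsAlgClosed.exists_pow_nat_eq ζm (by omega : 0 < m)
    obtain ⟨ξn, hξn⟩ := IsAlgClosed.exists_pow_nat_eq ζn (by omega : 0 < n)
    have hφ := isNormalizedCocycle_cocycleProd hζm1 hζn1 a 0 c
    rw [cocycleProd_zero_eq] at hφ ⊢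
    let r : Fin 2 → ZMod m × ZMod n := ![(1, 0), (0, 1)]
    -- The two mixed actions are free to be trivial, which makes both mutual braidings `1`, so that
    -- `XY = YX`.
    let D := ArrowBimodule.prodOfAction hζm1 hξm hζn1 hξn a c r ![lam₁, 1] ![1, eta₂]
      (Fin.forall_fin_two.2 ⟨by simpa [r, hm1] using h1, by simp [r]⟩)
      (Fin.forall_fin_two.2 ⟨by simp [r], by simpa [r, hn1] using h2⟩)
    have b00 : D.braiding (r 0) 0 = lam₁ * ζm ^ a := by
      simp [D, ArrowBimodule.braiding_prodOfAction, r, hm1]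
    have b11 : D.braiding (r 1) 1 = eta₂ * ζn ^ c := by
      simp [D, ArrowBimodule.braiding_prodOfAction, r, hn1]
    have b01 : D.braiding (r 0) 1 = 1 := by
      simp [D, ArrowBimodule.braiding_prodOfAction, r]
    have b10 : D.braiding (r 1) 0 = 1 := by
      simp [D, ArrowBimodule.braiding_prodOfAction, r]
    -- The self-braidings have orders dividing `m²` and `n²`; the product serves as a common
    -- exponent.
    refine ⟨D.majidAlgebra hφ, D.isGraded_majidAlgebra hφ, ?_, ?_,
      D.planeSatisfiesR1R2_majidAlgebra hφ (by rw [b01, b10, mul_one]) (N := m * m * (n * n))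
        (mul_ne_zero (mul_ne_zero (NeZero.ne m) (NeZero.ne m))
          (mul_ne_zero (NeZero.ne n) (NeZero.ne n)))
        (Fin.forall_fin_two.2 ⟨?_, ?_⟩) (Fin.forall_fin_two.2 ⟨?_, ?_⟩)⟩
    · refine (D.act_majidAlgebra hφ _ _).trans ?_
      rw [ArrowBimodule.actionScalar_prodOfAction_left _ _ _ _ _ _ _ _ _ _ _ hm]
      rfl
    · refine (D.act_majidAlgebra hφ _ _).trans ?_
      rw [ArrowBimodule.actionScalar_prodOfAction_right _ _ _ _ _ _ _ _ _ _ _ hn]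
      rfl
    · rw [b00, pow_mul, pow_mul, pow_mul, mul_pow, h1, pow_right_comm ζm, hζm1, one_pow, mul_one,
        pow_right_comm ζm, hζm1, one_pow, one_pow, one_pow]
    · rw [b11, mul_comm (m * m), pow_mul, pow_mul, pow_mul, mul_pow, h2, pow_right_comm ζn, hζn1, one_pow,
        mul_one, pow_right_comm ζn, hζn1, one_pow, one_pow, one_pow]
    · rw [b00]
      intro e
      -- The `m`-th power removes the factor `ζm ^ a` and leaves `λ₁ ^ m = ζm ^ a = 1`, so the
      -- self-braiding is `λ₁` itself.
      have := congrArg (· ^ m) e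
      simp only [mul_pow, h1, one_pow, pow_right_comm ζm a m, hζm1, mul_one] at this
      rw [this, mul_one] at e
      exact h3 e
    · rw [b11]
      intro e
      have := congrArg (· ^ n) e
      simp only [mul_pow, h2, one_pow, pow_right_comm ζn c n, hζn1, mul_one] at this
      rw [this, mul_one] at e
      exact h4 e

open ZMod in
theorem exists_graded_cyclic_iff {k : Type*} [Field k] [CharZero k] {m : ℕ}
    (hm : 1 < m) {ζ ξ : k} (hζ : IsPrimitiveRoot ζ m) (hξ : ξ ^ m = ζ) {α β : ℕ}
    (hα : α < m) (hβ : β < m) (a : ℕ) (mu₁ mu₂ : k) :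
    (∃ M : MajidAlgebra k
        (PathCoalgebra k (![(α : ZMod m), (β : ZMod m)] : Fin 2 → ZMod m)),
      M.IsGraded (cocycleCyclic m ζ a) ∧
      M.act 1 (PathCoalgebra.ofPath k _ (.arrow 0 0)) =
        mu₁ • PathCoalgebra.ofPath k _ (.arrow 0 0) ∧
      M.act 1 (PathCoalgebra.ofPath k _ (.arrow 0 1)) =
        mu₂ • PathCoalgebra.ofPath k _ (.arrow 0 1) ∧
      M.PlaneSatisfiesR1R2) ↔
    (∃ x y : ℤ,
      (m * (β * x + α * y + 2 * a * α * β) + 2 * a * α * β : ℤ) ≡ 0 [ZMOD (m ^ 2 : ℤ)] ∧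
      mu₁ = ξ ^ (a * α) * ζ ^ x ∧ mu₂ = ξ ^ (a * β) * ζ ^ y ∧
      mu₁ ^ α ≠ 1 ∧ mu₂ ^ β ≠ 1) := by
  have : NeZero m := ⟨by omega⟩
  have hm0 : m ≠ 0 := by omega
  have hζ1 := hζ.pow_eq_one
  have hξ0 : ξ ≠ 0 := ArrowBimodule.pow_root_ne_zero hζ1 hξ
  have hφ := isNormalizedCocycle_cocycleCyclic hζ1 a
  have hαv : (α : ZMod m).val = α := ZMod.val_natCast_of_lt hα
  have hβv : (β : ZMod m).val = β := ZMod.val_natCast_of_lt hβ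
  -- The self-braiding and `μ ^ γ` differ by `ζ ^ (aγγ) = (μ ^ γ) ^ m`. If either of them is `1`,
  -- then so is this factor.
  have key {μ : k} {γ : ℕ} (h : μ ^ m = ζ ^ (a * γ)) :
      (μ * ζ ^ (a * γ)) ^ γ = 1 ↔ μ ^ γ = 1 := by
    have h' : ζ ^ (a * γ * γ) = (μ ^ γ) ^ m := by rw [pow_right_comm, h, pow_mul]
    constructor <;> intro e
    · have e' := congrArg (· ^ m) e
      simp only [mul_pow, one_pow, ← pow_mul] at e'
      rw [pow_mul μ, ← h', mul_comm _ m, pow_mul ζ m, hζ1, one_pow, mul_one] at e'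
      rwa [mul_pow, ← pow_mul, e', mul_one] at e
    · rw [mul_pow, ← pow_mul, h', e, one_pow, mul_one]
  constructor
  · rintro ⟨M, hM, hX, hY, h⟩
    obtain ⟨⟨q, hq0, hq, hq'⟩, hne⟩ := hM.commutes_of_planeSatisfiesR1R2 hφ h
    have hX' : M.Commutes 1 0 (mu₁ * ζ ^ (a * (α : ZMod m).val)) :=
      hM.commutes_of_act_cyclic hm hζ1 (i := 0) hX
    have hY' : M.Commutes 1 1 (mu₂ * ζ ^ (a * (β : ZMod m).val)) :=
      hM.commutes_of_act_cyclic hm hζ1 (i := 1) hY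
    rw [hαv] at hX'
    rw [hβv] at hY'
    have h1 : (mu₁ * ζ ^ (a * α)) ^ m = ζ ^ (a * (α : ZMod m).val) :=
      hM.pow_eq_of_commutes_cyclic hm hζ1 hX'
    have h2 : (mu₂ * ζ ^ (a * β)) ^ m = ζ ^ (a * (β : ZMod m).val) :=
      hM.pow_eq_of_commutes_cyclic hm hζ1 hY'
    rw [hαv, mul_pow, pow_right_comm ζ, hζ1, one_pow, mul_one] at h1
    rw [hβv, mul_pow, pow_right_comm ζ, hζ1, one_pow, mul_one] at h2
    obtain ⟨x, hx⟩ := exists_eq_mul_zpow hm0 hζ hξ h1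
    obtain ⟨y, hy⟩ := exists_eq_mul_zpow hm0 hζ hξ h2
    -- As `α, β < m`, no carry occurs on the way from `0` to `α` or `β`, so the mutual braidings are
    -- plain powers of the scalars of the generator.
    have e1 := hM.commutes_unique hφ (hM.commutes_natCast_cyclic_of_lt hm hζ1 hY' hα) hq
    have e2 := hM.commutes_unique hφ (hM.commutes_natCast_cyclic_of_lt hm hζ1 hX' hβ) hq'
    refine ⟨x, y, ?_, hx, hy, ?_, ?_⟩
    · rw [Int.modEq_zero_iff_dvd, ← zpow_eq_one_iff_of_pow_eq hζ hξ,
        ← pow_mul_pow_eq_zpow hξ0, hξ, ← hx, ← hy, e1, e2, inv_mul_cancel₀ hq0]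
    · intro e
      have := hM.commutes_natCast_cyclic_of_lt hm hζ1 hX' hα
      rw [(key h1).2 e] at this
      exact hne 0 this
    · intro e
      have := hM.commutes_natCast_cyclic_of_lt hm hζ1 hY' hβ
      rw [(key h2).2 e] at this
      exact hne 1 this
  · rintro ⟨x, y, hxy, hx, hy, h3, h4⟩
    have hr (N : ℕ) (z : ℤ) : (ξ ^ N * ζ ^ z) ^ m = ζ ^ N := by
      rw [mul_pow, pow_right_comm, hξ, ← zpow_natCast (ζ ^ z), ← zpow_mul, mul_comm z, zpow_mul,
        zpow_natCast ζ m, hζ1, one_zpow, mul_one]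
    have h1 : mu₁ ^ m = ζ ^ (a * α) := by rw [hx, hr]
    have h2 : mu₂ ^ m = ζ ^ (a * β) := by rw [hy, hr]
    let r : Fin 2 → ZMod m := ![(α : ZMod m), (β : ZMod m)]
    let D := ArrowBimodule.cyclicOfAction hζ1 hξ a r ![mu₁, mu₂]
      (Fin.forall_fin_two.2 ⟨by simpa [r, hαv] using h1, by simpa [r, hβv] using h2⟩)
    have b0 (f : ZMod m) : D.braiding f 0 = (mu₁ * ζ ^ (a * α)) ^ f.val := by
      simp [D, ArrowBimodule.braiding_cyclicOfAction, r, hαv]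
    have b1 (f : ZMod m) : D.braiding f 1 = (mu₂ * ζ ^ (a * β)) ^ f.val := by
      simp [D, ArrowBimodule.braiding_cyclicOfAction, r, hβv]
    have hr0 : (r 0).val = α := hαv
    have hr1 : (r 1).val = β := hβv
    -- The `m`-th power of `μ ζ ^ N` is `ζ ^ N`, whose `m`-th power is `1`; hence the exponent `m²`.
    have hN {μ : k} {N l : ℕ} (h : μ ^ m = ζ ^ N) : ((μ * ζ ^ N) ^ l) ^ (m * m) = 1 := by
      rw [pow_right_comm, pow_mul _ m m, mul_pow, h, pow_right_comm ζ, hζ1, one_pow, mul_one,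
        pow_right_comm ζ, hζ1, one_pow, one_pow]
    refine ⟨D.majidAlgebra hφ, D.isGraded_majidAlgebra hφ, ?_, ?_,
      D.planeSatisfiesR1R2_majidAlgebra hφ ?_ (N := m * m) (mul_ne_zero hm0 hm0)
        (Fin.forall_fin_two.2 ⟨?_, ?_⟩) (Fin.forall_fin_two.2 ⟨?_, ?_⟩)⟩
    · refine (D.act_majidAlgebra hφ _ _).trans ?_
      rw [ArrowBimodule.actionScalar_cyclicOfAction _ _ _ _ _ _ hm]
      rfl
    · refine (D.act_majidAlgebra hφ _ _).trans ?_
      rw [ArrowBimodule.actionScalar_cyclicOfAction _ _ _ _ _ _ hm]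
      rfl
    · rw [b0, b1, hr0, hr1, mul_comm, hx, hy, ← hξ, pow_mul_pow_eq_zpow hξ0,
        zpow_eq_one_iff_of_pow_eq hζ hξ]
      exact Int.modEq_zero_iff_dvd.1 hxy
    · rw [b0]
      exact hN h1
    · rw [b1]
      exact hN h2
    · rw [b0, hr0]
      exact mt (key h1).1 h3
    · rw [b1, hr1]
      exact mt (key h2).1 h4

end

theorem proposition2p4 {k : Type*} [Field k] [IsAlgClosed k] [CharZero k] :
    (∀ m n : ℕ, 1 < m → 1 < n →
      ∀ ζm ζn : k, IsPrimitiveRoot ζm m → IsPrimitiveRoot ζn n →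
      ∀ a b c : ℕ, a < m → b < Nat.gcd m n → c < n →
      ∀ lam₁ eta₂ : k,
        (∃ M : MajidAlgebra k
            (PathCoalgebra k (![(1, 0), (0, 1)] : Fin 2 → ZMod m × ZMod n)),
          M.IsGraded (cocycleProd m n ζm ζn a b c) ∧
          M.act (1, 0) (PathCoalgebra.ofPath k _ (.arrow 0 0)) =
            lam₁ • PathCoalgebra.ofPath k _ (.arrow 0 0) ∧
          M.act (0, 1) (PathCoalgebra.ofPath k _ (.arrow 0 1)) =
            eta₂ • PathCoalgebra.ofPath k _ (.arrow 0 1) ∧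
          M.PlaneSatisfiesR1R2) ↔
        (lam₁ ^ m = ζm ^ a ∧ eta₂ ^ n = ζn ^ c ∧
          (∃ x y : ℤ, (m * x + n * y + (m + 1) * b : ℤ) ≡ 0 [ZMOD (m * n : ℤ)]) ∧
          lam₁ ≠ 1 ∧ eta₂ ≠ 1)) ∧
    (∀ m : ℕ, 1 < m →
      ∀ ζ ξ : k, IsPrimitiveRoot ζ m → ξ ^ m = ζ →
      ∀ α β : ℕ, 0 < α → α < m → 0 < β → β < m → Nat.Coprime α β →
      ∀ a : ℕ, a < m →
      ∀ mu₁ mu₂ : k,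
        (∃ M : MajidAlgebra k
            (PathCoalgebra k (![(α : ZMod m), (β : ZMod m)] : Fin 2 → ZMod m)),
          M.IsGraded (cocycleCyclic m ζ a) ∧
          M.act 1 (PathCoalgebra.ofPath k _ (.arrow 0 0)) =
            mu₁ • PathCoalgebra.ofPath k _ (.arrow 0 0) ∧
          M.act 1 (PathCoalgebra.ofPath k _ (.arrow 0 1)) =
            mu₂ • PathCoalgebra.ofPath k _ (.arrow 0 1) ∧
          M.PlaneSatisfiesR1R2) ↔
        (∃ x y : ℤ,
          (m * (β * x + α * y + 2 * a * α * β) + 2 * a * α * β : ℤ) ≡ 0 [ZMOD (m ^ 2 : ℤ)] ∧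
          mu₁ = ξ ^ (a * α) * ζ ^ x ∧ mu₂ = ξ ^ (a * β) * ζ ^ y ∧
          mu₁ ^ α ≠ 1 ∧ mu₂ ^ β ≠ 1)) := by
  refine ⟨?_, ?_⟩
  · intro m n hm hn ζm ζn hζm hζn a b c _ hb _ lam₁ eta₂
    exact exists_graded_prod_iff hm hn hζm hζn hb lam₁ eta₂
  · intro m hm ζ ξ hζ hξ α β _ hα _ hβ _ a _ mu₁ mu₂
    exact exists_graded_cyclic_iff hm hζ hξ hα hβ a mu₁ mu₂
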